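/- **Setting.** Let $p_0=(0,0)$, $p_1=(1,0)$, $p_2=(\tfrac12,\tfrac{\sqrt3}2)$, $f_i(x)=(x+p_i)/2$ on $\mathbb R^2$, and let $K$ be the Sierpiński gasket, i.e. the unique nonempty compact set with $K=f_0(K)\cup f_1(K)\cup f_2(K)$. Let $X$ be the countable set of all finite words $w=w_1\dots w_n$ over $\{0,1,2\}$ (including the empty word $o$), with the discrete topology; write $|w|=n$, $w^-=w_1\dots w_{n-1}$ for $n\ge1$, $K_w=f_{w_1}\circ\dots\circ f_{w_n}(K)$, and $p_w=f_{w_1}\circ\dots\circ f_{w_{n-1}}(p_{w_n})$ for $n\ge1$. Fix $\lambda\in(1/5,1/3)$, $\theta\in(0,\lambda)$ and $C_1,C_2>0$. Define a symmetric conductance $c$ on $X\times X$ by $c(w,w^-)=c(w^-,w)=(3\lambda)^{-(n-1)}$ for $|w|=n\ge1$; for $|w|=|w'|=n$ with $w\ne w'$ and $K_w\cap K_{w'}\ne\emptyset$, by $c(w,w')=C_1(3\lambda)^{-n}$ if $p_w\ne p_{w'}$ and $c(w,w')=C_2(3\lambda)^{-n}$ if $p_w=p_{w'}$; and $c(x,y)=0$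 otherwise. Let $m(\{x\})=(\theta/(3\lambda))^{|x|}$ for $x\in X$; $m$ is a finite measure on $X$. Let $P(x,y)=c(x,y)/\sum_z c(x,z)$, let $G(x,y)=\sum_{n\ge0}P^{(n)}(x,y)$ be the Green function and $\mathcal K(x,y)=G(x,y)/G(o,y)$ the Martin kernel. Let $\overline X$ be the Martin compactification of $X$, i.e. the smallest compactification of the discrete space $X$ to which all functions $\mathcal K(x,\cdot)$, $x\in X$, extend continuously; regard $m$ also as a measure on $\overline X$ with $m(\overline X\setminus X)=0$. For functions $u,v$ on $X$ (or on $\overline X$) of finite energy put $$\mathcal E(u,v)=\frac12\sum_{x,y\in X}c(x,y)(u(x)-u(y))(v(x)-v(y)).$$ Let $\mathcal E_X=\mathcal E$ with domain $\mathcal F_X\subseteq L^2(X;m)$ the closure of the set $C_0(X)$ of finitely supported functions with respect to the norm $(\mathcal E(u,u)+\|u\|_{L^2(X;m)}^2)^{1/2}$, in the space of functions in $L^2(X;m)$ with $\mathcal E(u,u)<\infty$. Let $\mathcal E_{\overline X}=\mathcal E$ with domain $$\mathcal F_{\overline X}=\{u\in C(\overline X):\ \mathcal E(u,u)<\infty\}\subseteq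 L^2(\overline X;m).$$ **Part form.** For a regular Dirichlet form $(\mathcal E,\mathcal F)$ on $L^2(E;\mu)$ and an open set $D\subseteq E$, the part form on $D$ is the restriction of $\mathcal E$ to $\mathcal F_D=\{u\in\mathcal F:\ \tilde u=0\text{ q.e. on }E\setminus D\}$, regarded as a subspace of $L^2(D;\mu|_D)$. Here $\tilde u$ is a quasi-continuous version of $u$, and quasi-continuity and "q.e." (up to a set of zero capacity) refer to the $1$-capacity $\mathrm{Cap}(A)=\inf\{\mathcal E(u,u)+\|u\|_{L^2(E;\mu)}^2:\ u\in\mathcal F,\ u\ge1\ \mu\text{-a.e. on }A\}$ for open $A$, extended to all sets by taking the infimum over open supersets. **Theorem.** $(\mathcal E_{\overline X},\mathcal F_{\overline X})$ is a regular Dirichlet form on $L^2(\overline X;m)$, $X$ is an open subset of $\overline X$, and $(\mathcal E_X,\mathcal F_X)$ on $L^2(X;m)$ is the part form of $(\mathcal E_{\overline X},\mathcal F_{\overline X})$ on $X$; that is, with functions on $X$ extended by $0$ to $\overline X$, $\mathcal F_X=\{u\in\mathcal F_{\overline X}:\tilde u=0\text{ q.e. on }\overline X\setminus X\}$, and $\mathcal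 E_X=\mathcal E_{\overline X}$ on this space. -/

import Mathlib

open MeasureTheory Set Filter Topology
open scoped ENNReal

noncomputable section

/-! ### The Sierpinski gasket -/

/-- The Euclidean plane. -/
abbrev Plane : Type := EuclideanSpace ℝ (Fin 2)

/-- The vertices `p₀ = (0,0)`, `p₁ = (1,0)`, `p₂ = (1/2, √3/2)` of the triangle. -/
def cornerPt : Fin 3 → Plane :=
  ![!₂[0, 0], !₂[1, 0], !₂[1 / 2, Real.sqrt 3 / 2]]

/-- The contraction `f_i(x) = (x + p_i) / 2`. -/
def sgMap (i : Fin 3) (x : Plane) : Plane := (2⁻¹ : ℝ) • (x + cornerPt i)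

/-- `gasketNet n` is the finite set usually called `V_{n+1}`:
`V₁ = {p₀, p₁, p₂}` and `V_{n+1} = f₀(V_n) ∪ f₁(V_n) ∪ f₂(V_n)`. -/
def gasketNet : ℕ → Set Plane
  | 0 => range cornerPt
  | n + 1 => ⋃ i, sgMap i '' gasketNet n

/-- The Sierpinski gasket `K`, the closure of `⋃ V_n`; it is the unique nonempty compact set
with `K = f₀(K) ∪ f₁(K) ∪ f₂(K)`. -/
def gasket : Set Plane := closure (⋃ n, gasketNet n)

/-! ### The Sierpinski graph -/

/-- Finite words `w₁…w_n` over the letters `0, 1, 2`: the vertices of the Sierpinski graph `X`.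
The root `o` is the empty word. -/
def Word : Type := List (Fin 3)

namespace Word

instance : DecidableEq Word := inferInstanceAs (DecidableEq (List (Fin 3)))
instance : Countable Word := inferInstanceAs (Countable (List (Fin 3)))

/-- `X` carries the discrete topology and all its subsets are measurable. -/
instance : TopologicalSpace Word := ⊥
instance : DiscreteTopology Word := ⟨rfl⟩
instance : MeasurableSpace Word := ⊤
instance : DiscreteMeasurableSpace Word := ⟨fun _ => MeasurableSpace.measurableSet_top⟩

/-- The root `o`, i.e. the empty word. -/
def root : Word := ([] : List (Fin 3))

/-- The length `|w|`. -/
def len (w : Word) : ℕ := List.length w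

/-- The father `w⁻ = w₁…w_{n-1}` of `w = w₁…w_n` (only used for `w ≠ ∅`). -/
def father (w : Word) : Word := List.dropLast w

/-- `f_w = f_{w₁} ∘ … ∘ f_{w_n}`. -/
def map (w : Word) (x : Plane) : Plane := List.foldr sgMap x w

/-- The cell `K_w = f_w(K)`. -/
def cell (w : Word) : Set Plane := w.map '' gasket

/-- The point `p_w = f_{w₁…w_{n-1}}(p_{w_n})` for `n = |w| ≥ 1` (the value at the empty word is
irrelevant). The map `w ↦ p_w` is `Φ_n` on words of length `n`. -/
def pt (w : Word) : Plane := w.father.map (cornerPt (List.getLastD w 0))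

/-- `y` is the father of `x`. -/
def IsFather (x y : Word) : Prop := x ≠ root ∧ y = x.father

/-- Horizontal edges: distinct words of the same length whose cells intersect. -/
def HorizontalAdj (x y : Word) : Prop :=
  x.len = y.len ∧ x ≠ y ∧ (x.cell ∩ y.cell).Nonempty

end Word

open Classical in
/-- The conductance `c(x,y)` with parameters `lam`, `C₁`, `C₂`: it is `(3 lam)^{-n}` on a
vertical edge between levels `n` and `n+1`; on a horizontal edge of level `n` it is
`C₁ (3 lam)^{-n}` when `Φ_n(x) ≠ Φ_n(y)` (type I) and `C₂ (3 lam)^{-n}` when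
`Φ_n(x) = Φ_n(y)` (type II); it is `0` off the edges. -/
def conductance (lam C₁ C₂ : ℝ) (x y : Word) : ℝ :=
  if Word.IsFather x y then 1 / (3 * lam) ^ y.len
  else if Word.IsFather y x then 1 / (3 * lam) ^ x.len
  else if Word.HorizontalAdj x y then
    (if x.pt ≠ y.pt then C₁ else C₂) / (3 * lam) ^ x.len
  else 0

/-! ### Random walks and the Martin compactification -/

section Martin

variable {V : Type}

/-- The transition probability `P(x,y) = c(x,y) / π(x)`, `π(x) = ∑_y c(x,y)`, of the reversible
random walk with conductance `c`. -/
def transitionProb (c : V → V → ℝ) (x y : V) : ℝ := c x y / ∑' z, c x z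

open Classical in
/-- The `n`-step transition probability `P⁽ⁿ⁾(x,y)`. -/
def nStepProb (P : V → V → ℝ) : ℕ → V → V → ℝ≥0∞
  | 0, x, y => if x = y then 1 else 0
  | n + 1, x, y => ∑' z, ENNReal.ofReal (P x z) * nStepProb P n z y

/-- The Green function `G(x,y) = ∑_n P⁽ⁿ⁾(x,y)`. -/
def greenFunction (P : V → V → ℝ) (x y : V) : ℝ≥0∞ := ∑' n, nStepProb P n x y

/-- The Martin kernel `K(x,y) = G(x,y) / G(o,y)` with reference point `o`. -/
def martinKernel (P : V → V → ℝ) (o x y : V) : ℝ≥0∞ :=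
  greenFunction P x y / greenFunction P o y

open Classical in
/-- The map `y ↦ ((K(x,y))_x, (1_{x = y})_x)` into a compact product space. -/
def martinMap (P : V → V → ℝ) (o y : V) : (V → ℝ≥0∞) × (V → Bool) :=
  (fun x => martinKernel P o x y, fun x => decide (x = y))

/-- The Martin compactification: the smallest compactification of the discrete space `V` to which
all functions `K(x,·)` extend continuously. It is the closure of the image of `V` under the joint
map given by these functions together with the indicator functions of points (the latter make `V`
a discrete open subset). -/
def MartinCompactification (P : V → V → ℝ) (o : V) : Type :=
  closure (range (martinMap P o))

variable (P : V → V → ℝ) (o : V)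

instance : TopologicalSpace (MartinCompactification P o) :=
  inferInstanceAs (TopologicalSpace (closure (range (martinMap P o))))
instance : T2Space (MartinCompactification P o) :=
  inferInstanceAs (T2Space (closure (range (martinMap P o))))
instance : CompactSpace (MartinCompactification P o) :=
  isCompact_iff_compactSpace.mp (isClosed_closure (s := range (martinMap P o))).isCompact
instance : MeasurableSpace (MartinCompactification P o) := borel _
instance : BorelSpace (MartinCompactification P o) := ⟨rfl⟩

/-- The inclusion of `V` into its Martin compactification. -/
def martinIncl (y : V) : MartinCompactification P o :=
  ⟨martinMap P o y, subset_closure (mem_range_self y)⟩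

end Martin

/-! ### Dirichlet forms -/

/-- The raw data of a form on `L²(E; μ)`: a domain and a function of two variables, of which only
the values on the domain matter. -/
structure L2Form {E : Type} [MeasurableSpace E] (μ : Measure E) where
  /-- the domain `ℱ` -/
  dom : Set (Lp ℝ 2 μ)
  /-- the form `ℰ(u,v)` -/
  form : Lp ℝ 2 μ → Lp ℝ 2 μ → ℝ

namespace L2Form

variable {E : Type} [MeasurableSpace E] {μ : Measure E} (Q : L2Form μ)

/-- `ℰ₁(u,u) = ℰ(u,u) + (u,u)`. -/
def normSq₁ (u : Lp ℝ 2 μ) : ℝ := Q.form u u + ‖u‖ ^ 2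

/-- A Dirichlet form on `L²(E; μ)`: a densely defined, nonnegative definite, symmetric bilinear
form that is closed and Markovian. -/
structure IsDirichletForm : Prop where
  zero_mem : (0 : Lp ℝ 2 μ) ∈ Q.dom
  add_mem : ∀ u ∈ Q.dom, ∀ v ∈ Q.dom, u + v ∈ Q.dom
  smul_mem : ∀ (a : ℝ), ∀ u ∈ Q.dom, a • u ∈ Q.dom
  dense : Dense Q.dom
  symm : ∀ u ∈ Q.dom, ∀ v ∈ Q.dom, Q.form u v = Q.form v u
  add_left : ∀ u ∈ Q.dom, ∀ v ∈ Q.dom, ∀ w ∈ Q.dom,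
    Q.form (u + v) w = Q.form u w + Q.form v w
  smul_left : ∀ (a : ℝ), ∀ u ∈ Q.dom, ∀ v ∈ Q.dom, Q.form (a • u) v = a * Q.form u v
  nonneg : ∀ u ∈ Q.dom, 0 ≤ Q.form u u
  /-- `ℱ` is complete for `ℰ₁`. -/
  closed : ∀ u : ℕ → Lp ℝ 2 μ, (∀ n, u n ∈ Q.dom) →
    (∀ ε > 0, ∃ N, ∀ m ≥ N, ∀ n ≥ N, Q.normSq₁ (u m - u n) < ε) →
    ∃ v ∈ Q.dom, Tendsto (fun n => Q.normSq₁ (u n - v)) atTop (𝓝 0)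
  /-- The unit contraction operates. -/
  markov : ∀ u ∈ Q.dom, ∃ v ∈ Q.dom,
    (∀ᵐ x ∂μ, v x = min (max (u x) 0) 1) ∧ Q.form v v ≤ Q.form u u

variable [TopologicalSpace E]

/-- A regular Dirichlet form: the state space `E` is a locally compact separable metrizable space,
`μ` is a Radon measure with full support, and `ℱ ∩ C_c(E)` is `ℰ₁`-dense in `ℱ` and uniformly dense
in `C_c(E)`. -/
structure IsRegularDirichletForm : Prop extends Q.IsDirichletForm where
  locallyCompact : LocallyCompactSpace E
  separable : TopologicalSpace.SeparableSpace E
  metrizable : TopologicalSpace.MetrizableSpace E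
  finiteOnCompacts : IsFiniteMeasureOnCompacts μ
  fullSupport : μ.IsOpenPosMeasure
  core_dense : ∀ u ∈ Q.dom, ∀ ε > 0, ∃ v ∈ Q.dom,
    (∃ g : C(E, ℝ), HasCompactSupport g ∧ v =ᵐ[μ] g) ∧ Q.normSq₁ (u - v) < ε
  core_dense_unif : ∀ f : C(E, ℝ), HasCompactSupport f → ∀ ε > 0,
    ∃ g : C(E, ℝ), HasCompactSupport g ∧ (∃ v ∈ Q.dom, v =ᵐ[μ] g) ∧ ∀ x, |f x - g x| < ε

/-- The `1`-capacity of an open set `A`: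
`inf {ℰ₁(u,u) : u ∈ ℱ, u ≥ 1 μ-a.e. on A}`, with `inf ∅ = ∞`. -/
def capOpen (A : Set E) : ℝ≥0∞ :=
  ⨅ u ∈ {u ∈ Q.dom | ∀ᵐ x ∂μ, x ∈ A → 1 ≤ u x}, ENNReal.ofReal (Q.normSq₁ u)

/-- The `1`-capacity of an arbitrary set: the infimum of the capacities of its open supersets. -/
def cap (A : Set E) : ℝ≥0∞ := ⨅ B ∈ {B : Set E | IsOpen B ∧ A ⊆ B}, Q.capOpen B

/-- Quasi-continuous functions: continuous on the complement of open sets of arbitrarily small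
capacity. -/
def QuasiContinuous (f : E → ℝ) : Prop :=
  ∀ ε > 0, ∃ G : Set E, IsOpen G ∧ Q.cap G < ε ∧ ContinuousOn f Gᶜ

/-- `u` has a quasi-continuous version which vanishes quasi-everywhere on `A`, i.e. on `A` up to a
set of zero capacity. -/
def VanishesQEOn (u : Lp ℝ 2 μ) (A : Set E) : Prop :=
  ∃ f : E → ℝ, Q.QuasiContinuous f ∧ u =ᵐ[μ] f ∧ Q.cap {x ∈ A | f x ≠ 0} = 0

/-- Let `ι : D → E` identify `D` with an open subset of `E`, and `ν` with the restriction of `μ` to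
it. The form `R` on `L²(D; ν)` is the part form on `D` of the form `Q = (ℰ, ℱ)` on `L²(E; μ)`: its
domain is `{u ∈ ℱ : ũ = 0 q.e. on E \ D}` (such `u` vanish a.e. off `D`, hence are identified with
their restrictions to `D`), and on it the value of `R` is that of `ℰ`. -/
structure IsPartForm {D : Type} [MeasurableSpace D] [TopologicalSpace D] {ν : Measure D}
    (ι : D → E) (R : L2Form ν) : Prop where
  isOpenEmbedding : IsOpenEmbedding ι
  map_eq : ν.map ι = μ.restrict (range ι)
  mem_dom_iff : ∀ v : Lp ℝ 2 ν, v ∈ R.dom ↔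
    ∃ u ∈ Q.dom, Q.VanishesQEOn u (range ι)ᶜ ∧ v =ᵐ[ν] fun x => u (ι x)
  form_eq : ∀ v₁ v₂ : Lp ℝ 2 ν, ∀ u₁ ∈ Q.dom, ∀ u₂ ∈ Q.dom,
    Q.VanishesQEOn u₁ (range ι)ᶜ → Q.VanishesQEOn u₂ (range ι)ᶜ →
    (v₁ =ᵐ[ν] fun x => u₁ (ι x)) → (v₂ =ᵐ[ν] fun x => u₂ (ι x)) →
    R.form v₁ v₂ = Q.form u₁ u₂

end L2Form

/-! ### The two forms -/

/-- `∑_{x,y} c(x,y) (u(x) - u(y))² < ∞`. -/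
def FiniteEnergy {V : Type} (c : V → V → ℝ) (u : V → ℝ) : Prop :=
  Summable fun p : V × V => c p.1 p.2 * (u p.1 - u p.2) ^ 2

/-- `½ ∑_{x,y} c(x,y) (u(x) - u(y)) (v(x) - v(y))`. -/
def energy {V : Type} (c : V → V → ℝ) (u v : V → ℝ) : ℝ :=
  (1 / 2) * ∑' p : V × V, c p.1 p.2 * ((u p.1 - u p.2) * (v p.1 - v p.2))

/-- The measure `m` on `X` with `m({x}) = (θ / (3 lam))^{|x|}`. -/
def vertexMeasure (lam θ : ℝ) : Measure Word :=
  Measure.sum fun x => ENNReal.ofReal ((θ / (3 * lam)) ^ x.len) • Measure.dirac x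

/-- The form `(ℰ_X, ℱ_X)` on `L²(X; m)`: `ℱ_X` is the `(ℰ_X)₁`-closure of the set of functions with
finite support. -/
def formX (lam θ C₁ C₂ : ℝ) : L2Form (vertexMeasure lam θ) where
  dom := {u | FiniteEnergy (conductance lam C₁ C₂) u ∧
    ∃ φ : ℕ → Word → ℝ, (∀ n, (Function.support (φ n)).Finite) ∧
      Tendsto (fun n => energy (conductance lam C₁ C₂) (φ n - u) (φ n - u) +
        ∫ x, (φ n x - u x) ^ 2 ∂vertexMeasure lam θ) atTop (𝓝 0)}
  form u v := energy (conductance lam C₁ C₂) u v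

/-- The transition probability of the random walk on `X`. -/
def walkX (lam C₁ C₂ : ℝ) : Word → Word → ℝ := transitionProb (conductance lam C₁ C₂)

/-- The Martin compactification `X̄` of `X`. -/
abbrev XBar (lam C₁ C₂ : ℝ) : Type := MartinCompactification (walkX lam C₁ C₂) Word.root

/-- The inclusion `X → X̄`. -/
abbrev inclX (lam C₁ C₂ : ℝ) : Word → XBar lam C₁ C₂ := martinIncl (walkX lam C₁ C₂) Word.root

/-- The measure `m` regarded as a measure on `X̄` which does not charge `X̄ \ X`. -/
def measureXBar (lam θ C₁ C₂ : ℝ) : Measure (XBar lam C₁ C₂) :=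
  (vertexMeasure lam θ).map (inclX lam C₁ C₂)

/-- The form `(ℰ_X̄, ℱ_X̄)` on `L²(X̄; m)`: `ℱ_X̄` consists of the (classes of) continuous functions on
`X̄` whose restriction to `X` has finite energy. -/
def formXBar (lam θ C₁ C₂ : ℝ) : L2Form (measureXBar lam θ C₁ C₂) where
  dom := {u | ∃ f : C(XBar lam C₁ C₂, ℝ), u =ᵐ[measureXBar lam θ C₁ C₂] f ∧
    FiniteEnergy (conductance lam C₁ C₂) fun x => f (inclX lam C₁ C₂ x)}
  form u v := energy (conductance lam C₁ C₂) (fun x => u (inclX lam C₁ C₂ x))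
    (fun x => v (inclX lam C₁ C₂ x))

end

noncomputable section

/-! ### Words and adjacency of cells -/

namespace Word

/-! Since 3λ < 1, conductances grow geometrically with the level, so a function of finite energy has
increments of order (3λ)^{n/2} on the edges at level n. It is therefore bounded, with supremum
controlled by its energy and its value at the root. The root has mass 1, so the energy norm
dominates the supremum norm. Consequently nonempty subsets of X̄ have capacity bounded below
(`Admissible.le_cap`), quasi-continuity is continuity, and "q.e." means "everywhere". The part-form
claim reduces to this: a function of finite energy is a limit of finitely supported ones exactly
when its continuous extension vanishes off X. One direction is uniform convergence
(`Admissible.eq_zero_of_mem_dom_formX`), the other truncation at small height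
(`Admissible.mem_dom_formX`).

It remains to compare finite energy with continuity on X̄.

Extension. The walk hits the root from x with probability λ^{|x|}. The Doob transform by this
function has generator `gen`, and by reversibility each Martin kernel 𝒦(x,·) is a constant multiple
of `relGreen x`, a Green function of `gen`. If u has finite energy, then `gen` u decays like
(3λ)^{n/2}. The maximum principle, with a barrier depending only on the level, shows that u is a
uniform limit of finite combinations of Martin kernels (`Admissible.exists_potential_near`), so u
extends to X̄. Completeness of the form follows from this and lower semicontinuity of the energy.

Separation. `relGreen x` is harmonic for `gen` above the level of x. Two walks at the same level are
coupled: their horizontal distance roughly halves when both move to their fathers and roughly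
doubles when both move to children, and the former prevails. A Lyapunov function of the distance
gives geometric decay of increments (`Admissible.exists_decay`). Hence `relGreen x` is uniformly
close to functions built from harmonic functions on small cells of the gasket. One subdivision
multiplies the gasket energy by 3/5 and the conductances by 1/(3λ), and 1/(5λ) < 1 because λ > 1/5,
so these functions have finite energy (`Admissible.finiteEnergy_piecewise`). The continuous
functions of finite energy thus separate points (`Admissible.core_separatesPoints`), and
Stone–Weierstrass gives regularity. -/

/-- The child `w i` of the word `w`. -/
def child (w : Word) (i : Fin 3) : Word := List.append w [i]

@[simp] theorem len_root : root.len = 0 := rfl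

@[simp] theorem len_child (w : Word) (i : Fin 3) : (w.child i).len = w.len + 1 :=
  List.length_append (as := w) (bs := [i])

@[simp] theorem father_child (w : Word) (i : Fin 3) : (w.child i).father = w :=
  List.dropLast_concat (l₁ := w) (b := i)

theorem child_ne_root (w : Word) (i : Fin 3) : w.child i ≠ root := by
  intro h
  have := congrArg len h
  simp at this

theorem exists_eq_child {w : Word} (h : w ≠ root) : ∃ v i, w = child v i := by
  rcases List.eq_nil_or_concat (w : List (Fin 3)) with h' | ⟨v, i, h'⟩
  · exact absurd h' h
  · exact ⟨v, i, h'.trans List.concat_eq_append⟩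

theorem child_inj {v w : Word} {i j : Fin 3} : v.child i = w.child j ↔ v = w ∧ i = j := by
  constructor
  · intro h
    have := List.append_inj' (s₁ := v) (s₂ := w) (t₁ := [i]) (t₂ := [j]) h rfl
    exact ⟨this.1, by simpa using this.2⟩
  · rintro ⟨h, rfl⟩
    rw [h]

/-- Induction on words from the root to the leaves. -/
theorem child_induction {p : Word → Prop} (h₀ : p root) (h : ∀ w i, p w → p (w.child i))
    (w : Word) : p w :=
  List.reverseRecOn (motive := p) w h₀ h

theorem len_eq_zero {w : Word} : w.len = 0 ↔ w = root := List.length_eq_zero_iff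

theorem map_child (w : Word) (i : Fin 3) (x : Plane) :
    (w.child i).map x = w.map (sgMap i x) :=
  List.foldr_append (l := w) (l' := [i]) (f := sgMap) (b := x)

/-- Prepending a letter. -/
def prep (i : Fin 3) (w : Word) : Word := List.cons i w

/-- Induction on words from the leaves to the root. -/
theorem prep_induction {p : Word → Prop} (h₀ : p root) (h : ∀ i w, p w → p (prep i w))
    (w : Word) : p w :=
  List.rec (motive := p) h₀ (fun i w ih => h i w ih) w

theorem exists_eq_prep {w : Word} (h : w ≠ root) : ∃ i v, w = prep i v := by
  rcases List.exists_cons_of_ne_nil (l := w) h with ⟨i, v, h⟩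
  exact ⟨i, v, h⟩

@[simp] theorem len_prep (i : Fin 3) (w : Word) : (prep i w).len = w.len + 1 := rfl

theorem prep_child (i : Fin 3) (w : Word) (j : Fin 3) : prep i (w.child j) = (prep i w).child j :=
  rfl

theorem cell_prep (i : Fin 3) (w : Word) : (prep i w).cell = sgMap i '' w.cell := by
  change (fun x => sgMap i (w.map x)) '' gasket = _
  rw [cell, image_image]

/-! ### Combinatorial description of touching cells. -/

/-- The corner `j` of the cell of `x` is the corner `i` of the cell of `y`, for two different words
`x`, `y` of the same length. -/
inductive Meet : Word → Fin 3 → Word → Fin 3 → Prop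
  | base (v : Word) (i j : Fin 3) (h : i ≠ j) : Meet (v.child i) j (v.child j) i
  | step (x y : Word) (j i : Fin 3) (h : Meet x j y i) : Meet (x.child j) j (y.child i) i

theorem Meet.symm {x y : Word} {i j : Fin 3} (h : Meet x j y i) : Meet y i x j := by
  induction h with
  | base v i j h => exact .base v j i h.symm
  | step x y j i _ ih => exact .step _ _ _ _ ih

theorem Meet.len_eq {x y : Word} {i j : Fin 3} (h : Meet x j y i) : x.len = y.len := by
  induction h with
  | base v i j h => simp
  | step x y j i _ ih => simp [ih]

theorem Meet.letter_ne {x y : Word} {i j : Fin 3} (h : Meet x j y i) : i ≠ j := by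
  induction h with
  | base v i j h => exact h
  | step x y j i _ ih => exact ih

theorem Meet.ne {x y : Word} {i j : Fin 3} (h : Meet x j y i) : x ≠ y := by
  cases h with
  | base v i j h => simp [child_inj, h]
  | step x y j i h => simp [child_inj, h.letter_ne.symm]

theorem Meet.father {x y : Word} {i j : Fin 3} (h : Meet x j y i) :
    x.father = y.father ∨ Meet x.father j y.father i := by
  cases h with
  | base v i j h => simp
  | step x y j i h => right; simpa using h

/-- The last letter of `x` decides the constructor: it differs from the corner `j` in `base` and
equals it in `step`. So a corner of a cell is shared with at most one other cell of its level. -/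
theorem Meet.unique {x y y' : Word} {j i i' : Fin 3} (h : Meet x j y i) (h' : Meet x j y' i') :
    y = y' ∧ i = i' := by
  induction h generalizing y' i' with
  | base v i j h =>
    generalize hx : v.child i = x at h'
    cases h' with
    | base v' i'' j h' =>
      obtain ⟨rfl, rfl⟩ := child_inj.1 hx
      exact ⟨rfl, rfl⟩
    | step x y j i' h' => exact absurd (child_inj.1 hx).2 h
  | step x y j i h ih =>
    generalize hx : x.child j = z at h'
    cases h' with
    | base v' i'' j h' => exact absurd (child_inj.1 hx).2.symm h'
    | step x' y' j i' h' =>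
      obtain ⟨rfl, -⟩ := child_inj.1 hx
      obtain ⟨rfl, rfl⟩ := ih h'
      exact ⟨rfl, rfl⟩

theorem Meet.prep {x y : Word} {i j : Fin 3} (a : Fin 3) (h : Meet x j y i) :
    Meet (Word.prep a x) j (Word.prep a y) i := by
  induction h with
  | base v i j h => rw [prep_child, prep_child]; exact .base _ _ _ h
  | step x y j i _ ih => rw [prep_child, prep_child]; exact .step _ _ _ _ ih

/-! ### Barycentric coordinates: cells meet only at corners. -/

/-- The barycentric coordinates of the plane with respect to the three corner points. -/
def bary (j : Fin 3) (x : Plane) : ℝ :=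
  ![1 - x 0 - x 1 / Real.sqrt 3, x 0 - x 1 / Real.sqrt 3, 2 * x 1 / Real.sqrt 3] j

theorem bary_cornerPt (i j : Fin 3) : bary j (cornerPt i) = if i = j then 1 else 0 := by
  have h : Real.sqrt 3 ≠ 0 := by positivity
  fin_cases i <;> fin_cases j <;> simp [bary, cornerPt] <;> field_simp <;> norm_num

theorem bary_sgMap (i j : Fin 3) (x : Plane) :
    bary j (sgMap i x) = (bary j x + if i = j then 1 else 0) / 2 := by
  rw [← bary_cornerPt]
  fin_cases j <;> simp [bary, sgMap] <;> ring

theorem sum_bary (x : Plane) : ∑ j, bary j x = 1 := by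
  simp [Fin.sum_univ_three, bary]; ring

theorem continuous_bary (j : Fin 3) : Continuous (bary j) := by
  have h : ∀ j, Continuous (bary j) := by
    rw [Fin.forall_fin_succ, Fin.forall_fin_two]
    refine ⟨?_, ?_, ?_⟩ <;> unfold bary <;> simp <;> fun_prop
  exact h j

theorem bary_nonneg_of_mem_gasket {x : Plane} (hx : x ∈ gasket) (j : Fin 3) : 0 ≤ bary j x := by
  have hcl : IsClosed {x | 0 ≤ bary j x} := isClosed_le continuous_const (continuous_bary j)
  refine closure_minimal ?_ hcl hx
  refine iUnion_subset fun n => ?_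
  induction n with
  | zero =>
    rintro _ ⟨i, rfl⟩
    simp only [mem_ofPred_eq, bary_cornerPt]
    split_ifs <;> norm_num
  | succ n ih =>
    refine iUnion_subset fun i => ?_
    rintro _ ⟨y, hy, rfl⟩
    have := ih hy
    simp only [mem_ofPred_eq, bary_sgMap] at this ⊢
    split_ifs <;> linarith

theorem bary_nonneg_of_mem_cell {w : Word} {x : Plane} (hx : x ∈ w.cell) (j : Fin 3) :
    0 ≤ bary j x := by
  induction w using prep_induction generalizing x with
  | h₀ =>
    obtain ⟨y, hy, rfl⟩ := hx
    exact bary_nonneg_of_mem_gasket hy j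
  | h i w ih =>
    rw [cell_prep] at hx
    obtain ⟨y, hy, rfl⟩ := hx
    have := ih hy
    rw [bary_sgMap]
    split_ifs <;> linarith

theorem bary_le_one_of_mem_cell {w : Word} {x : Plane} (hx : x ∈ w.cell) (j : Fin 3) :
    bary j x ≤ 1 := by
  rw [← sum_bary x]
  exact Finset.single_le_sum (fun i _ => bary_nonneg_of_mem_cell hx i) (Finset.mem_univ j)

/-- The word `j…j` of length `n`. -/
def const (j : Fin 3) (n : ℕ) : Word := List.replicate n j

theorem const_succ (j : Fin 3) (n : ℕ) : const j (n + 1) = (const j n).child j :=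
  List.replicate_succ'

/-- A map `sgMap i` with `i ≠ j` at least halves the distance budget of coordinate `j`, leaving it
at most 1/2; only repeated use of `sgMap j` can reach the value 1. -/
theorem eq_const_of_bary_eq_one {w : Word} {x : Plane} (hx : x ∈ w.cell) {j : Fin 3}
    (h : bary j x = 1) : w = const j w.len := by
  induction w using prep_induction generalizing x with
  | h₀ => rfl
  | h i w ih =>
    rw [cell_prep] at hx
    obtain ⟨y, hy, rfl⟩ := hx
    rw [bary_sgMap] at h
    have h1 := bary_le_one_of_mem_cell hy j
    split_ifs at h with hij
    · subst hij
      have := ih hy (by linarith)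
      change List.cons i w = List.replicate (List.length w + 1) i
      rw [List.replicate_succ]
      exact congrArg _ this
    · linarith

theorem meet_prep_const (i j : Fin 3) (h : i ≠ j) (n : ℕ) :
    Meet (prep i (const j n)) j (prep j (const i n)) i := by
  induction n with
  | zero => exact .base root i j h
  | succ n ih =>
    rw [const_succ, const_succ, prep_child, prep_child]
    exact .step _ _ _ _ ih

theorem sgMap_injective (i : Fin 3) : Function.Injective (sgMap i) := by
  intro x y h
  have := smul_right_injective Plane (by norm_num : (2⁻¹ : ℝ) ≠ 0) h
  simpa using this

theorem Meet.of_cell_inter {x y : Word} (hl : x.len = y.len) (hne : x ≠ y)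
    (h : (x.cell ∩ y.cell).Nonempty) : ∃ j i, Meet x j y i := by
  induction x using prep_induction generalizing y with
  | h₀ => exact absurd (len_eq_zero.1 hl.symm).symm hne
  | h i x ih =>
    obtain ⟨j, y, rfl⟩ : ∃ j v, y = Word.prep j v := exists_eq_prep (by rintro rfl; simp at hl)
    have hl' : x.len = y.len := by simpa using hl
    rw [cell_prep, cell_prep] at h
    obtain ⟨_, ⟨a, ha, rfl⟩, ⟨b, hb, hab⟩⟩ := h
    by_cases hij : i = j
    · subst hij
      have : b = a := sgMap_injective i hab
      subst this
      obtain ⟨l, k, hm⟩ := ih hl' (fun h => hne (by rw [h])) ⟨b, ha, hb⟩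
      exact ⟨l, k, hm.prep i⟩
    · have h1 := congrArg (bary j) hab
      have h2 := congrArg (bary i) hab
      simp only [bary_sgMap, if_true, hij, if_false, Ne.symm hij] at h1 h2
      have := bary_le_one_of_mem_cell ha j
      have := bary_le_one_of_mem_cell hb i
      have := bary_nonneg_of_mem_cell ha i
      have := bary_nonneg_of_mem_cell hb j
      -- With different first letters, comparing coordinate `j` gives `bary j a = bary j b + 1`,
      -- which forces `bary j a = 1`; symmetrically `bary i b = 1`. The common point is the midpoint
      -- of the edge between the corners `i` and `j`.
      have e1 := eq_const_of_bary_eq_one ha (j := j) (by linarith)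
      have e2 := eq_const_of_bary_eq_one hb (j := i) (by linarith)
      refine ⟨j, i, ?_⟩
      rw [e1, e2, ← hl']
      exact meet_prep_const i j hij _

theorem sgMap_cornerPt_self (i : Fin 3) : sgMap i (cornerPt i) = cornerPt i := by
  rw [sgMap, ← two_smul ℝ, smul_smul]
  norm_num

theorem sgMap_cornerPt_comm (i j : Fin 3) : sgMap i (cornerPt j) = sgMap j (cornerPt i) := by
  rw [sgMap, sgMap, add_comm]

theorem Meet.map_eq {x y : Word} {i j : Fin 3} (h : Meet x j y i) :
    x.map (cornerPt j) = y.map (cornerPt i) := by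
  induction h with
  | base v i j h => rw [map_child, map_child, sgMap_cornerPt_comm]
  | step x y j i _ ih => rw [map_child, map_child, sgMap_cornerPt_self, sgMap_cornerPt_self, ih]

theorem map_cornerPt_mem_cell (w : Word) (i : Fin 3) : w.map (cornerPt i) ∈ w.cell :=
  ⟨_, subset_closure (mem_iUnion.2 ⟨0, mem_range_self i⟩), rfl⟩

theorem horizontalAdj_iff {x y : Word} : HorizontalAdj x y ↔ ∃ j i, Meet x j y i := by
  constructor
  · rintro ⟨h1, h2, h3⟩
    exact Meet.of_cell_inter h1 h2 h3
  · rintro ⟨j, i, h⟩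
    refine ⟨h.len_eq, h.ne, x.map (cornerPt j), map_cornerPt_mem_cell _ _, ?_⟩
    rw [h.map_eq]
    exact map_cornerPt_mem_cell _ _

theorem HorizontalAdj.symm {x y : Word} (h : HorizontalAdj x y) : HorizontalAdj y x :=
  ⟨h.1.symm, h.2.1.symm, by rw [inter_comm]; exact h.2.2⟩

theorem horizontalAdj_child {v : Word} {i j : Fin 3} (h : i ≠ j) :
    HorizontalAdj (v.child i) (v.child j) :=
  horizontalAdj_iff.2 ⟨_, _, .base v i j h⟩

theorem HorizontalAdj.father {x y : Word} (h : HorizontalAdj x y) :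
    x.father = y.father ∨ HorizontalAdj x.father y.father := by
  obtain ⟨j, i, h⟩ := horizontalAdj_iff.1 h
  exact h.father.imp id fun h => horizontalAdj_iff.2 ⟨_, _, h⟩

/-- Two consecutive horizontal steps amount to at most one step of the fathers. -/
theorem HorizontalAdj.father_trans {x y z : Word} (h₁ : HorizontalAdj x y)
    (h₂ : HorizontalAdj y z) :
    x.father = z.father ∨ HorizontalAdj x.father z.father := by
  obtain ⟨j, i, h⟩ := horizontalAdj_iff.1 h₁
  obtain ⟨k, l, h'⟩ := horizontalAdj_iff.1 h₂
  rw [horizontalAdj_iff]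
  cases h with
  | base v i j h =>
    rcases h'.father with h2 | h2
    · left; simpa using h2
    · right; exact ⟨_, _, by simpa using h2⟩
  | step x y j i h =>
    generalize hy : y.child i = y' at h'
    cases h' with
    | base v' i' k' _ =>
      obtain ⟨rfl, rfl⟩ := child_inj.1 hy
      right; exact ⟨_, _, by simpa using h⟩
    -- Both edges leave the middle word through the corner named by its last letter. The fathers of
    -- `x` and `z` then meet the same corner of its father, so they coincide by uniqueness.
    | step y'' z k l h' =>
      obtain ⟨rfl, rfl⟩ := child_inj.1 hy
      left
      simpa using (h.symm.unique h').1

/-! ### Finite levels and horizontal neighbours. -/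

/-- The words of length `n`. -/
def level (n : ℕ) : Finset Word := (List.finite_length_eq (Fin 3) n).toFinset

@[simp] theorem mem_level {n : ℕ} {w : Word} : w ∈ level n ↔ w.len = n :=
  Set.Finite.mem_toFinset _

/-- The words of length at most `n`. -/
def upTo (n : ℕ) : Finset Word := (List.finite_length_le (Fin 3) n).toFinset

@[simp] theorem mem_upTo {n : ℕ} {w : Word} : w ∈ upTo n ↔ w.len ≤ n :=
  Set.Finite.mem_toFinset _

open Classical in
/-- The horizontal neighbours of a word. -/
def hor (x : Word) : Finset Word := (level x.len).filter (HorizontalAdj x)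

@[simp] theorem mem_hor {x y : Word} : y ∈ hor x ↔ HorizontalAdj x y := by
  simp only [hor, Finset.mem_filter, mem_level, and_iff_right_iff_imp]
  exact fun h => h.1.symm

/-- By `Meet.unique`, a neighbour is determined by the corner of `x` at which it meets `x`, and
there are three corners. -/
theorem card_hor_le (x : Word) : (hor x).card ≤ 3 := by
  classical
  choose! f g hfg using fun y (hy : y ∈ hor x) => horizontalAdj_iff.1 (mem_hor.1 hy)
  have : Set.InjOn f (hor x) := by
    intro y hy z hz h
    have h1 := hfg y hy
    have h2 := hfg z hz
    rw [h] at h1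
    exact (h1.unique h2).1
  simpa using Finset.card_le_card_of_injOn (t := Finset.univ) f (fun _ _ => Finset.mem_univ _) this

end Word

end

noncomputable section

/-! ### The weighted graph -/

namespace Word

/-- The father of a word, the children and the horizontal neighbours. -/
def nbhd (x : Word) : Finset Word :=
  (if x = root then ∅ else {x.father}) ∪ (Finset.univ.image x.child ∪ hor x)

theorem len_father {x : Word} (h : x ≠ root) : x.father.len + 1 = x.len := by
  obtain ⟨v, i, rfl⟩ := exists_eq_child h
  simp

theorem child_injective (x : Word) : Function.Injective x.child := fun _ _ h => (child_inj.1 h).2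

theorem sum_nbhd (x : Word) {M : Type*} [AddCommMonoid M] (f : Word → M) :
    ∑ z ∈ nbhd x, f z =
      (if x = root then 0 else f x.father) + (∑ i, f (x.child i) + ∑ z ∈ hor x, f z) := by
  rw [nbhd, Finset.sum_union, Finset.sum_union, Finset.sum_image (x.child_injective.injOn)]
  · split_ifs <;> simp
  · rw [Finset.disjoint_left]
    intro z hz hz'
    obtain ⟨i, -, rfl⟩ := Finset.mem_image.1 hz
    have := (mem_hor.1 hz').1
    simp at this
  · rw [Finset.disjoint_left]
    intro z hz hz'
    split_ifs at hz with h
    · simp at hz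
    · rw [Finset.mem_singleton] at hz
      subst hz
      have hl := len_father h
      rcases Finset.mem_union.1 hz' with hz' | hz'
      · obtain ⟨i, -, h'⟩ := Finset.mem_image.1 hz'
        have := congrArg len h'
        simp at this
        omega
      · have := (mem_hor.1 hz').1
        omega

theorem mem_nbhd {x z : Word} :
    z ∈ nbhd x ↔ IsFather x z ∨ IsFather z x ∨ HorizontalAdj x z := by
  simp only [nbhd, Finset.mem_union, mem_hor, IsFather]
  refine or_congr ?_ (or_congr ?_ Iff.rfl)
  · split_ifs with h <;> simp [h]
  · constructor
    · intro h
      obtain ⟨i, -, rfl⟩ := Finset.mem_image.1 h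
      exact ⟨child_ne_root _ _, (father_child _ _).symm⟩
    · rintro ⟨h, rfl⟩
      obtain ⟨v, i, rfl⟩ := exists_eq_child h
      simp [child_inj]

theorem mem_nbhd_comm {x z : Word} : z ∈ nbhd x ↔ x ∈ nbhd z := by
  rw [mem_nbhd, mem_nbhd]
  constructor
  all_goals
    rintro (h | h | h)
    · exact Or.inr (Or.inl h)
    · exact Or.inl h
    · exact Or.inr (Or.inr h.symm)

theorem child_mem_nbhd (x : Word) (i : Fin 3) : x.child i ∈ nbhd x :=
  mem_nbhd.2 (Or.inr (Or.inl ⟨child_ne_root _ _, (father_child _ _).symm⟩))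

theorem father_mem_nbhd {x : Word} (h : x ≠ root) : x.father ∈ nbhd x :=
  mem_nbhd.2 (Or.inl ⟨h, rfl⟩)

theorem card_nbhd_le (x : Word) : (nbhd x).card ≤ 7 := by
  have h := sum_nbhd x (fun _ => 1)
  simp only [Finset.sum_const, smul_eq_mul, mul_one, Finset.card_univ, Fintype.card_fin] at h
  have := card_hor_le x
  split_ifs at h <;> omega

open Classical in
/-- The weight of a horizontal edge. -/
def weight (C₁ C₂ : ℝ) (x y : Word) : ℝ := if x.pt ≠ y.pt then C₁ else C₂

/-- The standing assumptions on the parameters. -/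
structure Admissible (lam C₁ C₂ : ℝ) : Prop where
  lam_gt : 1 / 5 < lam
  lam_lt : lam < 1 / 3
  C₁_pos : 0 < C₁
  C₂_pos : 0 < C₂

section

variable {lam C₁ C₂ : ℝ}

theorem Admissible.lam_pos (A : Admissible lam C₁ C₂) : 0 < lam := by linarith [A.lam_gt]

theorem Admissible.three_pos (A : Admissible lam C₁ C₂) : 0 < 3 * lam := by linarith [A.lam_pos]

theorem Admissible.three_lt (A : Admissible lam C₁ C₂) : 3 * lam < 1 := by linarith [A.lam_lt]

theorem weight_comm (x y : Word) : weight C₁ C₂ x y = weight C₁ C₂ y x := by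
  simp only [weight, ne_comm]

theorem Admissible.weight_pos (A : Admissible lam C₁ C₂) (x y : Word) : 0 < weight C₁ C₂ x y := by
  unfold weight
  split_ifs
  exacts [A.C₁_pos, A.C₂_pos]

theorem min_le_weight (x y : Word) :
    min C₁ C₂ ≤ weight C₁ C₂ x y := by
  unfold weight
  split_ifs
  exacts [min_le_left _ _, min_le_right _ _]

theorem Admissible.weight_le (A : Admissible lam C₁ C₂) (x y : Word) :
    weight C₁ C₂ x y ≤ C₁ + C₂ := by
  unfold weight
  have := A.C₁_pos
  have := A.C₂_pos
  split_ifs <;> linarith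

theorem conductance_father {x : Word} (h : x ≠ root) :
    conductance lam C₁ C₂ x x.father = 1 / (3 * lam) ^ x.father.len :=
  if_pos ⟨h, rfl⟩

theorem conductance_child (x : Word) (i : Fin 3) :
    conductance lam C₁ C₂ x (x.child i) = 1 / (3 * lam) ^ x.len := by
  rw [conductance, if_neg, if_pos ⟨child_ne_root _ _, (father_child _ _).symm⟩]
  rintro ⟨h, h'⟩
  have := congrArg len h'
  have := len_father h
  simp at *
  omega

theorem HorizontalAdj.not_isFather {x y : Word} (h : HorizontalAdj x y) : ¬ IsFather x y := by
  rintro ⟨h', rfl⟩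
  have := len_father h'
  have := h.1
  omega

theorem conductance_hor {x y : Word} (h : HorizontalAdj x y) :
    conductance lam C₁ C₂ x y = weight C₁ C₂ x y / (3 * lam) ^ x.len := by
  rw [conductance, if_neg h.not_isFather, if_neg h.symm.not_isFather, if_pos h, weight]

theorem conductance_eq_zero {x y : Word} (h : y ∉ nbhd x) : conductance lam C₁ C₂ x y = 0 := by
  rw [mem_nbhd] at h
  push Not at h
  rw [conductance, if_neg h.1, if_neg h.2.1, if_neg h.2.2]

theorem conductance_comm (x y : Word) :
    conductance lam C₁ C₂ x y = conductance lam C₁ C₂ y x := by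
  by_cases h : y ∈ nbhd x
  · rcases mem_nbhd.1 h with h | h | h
    · obtain ⟨v, i, rfl⟩ := exists_eq_child h.1
      obtain rfl := h.2.trans (father_child _ _)
      rw [conductance_child]
      have := conductance_father (lam := lam) (C₁ := C₁) (C₂ := C₂) (child_ne_root y i)
      rw [father_child] at this
      rw [this]
    · obtain ⟨v, i, rfl⟩ := exists_eq_child h.1
      obtain rfl := h.2.trans (father_child _ _)
      rw [conductance_child]
      have := conductance_father (lam := lam) (C₁ := C₁) (C₂ := C₂) (child_ne_root x i)
      rw [father_child] at this
      rw [this]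
    · rw [conductance_hor h, conductance_hor h.symm, weight_comm, h.1]
  · rw [conductance_eq_zero h, conductance_eq_zero (mt mem_nbhd_comm.2 h)]

/-- The conductances at `x` are at most `(1 + C₁ + C₂) (3 lam)^{-|x|}`. -/
theorem Admissible.conductance_le (A : Admissible lam C₁ C₂) (x y : Word) :
    conductance lam C₁ C₂ x y ≤ (1 + C₁ + C₂) / (3 * lam) ^ x.len := by
  have h3 := A.three_pos
  have h3' := A.three_lt
  have hC₁ := A.C₁_pos
  have hC₂ := A.C₂_pos
  by_cases h : y ∈ nbhd x
  · rcases mem_nbhd.1 h with h | h | h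
    · obtain ⟨v, i, rfl⟩ := exists_eq_child h.1
      obtain rfl := h.2.trans (father_child _ _)
      rw [conductance_comm, conductance_child, len_child]
      gcongr ?_ / ?_
      · linarith
      · exact pow_le_pow_of_le_one h3.le h3'.le (Nat.le_succ _)
    · obtain ⟨v, i, rfl⟩ := exists_eq_child h.1
      obtain rfl := h.2.trans (father_child _ _)
      rw [conductance_child]
      gcongr
      linarith
    · rw [conductance_hor h]
      gcongr
      linarith [A.weight_le x y]
  · rw [conductance_eq_zero h]
    positivity

/-- The smallest relative conductance. -/
def minCond (lam C₁ C₂ : ℝ) : ℝ := min (3 * lam) (min C₁ C₂)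

theorem Admissible.minCond_pos (A : Admissible lam C₁ C₂) : 0 < minCond lam C₁ C₂ :=
  lt_min A.three_pos (lt_min A.C₁_pos A.C₂_pos)

theorem Admissible.le_conductance (A : Admissible lam C₁ C₂) {x y : Word} (h : y ∈ nbhd x) :
    minCond lam C₁ C₂ / (3 * lam) ^ x.len ≤ conductance lam C₁ C₂ x y := by
  have h3 := A.three_pos
  have h3' := A.three_lt
  have hm : minCond lam C₁ C₂ ≤ 3 * lam := min_le_left _ _
  rcases mem_nbhd.1 h with h | h | h
  · obtain ⟨v, i, rfl⟩ := exists_eq_child h.1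
    obtain rfl := h.2.trans (father_child _ _)
    -- The edge to the father belongs to the previous level, so in units of (3λ)^{-|x|} its
    -- conductance is only 3λ. This is why 3λ enters `minCond`.
    rw [conductance_comm, conductance_child, len_child, div_le_div_iff₀ (by positivity)
      (by positivity), pow_succ, one_mul, mul_comm]
    gcongr
  · obtain ⟨v, i, rfl⟩ := exists_eq_child h.1
    obtain rfl := h.2.trans (father_child _ _)
    rw [conductance_child]
    gcongr
    linarith
  · rw [conductance_hor h]
    gcongr
    exact (min_le_right _ _).trans (min_le_weight _ _)

theorem Admissible.conductance_pos (A : Admissible lam C₁ C₂) {x y : Word} (h : y ∈ nbhd x) :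
    0 < conductance lam C₁ C₂ x y :=
  lt_of_lt_of_le (div_pos A.minCond_pos (pow_pos A.three_pos _)) (A.le_conductance h)

theorem Admissible.conductance_nonneg (A : Admissible lam C₁ C₂) (x y : Word) :
    0 ≤ conductance lam C₁ C₂ x y := by
  by_cases h : y ∈ nbhd x
  · exact (A.conductance_pos h).le
  · rw [conductance_eq_zero h]

/-! ### The generator of the random walk conditioned to return to the root -/

/-- The generator of the walk conditioned to hit the root (and killed there), up to the speed. -/
def gen (lam C₁ C₂ : ℝ) (F : Word → ℝ) (x : Word) : ℝ :=
  (if x = root then -(3 * (1 - lam)) * F x else 3 * (F x.father - F x)) +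
    lam * ∑ i, (F (x.child i) - F x) + ∑ z ∈ hor x, weight C₁ C₂ x z * (F z - F x)

theorem gen_add (F G : Word → ℝ) (x : Word) :
    gen lam C₁ C₂ (fun y => F y + G y) x = gen lam C₁ C₂ F x + gen lam C₁ C₂ G x := by
  simp only [gen]
  have h : ∀ z, weight C₁ C₂ x z * (F z + G z - (F x + G x)) =
    weight C₁ C₂ x z * (F z - F x) + weight C₁ C₂ x z * (G z - G x) := fun z => by ring
  simp only [h, Finset.sum_add_distrib, Fin.sum_univ_three]
  split_ifs <;> ring

theorem gen_const_mul (a : ℝ) (F : Word → ℝ) (x : Word) :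
    gen lam C₁ C₂ (fun y => a * F y) x = a * gen lam C₁ C₂ F x := by
  simp only [gen]
  have h : ∀ z, weight C₁ C₂ x z * (a * F z - a * F x) =
    a * (weight C₁ C₂ x z * (F z - F x)) := fun z => by ring
  simp only [h, ← Finset.mul_sum, Fin.sum_univ_three]
  split_ifs <;> ring

theorem gen_neg (F : Word → ℝ) (x : Word) :
    gen lam C₁ C₂ (fun y => -F y) x = -gen lam C₁ C₂ F x := by
  have := gen_const_mul (lam := lam) (C₁ := C₁) (C₂ := C₂) (-1) F x
  simpa using this

theorem gen_sub (F G : Word → ℝ) (x : Word) :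
    gen lam C₁ C₂ (fun y => F y - G y) x = gen lam C₁ C₂ F x - gen lam C₁ C₂ G x := by
  simp only [sub_eq_add_neg, gen_add, gen_neg]

theorem gen_sum {ι : Type*} (s : Finset ι) (F : ι → Word → ℝ) (x : Word) :
    gen lam C₁ C₂ (fun y => ∑ i ∈ s, F i y) x = ∑ i ∈ s, gen lam C₁ C₂ (F i) x := by
  classical
  induction s using Finset.induction_on with
  | empty => simp [gen]
  | insert a s ha ih => simp only [Finset.sum_insert ha, gen_add, ih]

/-- The generator on functions of the level. -/
theorem gen_len (T : ℕ → ℝ) (x : Word) :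
    gen lam C₁ C₂ (fun y => T y.len) x =
      (if x.len = 0 then -(3 * (1 - lam)) * T 0 else 3 * (T (x.len - 1) - T x.len)) +
        3 * lam * (T (x.len + 1) - T x.len) := by
  have h : ∑ z ∈ hor x, weight C₁ C₂ x z * (T z.len - T x.len) = 0 := by
    refine Finset.sum_eq_zero fun z hz => ?_
    rw [(mem_hor.1 hz).1]; ring
  rw [gen, h]
  simp only [len_child, Fin.sum_univ_three, len_eq_zero]
  split_ifs with hx
  · subst hx; simp; ring
  · rw [← len_father hx, Nat.add_sub_cancel]; ring

/-- Relation between the generator and the conductances. -/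
theorem Admissible.sum_conductance_eq_gen (A : Admissible lam C₁ C₂) (F : Word → ℝ) (x : Word) :
    ∑ z ∈ nbhd x, conductance lam C₁ C₂ x z * (lam ^ z.len * F z - lam ^ x.len * F x) =
      gen lam C₁ C₂ F x / 3 ^ x.len := by
  have hl := A.lam_pos
  rw [sum_nbhd]
  have h : ∑ z ∈ hor x, conductance lam C₁ C₂ x z * (lam ^ z.len * F z - lam ^ x.len * F x) =
      (∑ z ∈ hor x, weight C₁ C₂ x z * (F z - F x)) / 3 ^ x.len := by
    rw [Finset.sum_div]
    refine Finset.sum_congr rfl fun z hz => ?_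
    have hz := mem_hor.1 hz
    rw [conductance_hor hz, ← hz.1, mul_pow]
    field_simp
  rw [h, gen]
  simp only [conductance_child, len_child, Fin.sum_univ_three]
  -- This is the Doob transform by λ^{|x|}. Away from the root, the surplus 3(1-λ)F from the father
  -- edge cancels the deficit from the three children. At the root there is no father, and the
  -- deficit stays as a killing term.
  split_ifs with hx
  · subst hx
    simp
    ring
  · rw [conductance_father hx, ← len_father hx]
    simp only [mul_pow, pow_succ]
    field_simp
    ring

/-- If `F` is positive at a point where it attains its maximum then the generator is nonpositive
there. -/
theorem Admissible.gen_nonpos_of_max (A : Admissible lam C₁ C₂) {F : Word → ℝ} {x : Word}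
    (h0 : 0 ≤ F x) (h : ∀ z, F z ≤ F x) : gen lam C₁ C₂ F x ≤ 0 := by
  have h1 : ∑ i, (F (x.child i) - F x) ≤ 0 := Finset.sum_nonpos fun i _ => sub_nonpos.2 (h _)
  have h2 : ∑ z ∈ hor x, weight C₁ C₂ x z * (F z - F x) ≤ 0 := Finset.sum_nonpos fun z _ =>
    mul_nonpos_of_nonneg_of_nonpos (A.weight_pos _ _).le (sub_nonpos.2 (h _))
  have h3 := mul_nonpos_of_nonneg_of_nonpos A.lam_pos.le h1
  have h4 := A.lam_lt
  unfold gen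
  split_ifs
  · nlinarith
  · linarith [h x.father]

/-- Functions on words that are small at high levels attain their maximum. -/
theorem exists_max_of_level {F : Word → ℝ} {y : Word} {n : ℕ}
    (h : ∀ z : Word, n < z.len → F z ≤ F y) : ∃ x, F y ≤ F x ∧ ∀ z, F z ≤ F x := by
  classical
  obtain ⟨x, -, hmax⟩ := (insert y (upTo n)).exists_max_image F ⟨y, by simp⟩
  refine ⟨x, hmax y (by simp), fun z => ?_⟩
  by_cases hz : z.len ≤ n
  · exact hmax z (by simp [hz])
  · exact (h z (by omega)).trans (hmax y (by simp))

/-- The maximum principle. -/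
theorem Admissible.maximum_principle (A : Admissible lam C₁ C₂) {F : Word → ℝ} {B : ℝ}
    (hB : ∀ x, F x ≤ B) (h : ∀ x, F x ≤ 0 ∨ 0 ≤ gen lam C₁ C₂ F x) (x : Word) : F x ≤ 0 := by
  by_contra! hx
  -- The penalty ε(|y|+1) forces a maximum to exist, and this ε leaves half of the value at `x`. The
  -- generator of |y|+1 is negative everywhere, also at the root, so the penalized function has
  -- positive generator wherever it is positive.
  set ε : ℝ := F x / (2 * (x.len + 1)) with hε
  have hε0 : 0 < ε := by positivity
  set G : Word → ℝ := fun y => F y - ε * ((y.len : ℝ) + 1) with hG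
  have hGx : 0 < G x := by
    have : ε * ((x.len : ℝ) + 1) = F x / 2 := by rw [hε]; field_simp
    simp only [hG, this]
    linarith
  obtain ⟨n, hn⟩ := exists_nat_gt (B / ε)
  obtain ⟨y, hxy, hy⟩ := exists_max_of_level (F := G) (y := x) (n := n) (fun z hz => by
    have h1 : B < ε * n := by rwa [div_lt_iff₀' hε0] at hn
    have h2 : (n : ℝ) ≤ z.len := by exact_mod_cast hz.le
    have h3 := hB z
    have : G z ≤ 0 := by
      simp only [hG]
      nlinarith
    linarith)
  have hGy : 0 < G y := lt_of_lt_of_le hGx hxy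
  have h1 := A.gen_nonpos_of_max hGy.le hy
  have hFy : 0 < F y := by
    have : G y ≤ F y := by simp only [hG]; nlinarith [hε0, (Nat.cast_nonneg y.len : (0:ℝ) ≤ _)]
    linarith
  have h2 := (h y).resolve_left (not_le.2 hFy)
  rw [hG, gen_sub, gen_const_mul, gen_len (T := fun n => (n : ℝ) + 1)] at h1
  have hl := A.lam_lt
  have h3 : (if y.len = 0 then -(3 * (1 - lam)) * (((0 : ℕ) : ℝ) + 1) else
      3 * ((((y.len - 1 : ℕ) : ℝ) + 1) - ((y.len : ℝ) + 1))) +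
        3 * lam * ((((y.len + 1 : ℕ) : ℝ) + 1) - ((y.len : ℝ) + 1)) < 0 := by
    split_ifs with h0
    · rw [h0]; push_cast; linarith
    · rw [Nat.cast_sub (by omega)]; push_cast; linarith
  have := mul_neg_of_pos_of_neg hε0 h3
  linarith

end

end Word

end

noncomputable section

/-! ### Green functions of general random walks -/

section Green

variable {V : Type} (P : V → V → ℝ)

theorem greenFunction_eq (x y : V) :
    greenFunction P x y =
      nStepProb P 0 x y + ∑' z, ENNReal.ofReal (P x z) * greenFunction P z y := by
  rw [greenFunction, tsum_eq_zero_add' ENNReal.summable]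
  congr 1
  simp only [nStepProb, greenFunction, ← ENNReal.tsum_mul_left]
  exact ENNReal.tsum_comm

/-- The Green function is the minimal nonnegative solution of the first-step equation: its partial
sums obey the same recursion starting from 0, so by induction they stay below any supersolution. -/
theorem greenFunction_le_of_supersolution {y : V} {S : V → ℝ≥0∞}
    (hS : ∀ x, nStepProb P 0 x y + ∑' z, ENNReal.ofReal (P x z) * S z ≤ S x) (x : V) :
    greenFunction P x y ≤ S x := by
  have h : ∀ n x, ∑ k ∈ Finset.range n, nStepProb P k x y ≤ S x := by
    intro n
    induction n with
    | zero => simp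
    | succ n ih =>
      intro x
      rw [Finset.sum_range_succ', add_comm]
      refine le_trans (add_le_add le_rfl ?_) (hS x)
      simp only [nStepProb]
      rw [← Summable.tsum_finsetSum fun _ _ => ENNReal.summable]
      refine ENNReal.tsum_le_tsum fun z => ?_
      rw [← Finset.mul_sum]
      gcongr
      exact ih z
  exact ENNReal.tsum_le_of_sum_range_le fun n => h n x

/-- Splitting off the last step instead of the first lets the induction for reversibility peel steps
from opposite ends. -/
theorem nStepProb_succ_right (n : ℕ) (x y : V) :
    nStepProb P (n + 1) x y = ∑' z, nStepProb P n x z * ENNReal.ofReal (P z y) := by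
  classical
  induction n generalizing x with
  | zero =>
    simp only [nStepProb]
    rw [tsum_eq_single y, tsum_eq_single x]
    · simp
    · intro z hz; simp [hz.symm]
    · intro z hz; simp [hz]
  | succ n ih =>
    rw [nStepProb]
    simp only [ih]
    simp only [nStepProb, ← ENNReal.tsum_mul_left, ← ENNReal.tsum_mul_right]
    rw [ENNReal.tsum_comm]
    simp only [mul_assoc]

/-- Reversibility of the `n`-step transition probabilities. -/
theorem nStepProb_reversible {π : V → ℝ≥0∞}
    (h : ∀ x y, π x * ENNReal.ofReal (P x y) = π y * ENNReal.ofReal (P y x)) (n : ℕ) (x y : V) :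
    π x * nStepProb P n x y = π y * nStepProb P n y x := by
  classical
  induction n generalizing x y with
  | zero =>
    simp only [nStepProb, eq_comm (a := y)]
    split_ifs with hxy
    · rw [hxy]
    · simp
  | succ n ih =>
    rw [nStepProb_succ_right, nStepProb, ← ENNReal.tsum_mul_left, ← ENNReal.tsum_mul_left]
    refine tsum_congr fun z => ?_
    rw [← mul_assoc, ih, mul_right_comm, h, mul_assoc]

theorem greenFunction_reversible {π : V → ℝ≥0∞}
    (h : ∀ x y, π x * ENNReal.ofReal (P x y) = π y * ENNReal.ofReal (P y x)) (x y : V) :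
    π x * greenFunction P x y = π y * greenFunction P y x := by
  simp only [greenFunction, ← ENNReal.tsum_mul_left, nStepProb_reversible P h]

end Green

/-! ### The Green function of the walk on words -/

namespace Word

section

variable {lam C₁ C₂ : ℝ}

variable (lam C₁ C₂) in
/-- The total conductance at a word. -/
def total (x : Word) : ℝ := ∑ z ∈ nbhd x, conductance lam C₁ C₂ x z

theorem tsum_conductance (x : Word) :
    ∑' z, conductance lam C₁ C₂ x z = total lam C₁ C₂ x :=
  tsum_eq_sum fun _ hz => conductance_eq_zero hz

theorem walkX_eq (x y : Word) :
    walkX lam C₁ C₂ x y = conductance lam C₁ C₂ x y / total lam C₁ C₂ x := by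
  rw [walkX, transitionProb, tsum_conductance]

theorem Admissible.total_pos (A : Admissible lam C₁ C₂) (x : Word) : 0 < total lam C₁ C₂ x :=
  Finset.sum_pos (fun _ hz => A.conductance_pos hz) ⟨x.child 0, child_mem_nbhd _ _⟩

theorem tsum_walkX (x : Word) (S : Word → ℝ≥0∞) :
    ∑' z, ENNReal.ofReal (walkX lam C₁ C₂ x z) * S z =
      ∑ z ∈ nbhd x, ENNReal.ofReal (walkX lam C₁ C₂ x z) * S z :=
  tsum_eq_sum fun z hz => by rw [walkX_eq, conductance_eq_zero hz]; simp

theorem Admissible.walkX_nonneg (A : Admissible lam C₁ C₂) (x y : Word) :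
    0 ≤ walkX lam C₁ C₂ x y := by
  rw [walkX_eq]
  exact div_nonneg (A.conductance_nonneg _ _) (A.total_pos _).le

/-- A real supersolution is a supersolution for the extended real transition operator. -/
theorem Admissible.greenFunction_le_ofReal (A : Admissible lam C₁ C₂) {y : Word} {S : Word → ℝ}
    (h0 : ∀ x, 0 ≤ S x)
    (h : ∀ x, ∑ z ∈ nbhd x, conductance lam C₁ C₂ x z * (S z - S x) ≤
      if x = y then -total lam C₁ C₂ x else 0) (x : Word) :
    greenFunction (walkX lam C₁ C₂) x y ≤ ENNReal.ofReal (S x) := by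
  refine greenFunction_le_of_supersolution (S := fun x => ENNReal.ofReal (S x)) _ (fun x => ?_) x
  have ht := A.total_pos x
  have h1 : ∑ z ∈ nbhd x, ENNReal.ofReal (walkX lam C₁ C₂ x z) * ENNReal.ofReal (S z) =
      ENNReal.ofReal (∑ z ∈ nbhd x, walkX lam C₁ C₂ x z * S z) := by
    rw [ENNReal.ofReal_sum_of_nonneg fun z _ => mul_nonneg (A.walkX_nonneg _ _) (h0 z)]
    simp only [ENNReal.ofReal_mul (A.walkX_nonneg _ _)]
  have h2 : nStepProb (walkX lam C₁ C₂) 0 x y = ENNReal.ofReal (if x = y then 1 else 0) := by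
    simp only [nStepProb]
    split_ifs <;> simp
  have h3 : ∑ z ∈ nbhd x, walkX lam C₁ C₂ x z * S z =
      S x + (∑ z ∈ nbhd x, conductance lam C₁ C₂ x z * (S z - S x)) / total lam C₁ C₂ x := by
    simp only [mul_sub, Finset.sum_sub_distrib, ← Finset.sum_mul, walkX_eq, div_mul_eq_mul_div,
      ← Finset.sum_div]
    rw [← total]
    field_simp
    ring
  rw [tsum_walkX, h1, h2, ← ENNReal.ofReal_add (by split_ifs <;> simp)
    (Finset.sum_nonneg fun z _ => mul_nonneg (A.walkX_nonneg _ _) (h0 z))]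
  refine ENNReal.ofReal_le_ofReal ?_
  rw [h3]
  have h4 := div_le_div_of_nonneg_right (h x) ht.le
  split_ifs at h4 ⊢
  · rw [neg_div, div_self ht.ne'] at h4
    linarith
  · rw [zero_div] at h4
    linarith

/-- An upper bound for the Green function. -/
theorem Admissible.greenFunction_le (A : Admissible lam C₁ C₂) (x y : Word) :
    greenFunction (walkX lam C₁ C₂) x y ≤ ENNReal.ofReal (lam ^ x.len *
      (total lam C₁ C₂ y * 3 ^ y.len / (3 * (1 - lam)) * lam ^ (y.len - x.len))) := by
  have hl := A.lam_pos
  have hl' := A.lam_lt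
  have hl'' : 0 < 1 - lam := by linarith
  have ht := A.total_pos y
  -- The supersolution depends on the level only: it is geometric below level |y|, and constant from
  -- there on because natural subtraction truncates. Its source sits on the whole level of `y`; `B`
  -- makes the share at `y` equal to `total`, and the other sources have the favourable sign.
  set B : ℝ := total lam C₁ C₂ y * 3 ^ y.len / (3 * (1 - lam)) with hB
  have hB0 : 0 < B := by positivity
  refine A.greenFunction_le_ofReal
    (S := fun x => lam ^ x.len * (B * lam ^ (y.len - x.len))) (fun x => by positivity) (fun x => ?_) x
  have h1 := A.sum_conductance_eq_gen (fun x => B * lam ^ (y.len - x.len)) x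
  rw [h1, gen_len (T := fun n => B * lam ^ (y.len - n))]
  have key : (if x.len = 0 then -(3 * (1 - lam)) * (B * lam ^ (y.len - 0)) else
      3 * (B * lam ^ (y.len - (x.len - 1)) - B * lam ^ (y.len - x.len))) +
      3 * lam * (B * lam ^ (y.len - (x.len + 1)) - B * lam ^ (y.len - x.len)) =
      if x.len = y.len then -(3 * (1 - lam)) * B else 0 := by
    rcases lt_trichotomy x.len y.len with h | h | h
    · obtain ⟨k, hk⟩ := Nat.exists_eq_add_of_lt h
      rw [if_neg h.ne, hk]
      rw [show x.len + k + 1 - x.len = k + 1 by omega,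
        show x.len + k + 1 - (x.len + 1) = k by omega]
      split_ifs with h0
      · rw [h0, show 0 + k + 1 - 0 = k + 1 by omega]; ring
      · rw [show x.len + k + 1 - (x.len - 1) = k + 2 by omega]; ring
    · rw [if_pos h, h, show y.len - (y.len + 1) = 0 by omega, Nat.sub_self]
      split_ifs with h0
      · rw [h0]; simp
      · rw [show y.len - (y.len - 1) = 1 by omega]; ring
    · rw [if_neg (by omega), if_neg (by omega), show y.len - (x.len - 1) = 0 by omega,
        show y.len - x.len = 0 by omega, show y.len - (x.len + 1) = 0 by omega]
      ring
  rw [key]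
  by_cases hxy : x = y
  · subst hxy
    rw [if_pos rfl, if_pos rfl, hB]
    apply le_of_eq
    field_simp
  · rw [if_neg hxy]
    split_ifs
    · apply div_nonpos_of_nonpos_of_nonneg _ (by positivity)
      nlinarith
    · simp

theorem Admissible.greenFunction_ne_top (A : Admissible lam C₁ C₂) (x y : Word) :
    greenFunction (walkX lam C₁ C₂) x y ≠ ∞ :=
  ((A.greenFunction_le x y).trans_lt ENNReal.ofReal_lt_top).ne

/-! ### The Green function relative to the hitting probability, and the Martin kernel. -/

variable (lam C₁ C₂) in
/-- The Green function divided by the probability of hitting the root. -/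
def relGreen (x y : Word) : ℝ :=
  (greenFunction (walkX lam C₁ C₂) y x).toReal / lam ^ y.len

theorem Admissible.toReal_greenFunction (A : Admissible lam C₁ C₂) (x y : Word) :
    (greenFunction (walkX lam C₁ C₂) y x).toReal = lam ^ y.len * relGreen lam C₁ C₂ x y := by
  have := A.lam_pos
  rw [relGreen]
  field_simp

theorem Admissible.relGreen_nonneg (A : Admissible lam C₁ C₂) (x y : Word) :
    0 ≤ relGreen lam C₁ C₂ x y :=
  div_nonneg ENNReal.toReal_nonneg (pow_pos A.lam_pos _).le

theorem Admissible.exists_relGreen_le (A : Admissible lam C₁ C₂) (x : Word) :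
    ∃ B, ∀ y, relGreen lam C₁ C₂ x y ≤ B := by
  have hl := A.lam_pos
  have hl' : 0 < 1 - lam := by linarith [A.lam_lt]
  have ht := A.total_pos x
  refine ⟨total lam C₁ C₂ x * 3 ^ x.len / (3 * (1 - lam)), fun y => ?_⟩
  rw [relGreen, div_le_iff₀' (by positivity)]
  have h := ENNReal.toReal_mono ENNReal.ofReal_ne_top (A.greenFunction_le y x)
  rw [ENNReal.toReal_ofReal (by positivity)] at h
  refine h.trans ?_
  gcongr
  exact mul_le_of_le_one_right (by positivity) (pow_le_one₀ hl.le (by linarith))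

/-- This is the first-step equation of the Green function in its starting point, carried over to
`gen` by the Doob transform. In particular `relGreen x` is harmonic at all levels above that of `x`.
-/
theorem Admissible.gen_relGreen (A : Admissible lam C₁ C₂) (x y : Word) :
    gen lam C₁ C₂ (relGreen lam C₁ C₂ x) y =
      if y = x then -(total lam C₁ C₂ x * 3 ^ x.len) else 0 := by
  have ht := A.total_pos y
  have h := greenFunction_eq (walkX lam C₁ C₂) y x
  rw [tsum_walkX] at h
  have h' := congrArg ENNReal.toReal h
  have hne : ∀ z ∈ nbhd y, ENNReal.ofReal (walkX lam C₁ C₂ y z) *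
      greenFunction (walkX lam C₁ C₂) z x ≠ ∞ := fun z _ =>
    ENNReal.mul_ne_top ENNReal.ofReal_ne_top (A.greenFunction_ne_top _ _)
  have h0 : nStepProb (walkX lam C₁ C₂) 0 y x = ENNReal.ofReal (if y = x then 1 else 0) := by
    simp only [nStepProb]
    split_ifs <;> simp
  rw [h0, ENNReal.toReal_add ENNReal.ofReal_ne_top (ENNReal.sum_ne_top.2 hne),
    ENNReal.toReal_sum hne, ENNReal.toReal_ofReal (by split_ifs <;> simp)] at h'
  simp only [ENNReal.toReal_mul, ENNReal.toReal_ofReal (A.walkX_nonneg _ _),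
    A.toReal_greenFunction] at h'
  simp only [walkX_eq, div_mul_eq_mul_div, ← Finset.sum_div] at h'
  have h1 := A.sum_conductance_eq_gen (relGreen lam C₁ C₂ x) y
  simp only [mul_sub, Finset.sum_sub_distrib, ← Finset.sum_mul] at h1
  rw [← total] at h1
  rw [eq_div_iff (by positivity)] at h1
  rw [← h1]
  split_ifs at h' ⊢ with hxy
  · subst hxy
    field_simp at h'
    simp only [mul_assoc] at h'
    rw [← neg_mul]
    congr 1
    linarith
  · field_simp at h'
    simp only [mul_assoc] at h'
    rw [mul_eq_zero]
    left
    linarith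

/-- The probability of hitting the root from `y` is `lam ^ |y|`. -/
theorem Admissible.relGreen_root (A : Admissible lam C₁ C₂) (y : Word) :
    relGreen lam C₁ C₂ root y = relGreen lam C₁ C₂ root root := by
  obtain ⟨B, hB⟩ := A.exists_relGreen_le root
  set g := relGreen lam C₁ C₂ root with hg
  have hconst : ∀ x, x ≠ root → gen lam C₁ C₂ (fun _ => g root) x = 0 := by
    intro x hx
    simp [gen, hx]
  have hgen : ∀ x, x ≠ root → gen lam C₁ C₂ g x = 0 := fun x hx => by
    rw [hg, A.gen_relGreen, if_neg hx]
  -- Off the root both `g` and constants are harmonic, and the two differences vanish at the root,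
  -- so the maximum principle applies with either sign.
  have h1 := A.maximum_principle (F := fun y => g y - g root) (B := B - g root)
    (fun x => by linarith [hB x]) (fun x => by
      by_cases hx : x = root
      · left; simp [hx]
      · right; rw [gen_sub, hgen x hx, hconst x hx]; simp) y
  have h2 := A.maximum_principle (F := fun y => g root - g y) (B := g root)
    (fun x => by linarith [A.relGreen_nonneg root x]) (fun x => by
      by_cases hx : x = root
      · left; simp [hx]
      · right; rw [gen_sub, hgen x hx, hconst x hx]; simp) y
  linarith

theorem greenFunction_self_pos (x : Word) : 1 ≤ greenFunction (walkX lam C₁ C₂) x x := by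
  rw [greenFunction_eq, nStepProb, if_pos rfl]
  exact le_self_add

theorem Admissible.relGreen_root_pos (A : Admissible lam C₁ C₂) :
    0 < relGreen lam C₁ C₂ root root := by
  refine div_pos (ENNReal.toReal_pos ?_ (A.greenFunction_ne_top _ _)) (pow_pos A.lam_pos _)
  exact (lt_of_lt_of_le one_pos (greenFunction_self_pos root)).ne'

theorem Admissible.walkX_reversible (A : Admissible lam C₁ C₂) (x y : Word) :
    ENNReal.ofReal (total lam C₁ C₂ x) * ENNReal.ofReal (walkX lam C₁ C₂ x y) =
      ENNReal.ofReal (total lam C₁ C₂ y) * ENNReal.ofReal (walkX lam C₁ C₂ y x) := by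
  rw [← ENNReal.ofReal_mul (A.total_pos _).le, ← ENNReal.ofReal_mul (A.total_pos _).le,
    walkX_eq, walkX_eq, mul_div_cancel₀ _ (A.total_pos _).ne', mul_div_cancel₀ _ (A.total_pos _).ne',
    conductance_comm]

/-- The Martin kernel is a multiple of the relative Green function. -/
theorem Admissible.exists_martinKernel_eq (A : Admissible lam C₁ C₂) (x : Word) :
    ∃ k : ℝ, 0 < k ∧ ∀ y, martinKernel (walkX lam C₁ C₂) root x y =
      ENNReal.ofReal (k * relGreen lam C₁ C₂ x y) := by
  have hx := A.total_pos x
  have ho := A.total_pos root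
  have hg := A.relGreen_root_pos
  refine ⟨total lam C₁ C₂ root / (total lam C₁ C₂ x * relGreen lam C₁ C₂ root root),
    by positivity, fun y => ?_⟩
  have hy := A.total_pos y
  have hly := pow_pos A.lam_pos y.len
  -- Reversibility swaps the arguments. In the Martin quotient the factors depending on `y` alone
  -- cancel, and the remaining denominator is constant by `relGreen_root`.
  have key : ∀ z, greenFunction (walkX lam C₁ C₂) z y = ENNReal.ofReal
      (total lam C₁ C₂ y / total lam C₁ C₂ z * (lam ^ y.len * relGreen lam C₁ C₂ z y)) := by
    intro z
    have hz := A.total_pos z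
    have h := greenFunction_reversible _ A.walkX_reversible z y
    have h' := congrArg ENNReal.toReal h
    simp only [ENNReal.toReal_mul, ENNReal.toReal_ofReal hz.le, ENNReal.toReal_ofReal hy.le,
      A.toReal_greenFunction z y] at h'
    rw [← ENNReal.ofReal_toReal (A.greenFunction_ne_top z y)]
    congr 1
    field_simp
    linarith
  rw [martinKernel, key, key, ← ENNReal.ofReal_div_of_pos, A.relGreen_root]
  · congr 1
    field_simp
  · rw [A.relGreen_root]
    positivity

end

end Word

end

noncomputable section

/-! ### Functions of finite energy -/

section Energy

variable {V : Type} {c : V → V → ℝ}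

theorem energy_self (u : V → ℝ) :
    2 * energy c u u = ∑' p : V × V, c p.1 p.2 * (u p.1 - u p.2) ^ 2 := by
  rw [energy, ← mul_assoc]
  norm_num
  exact tsum_congr fun p => by ring

theorem FiniteEnergy.le_energy (hc : ∀ x y, 0 ≤ c x y) {u : V → ℝ} (hu : FiniteEnergy c u)
    (x y : V) : c x y * (u x - u y) ^ 2 ≤ 2 * energy c u u := by
  rw [energy_self]
  exact hu.le_tsum (x, y) fun p _ => mul_nonneg (hc _ _) (sq_nonneg _)

theorem energy_self_nonneg (hc : ∀ x y, 0 ≤ c x y) (u : V → ℝ) : 0 ≤ energy c u u := by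
  have h : 0 ≤ 2 * energy c u u := by
    rw [energy_self]
    exact tsum_nonneg fun p => mul_nonneg (hc _ _) (sq_nonneg _)
  linarith

end Energy

namespace Word

section

variable {lam C₁ C₂ : ℝ}

variable (lam C₁ C₂) in
/-- The constant in the bound of increments along edges. -/
def edgeConst : ℝ := Real.sqrt (2 / minCond lam C₁ C₂)

theorem Admissible.edgeConst_pos (A : Admissible lam C₁ C₂) : 0 < edgeConst lam C₁ C₂ :=
  Real.sqrt_pos.2 (div_pos two_pos A.minCond_pos)

/-- One edge carries no more than the whole energy, while its conductance is at least a constant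
times (3λ)^{-|x|}. -/
theorem Admissible.abs_sub_le_of_mem_nbhd (A : Admissible lam C₁ C₂) {u : Word → ℝ}
    (hu : FiniteEnergy (conductance lam C₁ C₂) u) {x y : Word} (h : y ∈ nbhd x) :
    |u y - u x| ≤ edgeConst lam C₁ C₂ * Real.sqrt (energy (conductance lam C₁ C₂) u u) *
      Real.sqrt (3 * lam) ^ x.len := by
  have h3 := A.three_pos
  have hm := A.minCond_pos
  have hE := energy_self_nonneg A.conductance_nonneg u
  have h1 := hu.le_energy A.conductance_nonneg x y
  have h2 := A.le_conductance h
  refine abs_le_of_sq_le_sq ?_ (by unfold edgeConst; positivity)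
  rw [mul_pow, mul_pow, edgeConst, Real.sq_sqrt (by positivity), Real.sq_sqrt hE, ← pow_mul,
    mul_comm x.len 2, pow_mul, Real.sq_sqrt h3.le]
  have h4 : minCond lam C₁ C₂ / (3 * lam) ^ x.len * (u x - u y) ^ 2 ≤
      2 * energy (conductance lam C₁ C₂) u u :=
    (mul_le_mul_of_nonneg_right h2 (sq_nonneg _)).trans h1
  rw [show (u y - u x) ^ 2 = (u x - u y) ^ 2 by ring]
  have h5 := pow_pos h3 x.len
  rw [div_mul_eq_mul_div, div_le_iff₀ h5] at h4
  rw [div_mul_eq_mul_div, div_mul_eq_mul_div, le_div_iff₀ hm]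
  linarith

theorem Admissible.sqrt_pos (A : Admissible lam C₁ C₂) : 0 < Real.sqrt (3 * lam) :=
  Real.sqrt_pos.2 A.three_pos

theorem Admissible.sqrt_lt_one (A : Admissible lam C₁ C₂) : Real.sqrt (3 * lam) < 1 := by
  rw [Real.sqrt_lt' one_pos]
  linarith [A.three_lt]

/-- Sum the edge increments along the line of ancestors: they are dominated by a geometric series of
ratio √(3λ) < 1. -/
theorem Admissible.abs_sub_root_le (A : Admissible lam C₁ C₂) {u : Word → ℝ}
    (hu : FiniteEnergy (conductance lam C₁ C₂) u) (x : Word) :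
    |u x - u root| ≤ edgeConst lam C₁ C₂ * Real.sqrt (energy (conductance lam C₁ C₂) u u) /
      (1 - Real.sqrt (3 * lam)) := by
  have hr := A.sqrt_pos
  have hr' := A.sqrt_lt_one
  have hr'' : 0 < 1 - Real.sqrt (3 * lam) := by linarith
  set M := edgeConst lam C₁ C₂ * Real.sqrt (energy (conductance lam C₁ C₂) u u) with hM
  have hM0 : 0 ≤ M := mul_nonneg A.edgeConst_pos.le (Real.sqrt_nonneg _)
  have key : |u x - u root| ≤ M * (1 - Real.sqrt (3 * lam) ^ x.len) / (1 - Real.sqrt (3 * lam)) := by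
    induction x using child_induction with
    | h₀ => simp
    | h v i ih =>
      have h1 := A.abs_sub_le_of_mem_nbhd hu (child_mem_nbhd v i)
      rw [← hM] at h1
      have h2 := abs_sub_le (u (v.child i)) (u v) (u root)
      rw [le_div_iff₀ hr''] at ih ⊢
      rw [len_child, pow_succ]
      nlinarith
  refine key.trans ?_
  gcongr
  apply mul_le_of_le_one_right hM0
  have := pow_pos hr x.len
  linarith

/-- Apart from the killing term at the root, `gen` is a combination of boundedly many edge
increments with bounded coefficients, so it inherits their decay. -/
theorem Admissible.exists_abs_gen_le (A : Admissible lam C₁ C₂) {u : Word → ℝ}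
    (hu : FiniteEnergy (conductance lam C₁ C₂) u) :
    ∃ a, 0 ≤ a ∧ ∀ x, |gen lam C₁ C₂ u x| ≤ a * Real.sqrt (3 * lam) ^ x.len := by
  have hC₁ := A.C₁_pos
  have hC₂ := A.C₂_pos
  have hl := A.lam_pos
  have hl' := A.lam_lt
  set M := edgeConst lam C₁ C₂ * Real.sqrt (energy (conductance lam C₁ C₂) u u) with hM
  have hM0 : 0 ≤ M := mul_nonneg A.edgeConst_pos.le (Real.sqrt_nonneg _)
  refine ⟨(3 + 3 * lam + 3 * (C₁ + C₂)) * M + 3 * |u root|, by positivity, fun x => ?_⟩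
  set R := Real.sqrt (3 * lam) ^ x.len with hR
  have hR0 : 0 < R := pow_pos A.sqrt_pos _
  have hb : ∀ z ∈ nbhd x, |u z - u x| ≤ M * R := fun z hz => A.abs_sub_le_of_mem_nbhd hu hz
  have h1 : |if x = root then -(3 * (1 - lam)) * u x else 3 * (u x.father - u x)| ≤
      3 * (M * R) + 3 * |u root| * R := by
    split_ifs with hx
    · subst hx
      have : R = 1 := by simp [hR]
      rw [this, abs_mul, abs_neg, abs_of_pos (by linarith)]
      nlinarith [abs_nonneg (u root)]
    · rw [abs_mul, abs_of_pos (by norm_num : (0 : ℝ) < 3)]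
      have := hb _ (father_mem_nbhd hx)
      have : 0 ≤ 3 * |u root| * R := by positivity
      linarith
  have h2 : |lam * ∑ i, (u (x.child i) - u x)| ≤ lam * (3 * (M * R)) := by
    rw [abs_mul, abs_of_pos hl]
    gcongr
    refine (Finset.abs_sum_le_sum_abs _ _).trans ?_
    refine (Finset.sum_le_card_nsmul _ _ (M * R) fun i _ => hb _ (child_mem_nbhd x i)).trans ?_
    simp
  have h3 : |∑ z ∈ hor x, weight C₁ C₂ x z * (u z - u x)| ≤ 3 * ((C₁ + C₂) * (M * R)) := by
    refine (Finset.abs_sum_le_sum_abs _ _).trans ?_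
    refine (Finset.sum_le_card_nsmul _ _ ((C₁ + C₂) * (M * R)) fun z hz => ?_).trans ?_
    · rw [abs_mul, abs_of_pos (A.weight_pos _ _)]
      gcongr
      · exact A.weight_le _ _
      · exact hb _ (mem_nbhd.2 (Or.inr (Or.inr (mem_hor.1 hz))))
    · rw [nsmul_eq_mul]
      gcongr
      exact_mod_cast card_hor_le x
  refine (abs_add_three _ _ _).trans ?_
  linarith

/-- Bounded functions whose image under the generator decays are uniform limits of Green
potentials. -/
theorem Admissible.exists_potential_near (A : Admissible lam C₁ C₂) {u : Word → ℝ} {B a : ℝ}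
    (hB : ∀ x, |u x| ≤ B) (ha : 0 ≤ a)
    (hu : ∀ x, |gen lam C₁ C₂ u x| ≤ a * Real.sqrt (3 * lam) ^ x.len) {ε : ℝ} (hε : 0 < ε) :
    ∃ (s : Finset Word) (b : Word → ℝ), ∀ y, |u y - ∑ x ∈ s, b x * relGreen lam C₁ C₂ x y| ≤ ε := by
  have hl := A.lam_pos
  have hl' := A.lam_lt
  -- A fourth root splits the decay of the source, t^{2n}, into two factors: one t^N makes the error
  -- small, the other is absorbed by the barrier.
  set t := Real.sqrt (Real.sqrt (3 * lam)) with ht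
  have ht0 : 0 < t := Real.sqrt_pos.2 A.sqrt_pos
  have ht1 : t < 1 := by
    rw [ht, Real.sqrt_lt' one_pos]
    linarith [A.sqrt_lt_one]
  have htr : Real.sqrt (3 * lam) = t ^ 2 := (Real.sq_sqrt A.sqrt_pos.le).symm
  have h1t : 0 < 1 - t := by linarith
  have h2t : 0 < 1 - lam * t := by nlinarith
  set D := a / (3 * (1 - t) * (1 - lam * t)) with hD
  have hD0 : 0 ≤ D := by positivity
  have hDa : 3 * D * (1 - t) * (1 - lam * t) = a := by
    rw [show 3 * D * (1 - t) * (1 - lam * t) = D * (3 * (1 - t) * (1 - lam * t)) by ring, hD,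
      div_mul_cancel₀ _ (by positivity)]
  obtain ⟨N, hN⟩ : ∃ N : ℕ, 2 * D * t ^ N ≤ ε := by
    have h := (tendsto_pow_atTop_nhds_zero_of_lt_one ht0.le ht1).const_mul (2 * D)
    rw [mul_zero] at h
    exact (h.eventually (eventually_le_nhds hε)).exists
  -- The barrier is bounded by 2Dt^N, and `D` is normalized so that its generator at level n+1 is
  -- exactly -a t^N t^n. Above level `N` this dominates the source a t^{2(n+1)}.
  set T : ℕ → ℝ := fun k => D * t ^ N * (2 - t ^ k) with hT
  set k : Word → ℝ := fun x => total lam C₁ C₂ x * 3 ^ x.len with hk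
  have hk0 : ∀ x, 0 < k x := fun x => mul_pos (A.total_pos x) (by positivity)
  refine ⟨upTo N, fun x => -gen lam C₁ C₂ u x / k x, ?_⟩
  set v : Word → ℝ := fun y => ∑ x ∈ upTo N, -gen lam C₁ C₂ u x / k x * relGreen lam C₁ C₂ x y
    with hv
  -- The potential `v` reproduces the source of `u` up to level `N`; only the small tail remains for
  -- the barrier.
  have hgv : ∀ y, gen lam C₁ C₂ v y = if y.len ≤ N then gen lam C₁ C₂ u y else 0 := by
    intro y
    rw [hv, gen_sum]
    simp only [gen_const_mul, A.gen_relGreen]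
    have : ∀ x, -gen lam C₁ C₂ u x / k x * (if y = x then -(k x) else 0) =
        if y = x then gen lam C₁ C₂ u x else 0 := by
      intro x
      have := hk0 x
      split_ifs
      · field_simp
      · simp
    simp only [hk] at this
    simp only [hk, this, Finset.sum_ite_eq, mem_upTo]
  have hvB : ∃ B', ∀ y, |v y| ≤ B' := by
    choose G hG using A.exists_relGreen_le
    refine ⟨∑ x ∈ upTo N, |-gen lam C₁ C₂ u x / k x| * G x, fun y => ?_⟩
    refine (Finset.abs_sum_le_sum_abs _ _).trans (Finset.sum_le_sum fun x _ => ?_)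
    rw [abs_mul, abs_of_nonneg (A.relGreen_nonneg x y)]
    gcongr
    exact hG x y
  obtain ⟨B', hB'⟩ := hvB
  have hT0 : ∀ n, 0 ≤ T n := fun n => by
    have : t ^ n ≤ 1 := pow_le_one₀ ht0.le ht1.le
    have : 0 ≤ 2 - t ^ n := by linarith
    simp only [hT]
    positivity
  have hTε : ∀ n, T n ≤ ε := fun n => by
    refine le_trans ?_ hN
    have : 0 < t ^ n := pow_pos ht0 n
    simp only [hT]
    rw [show 2 * D * t ^ N = D * t ^ N * 2 by ring]
    gcongr
    linarith
  have hgT : ∀ y : Word, gen lam C₁ C₂ (fun z => T z.len) y ≤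
      if y.len ≤ N then 0 else -(a * Real.sqrt (3 * lam) ^ y.len) := by
    intro y
    rw [gen_len]
    have hDt : 0 ≤ D * t ^ N := by positivity
    by_cases h0 : y.len = 0
    · rw [h0, if_pos rfl, if_pos (Nat.zero_le _)]
      have h1 : 0 ≤ (1 - lam) - lam * (1 - t) := by nlinarith
      have e : -(3 * (1 - lam)) * T 0 + 3 * lam * (T (0 + 1) - T 0) =
          -3 * (D * t ^ N * ((1 - lam) - lam * (1 - t))) := by
        simp only [hT]
        ring
      rw [e]
      linarith [mul_nonneg hDt h1]
    · obtain ⟨n, hn⟩ := Nat.exists_eq_succ_of_ne_zero h0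
      rw [hn, if_neg (Nat.succ_ne_zero n), Nat.succ_eq_add_one, Nat.add_sub_cancel]
      have e : 3 * (T n - T (n + 1)) + 3 * lam * (T (n + 1 + 1) - T (n + 1)) =
          -(a * (t ^ N * t ^ n)) := by
        rw [← hDa]
        simp only [hT, pow_succ]
        ring
      rw [e]
      split_ifs with hN'
      · have : 0 ≤ a * (t ^ N * t ^ n) := by positivity
        linarith
      · rw [htr, ← pow_mul, show 2 * (n + 1) = (n + 1) + (n + 1) by ring, pow_add]
        have h1 : t ^ (n + 1) ≤ t ^ N := pow_le_pow_of_le_one ht0.le ht1.le (by omega)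
        have h2 : t ^ (n + 1) ≤ t ^ n := pow_le_pow_of_le_one ht0.le ht1.le (by omega)
        have h3 : t ^ (n + 1) * t ^ (n + 1) ≤ t ^ N * t ^ n := by gcongr
        have := mul_le_mul_of_nonneg_left h3 ha
        linarith
  intro y
  rw [abs_le]
  have hp := A.maximum_principle (F := fun y => (u y - v y) - T y.len) (B := B + B') (fun x => by
      have := abs_le.1 (hB x); have := abs_le.1 (hB' x); have := hT0 x.len; linarith) (fun x => by
      right
      rw [gen_sub, gen_sub, hgv]
      have := hgT x
      have := abs_le.1 (hu x)
      split_ifs at * <;> linarith) y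
  have hn := A.maximum_principle (F := fun y => (v y - u y) - T y.len) (B := B + B') (fun x => by
      have := abs_le.1 (hB x); have := abs_le.1 (hB' x); have := hT0 x.len; linarith) (fun x => by
      right
      rw [gen_sub, gen_sub, hgv]
      have := hgT x
      have := abs_le.1 (hu x)
      split_ifs at * <;> linarith) y
  have := hTε y.len
  constructor <;> linarith

end

end Word

/-! ### Continuous functions on the Martin compactification -/

section Martin

variable {V : Type} (P : V → V → ℝ) (o : V)

theorem denseRange_martinIncl : DenseRange (martinIncl P o) := by
  intro ξ
  refine (closure_subtype (p := fun p => p ∈ closure (range (martinMap P o)))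
    (s := range (martinIncl P o))).2 ?_
  refine closure_mono ?_ ξ.2
  rintro _ ⟨y, rfl⟩
  exact ⟨martinIncl P o y, mem_range_self y, rfl⟩

theorem continuous_martinMap_val : Continuous
    (Subtype.val : MartinCompactification P o → (V → ℝ≥0∞) × (V → Bool)) :=
  continuous_subtype_val

/-- The indicator coordinate at `x` is continuous, so the set where it is true is open. In the dense
image of `V` this set contains only the image of `x`, hence it lies in the closure of that point. -/
theorem eq_martinIncl_iff {ξ : MartinCompactification P o} {x : V} :
    ξ = martinIncl P o x ↔ ξ.1.2 x = true := by
  constructor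
  · rintro rfl
    simp [martinIncl, martinMap]
  · intro h
    have hcont : Continuous fun η : MartinCompactification P o => η.1.2 x :=
      (continuous_apply x).comp (continuous_snd.comp (continuous_martinMap_val P o))
    have hU : IsOpen {η : MartinCompactification P o | η.1.2 x = true} :=
      (isOpen_discrete {true}).preimage hcont
    have h1 := (denseRange_martinIncl P o).open_subset_closure_inter hU h
    classical
    have h2 : {η : MartinCompactification P o | η.1.2 x = true} ∩ range (martinIncl P o) ⊆
        {martinIncl P o x} := by
      rintro _ ⟨hy, y, rfl⟩
      have : x = y := by
        have hy' : (martinMap P o y).2 x = true := hy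
        simpa [martinMap] using hy'
      rw [this]; rfl
    have h3 := closure_mono h2 h1
    rwa [closure_singleton] at h3

theorem martinIncl_injective : Function.Injective (martinIncl P o) := by
  intro x y h
  have := (eq_martinIncl_iff P o).1 h
  symm
  simpa [martinIncl, martinMap] using this

theorem isOpen_singleton_martinIncl (x : V) : IsOpen {martinIncl P o x} := by
  have hcont : Continuous fun η : MartinCompactification P o => η.1.2 x :=
    (continuous_apply x).comp (continuous_snd.comp (continuous_martinMap_val P o))
  have : {martinIncl P o x} = {η : MartinCompactification P o | η.1.2 x = true} := by
    ext η
    rw [mem_singleton_iff, eq_martinIncl_iff]; rfl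
  rw [this]
  exact (isOpen_discrete {true}).preimage hcont

theorem isOpenEmbedding_martinIncl [TopologicalSpace V] [DiscreteTopology V] :
    IsOpenEmbedding (martinIncl P o) := by
  refine .of_continuous_injective_isOpenMap continuous_of_discreteTopology
    (martinIncl_injective P o) fun s _ => ?_
  rw [← biUnion_of_singleton s, image_iUnion₂]
  exact isOpen_biUnion fun x _ => by
    rw [image_singleton]; exact isOpen_singleton_martinIncl P o x

variable {P o} in
theorem abs_le_of_abs_martinIncl_le {f : MartinCompactification P o → ℝ} (hf : Continuous f) {b : ℝ}
    (h : ∀ x, |f (martinIncl P o x)| ≤ b) (ξ : MartinCompactification P o) : |f ξ| ≤ b :=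
  (denseRange_martinIncl P o).induction_on (p := fun ξ => |f ξ| ≤ b) ξ
    (isClosed_le (by fun_prop) continuous_const) h

/-- Uniform limits of functions that extend continuously extend continuously. -/
theorem exists_extension_of_approx {u : V → ℝ}
    (h : ∀ ε > 0, ∃ f : C(MartinCompactification P o, ℝ), ∀ x, |f (martinIncl P o x) - u x| ≤ ε) :
    ∃ f : C(MartinCompactification P o, ℝ), ∀ x, f (martinIncl P o x) = u x := by
  choose F hF using fun n : ℕ => h (1 / ((n : ℝ) + 1)) (by positivity)
  have hlim : Tendsto (fun n : ℕ => 1 / ((n : ℝ) + 1)) atTop (𝓝 0) :=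
    tendsto_one_div_add_atTop_nhds_zero_nat
  have hmono : ∀ {n N : ℕ}, N ≤ n → 1 / ((n : ℝ) + 1) ≤ 1 / ((N : ℝ) + 1) := fun hn => by
    gcongr
  have hc : CauchySeq F := by
    refine cauchySeq_of_le_tendsto_0 (fun n : ℕ => 2 * (1 / ((n : ℝ) + 1)))
      (fun n m N hn hm => ?_) (by simpa using hlim.const_mul 2)
    rw [ContinuousMap.dist_le (by positivity)]
    intro ξ
    rw [Real.dist_eq]
    refine abs_le_of_abs_martinIncl_le (f := fun ξ => F n ξ - F m ξ) (by fun_prop) (fun x => ?_) ξ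
    have h1 := abs_le.1 ((hF n x).trans (hmono hn))
    have h2 := abs_le.1 ((hF m x).trans (hmono hm))
    rw [abs_le]
    constructor <;> linarith
  obtain ⟨f, hf⟩ := cauchySeq_tendsto_of_complete hc
  refine ⟨f, fun x => ?_⟩
  have h1 : Tendsto (fun n => F n (martinIncl P o x)) atTop (𝓝 (f (martinIncl P o x))) :=
    ((continuous_eval_const (F := C(MartinCompactification P o, ℝ)) (martinIncl P o x)).tendsto f).comp hf
  refine tendsto_nhds_unique h1 ?_
  rw [tendsto_iff_dist_tendsto_zero]
  exact squeeze_zero (fun _ => dist_nonneg) (fun n => hF n x) hlim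

/-- A bounded real function which is given by a Martin kernel extends continuously. -/
theorem exists_extension_of_martinKernel {x : V} {g : V → ℝ} {B : ℝ} (hg : ∀ y, 0 ≤ g y)
    (hB : ∀ y, g y ≤ B) (h : ∀ y, martinKernel P o x y = ENNReal.ofReal (g y)) :
    ∃ f : C(MartinCompactification P o, ℝ), (∀ y, f (martinIncl P o y) = g y) ∧
      ∀ ξ : MartinCompactification P o, ξ.1.1 x = ENNReal.ofReal (f ξ) := by
  have hcont : Continuous fun η : MartinCompactification P o => η.1.1 x :=
    (continuous_apply x).comp (continuous_fst.comp (continuous_martinMap_val P o))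
  have hne : ∀ η : MartinCompactification P o, min (η.1.1 x) (ENNReal.ofReal B) ≠ ∞ := fun η =>
    ((min_le_right _ _).trans_lt ENNReal.ofReal_lt_top).ne
  -- Capping at `B` keeps the coordinate away from ∞, where `toReal` is discontinuous, and changes
  -- nothing on the dense image of `V`.
  let f : C(MartinCompactification P o, ℝ) :=
    ⟨fun η => (min (η.1.1 x) (ENNReal.ofReal B)).toReal,
      ENNReal.continuousOn_toReal.comp_continuous (hcont.min continuous_const) hne⟩
  have hf : ∀ y, f (martinIncl P o y) = g y := by
    intro y
    change (min (martinKernel P o x y) (ENNReal.ofReal B)).toReal = g y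
    rw [h, min_eq_left (ENNReal.ofReal_le_ofReal (hB y)), ENNReal.toReal_ofReal (hg y)]
  refine ⟨f, hf, fun ξ => ?_⟩
  refine (denseRange_martinIncl P o).induction_on (p := fun ξ => ξ.1.1 x = ENNReal.ofReal (f ξ)) ξ
    (isClosed_eq hcont (ENNReal.continuous_ofReal.comp f.continuous)) fun y => ?_
  rw [hf]
  exact h y

end Martin

namespace Word

variable {lam C₁ C₂ : ℝ}

/-- The relative Green functions extend continuously to the Martin compactification, and determine
the Martin kernels. -/
theorem Admissible.exists_relGreen_extension (A : Admissible lam C₁ C₂) (x : Word) :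
    ∃ f : C(XBar lam C₁ C₂, ℝ), (∀ y, f (inclX lam C₁ C₂ y) = relGreen lam C₁ C₂ x y) ∧
      ∃ k : ℝ, ∀ ξ : XBar lam C₁ C₂, ξ.1.1 x = ENNReal.ofReal (k * f ξ) := by
  obtain ⟨k, hk, h⟩ := A.exists_martinKernel_eq x
  obtain ⟨B, hB⟩ := A.exists_relGreen_le x
  obtain ⟨f, hf, hf'⟩ := exists_extension_of_martinKernel (walkX lam C₁ C₂) root
    (g := fun y => k * relGreen lam C₁ C₂ x y) (B := k * B)
    (fun y => mul_nonneg hk.le (A.relGreen_nonneg _ _))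
    (fun y => mul_le_mul_of_nonneg_left (hB y) hk.le) h
  refine ⟨k⁻¹ • f, fun y => ?_, k, fun ξ => ?_⟩
  · have := hf y
    simp only [ContinuousMap.smul_apply, smul_eq_mul]
    change k⁻¹ * f (martinIncl _ _ y) = _
    rw [this]
    field_simp
  · rw [hf' ξ]
    simp only [ContinuousMap.smul_apply, smul_eq_mul]
    rw [mul_inv_cancel_left₀ hk.ne']

/-- Functions of finite energy extend continuously to the Martin compactification. -/
theorem Admissible.exists_extension (A : Admissible lam C₁ C₂) {u : Word → ℝ}
    (hu : FiniteEnergy (conductance lam C₁ C₂) u) :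
    ∃ f : C(XBar lam C₁ C₂, ℝ), ∀ y, f (inclX lam C₁ C₂ y) = u y := by
  obtain ⟨a, ha, hgen⟩ := A.exists_abs_gen_le hu
  have hB : ∀ x, |u x| ≤ |u root| + edgeConst lam C₁ C₂ *
      Real.sqrt (energy (conductance lam C₁ C₂) u u) / (1 - Real.sqrt (3 * lam)) := fun x => by
    have h1 := A.abs_sub_root_le hu x
    have h2 := abs_sub_abs_le_abs_sub (u x) (u root)
    linarith
  choose g hg hg' using A.exists_relGreen_extension
  refine exists_extension_of_approx _ _ fun ε hε => ?_
  obtain ⟨s, b, h⟩ := A.exists_potential_near hB ha hgen hε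
  refine ⟨∑ x ∈ s, b x • g x, fun y => ?_⟩
  rw [abs_sub_comm]
  convert h y using 3
  rw [ContinuousMap.sum_apply]
  refine Finset.sum_congr rfl fun x _ => ?_
  rw [ContinuousMap.smul_apply, smul_eq_mul]
  congr 1
  exact hg x y

end Word

end

noncomputable section

/-! ### The horizontal graph distance -/

namespace Word

/-- The graph of horizontal edges. -/
def horGraph : SimpleGraph Word where
  Adj := HorizontalAdj
  symm := ⟨fun _ _ h => h.symm⟩
  loopless := ⟨fun _ h => h.2.1 rfl⟩

/-- An edge lifts to the edge between the two children at the common corner; before each lifted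
edge, and once at the end, at most one step between siblings is needed. -/
theorem exists_walk_child {x y : Word} (p : horGraph.Walk x y) (i j : Fin 3) :
    ∃ q : horGraph.Walk (x.child i) (y.child j), q.length ≤ 2 * p.length + 1 := by
  have hsib : ∀ (x : Word) (i j : Fin 3),
      ∃ q : horGraph.Walk (x.child i) (x.child j), q.length ≤ 1 := by
    intro x i j
    by_cases h : i = j
    · subst h
      exact ⟨.nil, by simp⟩
    · exact ⟨.cons (show horGraph.Adj _ _ from horizontalAdj_child h) .nil, by simp⟩
  induction p generalizing i with
  | nil =>
    obtain ⟨q, hq⟩ := hsib _ i j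
    exact ⟨q, by simpa using hq⟩
  | cons h p ih =>
    obtain ⟨k, l, hm⟩ := horizontalAdj_iff.1 h
    obtain ⟨q, hq⟩ := hsib _ i k
    obtain ⟨q', hq'⟩ := ih l
    refine ⟨q.append (.cons (show horGraph.Adj _ _ from
      horizontalAdj_iff.2 ⟨_, _, hm.step⟩) q'), ?_⟩
    simp only [SimpleGraph.Walk.length_append, SimpleGraph.Walk.length_cons]
    omega

theorem exists_walk_of_eq_or_adj {x y : Word} (h : x = y ∨ HorizontalAdj x y) :
    ∃ q : horGraph.Walk x y, q.length ≤ 1 := by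
  rcases h with rfl | h
  · exact ⟨.nil, by simp⟩
  · exact ⟨.cons (show horGraph.Adj _ _ from h) .nil, by simp⟩

/-- Contract the edges in consecutive pairs: each pair becomes at most one step between fathers by
`HorizontalAdj.father_trans`. -/
theorem exists_walk_father : ∀ {x y : Word} (p : horGraph.Walk x y),
    ∃ q : horGraph.Walk x.father y.father, 2 * q.length ≤ p.length + 1
  | _, _, .nil => ⟨.nil, by simp⟩
  | _, _, .cons h .nil => by
    obtain ⟨q, hq⟩ := exists_walk_of_eq_or_adj (HorizontalAdj.father h)
    exact ⟨q, by simp; omega⟩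
  | _, _, .cons h (.cons h' p) => by
    obtain ⟨q, hq⟩ := exists_walk_of_eq_or_adj (HorizontalAdj.father_trans h h')
    obtain ⟨q', hq'⟩ := exists_walk_father p
    refine ⟨q.append q', ?_⟩
    simp only [SimpleGraph.Walk.length_append, SimpleGraph.Walk.length_cons]
    omega

theorem reachable_of_len_eq {x y : Word} (h : x.len = y.len) : horGraph.Reachable x y := by
  induction x using child_induction generalizing y with
  | h₀ => rw [len_eq_zero.1 h.symm]
  | h x i ih =>
    obtain ⟨y, j, rfl⟩ := exists_eq_child (w := y) (by rintro rfl; simp at h)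
    obtain ⟨p⟩ := ih (y := y) (by simpa using h)
    exact ⟨(exists_walk_child p i j).choose⟩

theorem dist_child_le {x y : Word} (h : x.len = y.len) (i j : Fin 3) :
    horGraph.dist (x.child i) (y.child j) ≤ 2 * horGraph.dist x y + 1 := by
  obtain ⟨p, hp⟩ := (reachable_of_len_eq h).exists_walk_length_eq_dist
  obtain ⟨q, hq⟩ := exists_walk_child p i j
  rw [← hp]
  exact (SimpleGraph.dist_le q).trans hq

theorem dist_father_le {x y : Word} (h : x.len = y.len) :
    2 * horGraph.dist x.father y.father ≤ horGraph.dist x y + 1 := by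
  obtain ⟨p, hp⟩ := (reachable_of_len_eq h).exists_walk_length_eq_dist
  obtain ⟨q, hq⟩ := exists_walk_father p
  rw [← hp]
  have := SimpleGraph.dist_le q
  omega

theorem dist_hor_le {x y z : Word} (h : x.len = y.len) (hz : HorizontalAdj x z) :
    horGraph.dist z y ≤ horGraph.dist x y + 1 := by
  obtain ⟨p, hp⟩ := (reachable_of_len_eq h).exists_walk_length_eq_dist
  rw [← hp]
  exact SimpleGraph.dist_le (.cons (show horGraph.Adj _ _ from hz.symm) p)

theorem exists_dist_hor_lt {x y : Word} (h : x.len = y.len) (hne : x ≠ y) :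
    ∃ z, HorizontalAdj x z ∧ horGraph.dist z y + 1 ≤ horGraph.dist x y := by
  obtain ⟨p, hp⟩ := (reachable_of_len_eq h).exists_walk_length_eq_dist
  rw [← hp]
  cases p with
  | nil => exact absurd rfl hne
  | cons h p =>
    refine ⟨_, h, ?_⟩
    rw [SimpleGraph.Walk.length_cons]
    exact Nat.succ_le_succ (SimpleGraph.dist_le p)

theorem one_le_dist {x y : Word} (h : x.len = y.len) (hne : x ≠ y) : 1 ≤ horGraph.dist x y :=
  (reachable_of_len_eq h).pos_dist_of_ne hne

end Word

/-! ### A concave function of the distance -/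

/-- The existence of the Lyapunov function used in the coupling. -/
theorem exists_lyapunov {lam m s : ℝ} (hl : 0 < lam) (hl' : lam < 1 / 3) (hm : 0 < m)
    (hms : m ≤ s) : ∃ (φ : ℕ → ℝ) (κ : ℝ), 0 < κ ∧ φ 0 = 0 ∧ 0 < φ 1 ∧ Monotone φ ∧
      ∀ d, 3 * (φ ((d + 2) / 2) - φ (d + 1)) + 3 * lam * (φ (2 * d + 3) - φ (d + 1)) +
        m * (φ d - φ (d + 1)) + 6 * s * (φ (d + 2) - φ (d + 1)) ≤ -κ * φ (d + 1) := by
  have hs : 0 < s := hm.trans_le hms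
  -- The increments q^d of the bounded part ψ shrink so fast that the gain m q^d from one step
  -- closer outweighs all possible losses from moving apart; half of it is left over.
  set q : ℝ := m / (2 * (2 + 6 * s)) with hq
  have hq0 : 0 < q := by positivity
  have hq1 : q ≤ 1 / 2 := by
    rw [hq, div_le_div_iff₀ (by positivity) (by norm_num)]
    linarith
  have hqm : (2 + 6 * s) * q = m / 2 := by
    rw [hq]; field_simp
  set E : ℝ := 5 / 2 + 6 * s with hE
  have hE0 : 0 < E := by positivity
  -- The linear part βd has drift at most β(E - (d+1)/2), because halving at rate 3 beats doubling
  -- at rate 3λ < 1. Beyond `R` this is at most -β(d+1)/4. Below `R` it costs at most βE, which β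
  -- makes half of what ψ has left over.
  obtain ⟨R, hR⟩ := exists_nat_gt (4 * E)
  set β : ℝ := m * q ^ R / (4 * E) with hβ
  have hβ0 : 0 < β := by positivity
  have hβE : β * E = m * q ^ R / 4 := by
    rw [hβ]; field_simp
  set ψ : ℕ → ℝ := fun d => ∑ j ∈ Finset.range d, q ^ j with hψ
  set φ : ℕ → ℝ := fun d => ψ d + β * d with hφ
  have hψm : Monotone ψ := fun a b hab => by
    refine Finset.sum_le_sum_of_subset_of_nonneg (Finset.range_mono hab) fun i _ _ => by positivity
  have hφm : Monotone φ := fun a b hab => by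
    have : (a : ℝ) ≤ b := by exact_mod_cast hab
    have := hψm hab
    simp only [hφ]
    nlinarith
  have htail : ∀ d k, ψ (d + k) - ψ d ≤ 2 * q ^ d := by
    intro d k
    have h1 : ψ (d + k) - ψ d = q ^ d * ∑ j ∈ Finset.range k, q ^ j := by
      simp only [hψ]
      rw [Finset.sum_range_add, add_sub_cancel_left, Finset.mul_sum]
      simp only [pow_add]
    have h2 : ∑ j ∈ Finset.range k, q ^ j ≤ 2 := by
      have := geom_sum_mul_neg q k
      have : 0 ≤ q ^ k := by positivity
      have h0 : 0 ≤ ∑ j ∈ Finset.range k, q ^ j := Finset.sum_nonneg fun _ _ => by positivity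
      nlinarith
    rw [h1, mul_comm]
    gcongr
  have hψ2 : ∀ d, ψ d ≤ 2 := fun d => by
    have := htail 0 d
    simp only [hψ, zero_add, Finset.range_zero, Finset.sum_empty, pow_zero] at this ⊢
    linarith
  -- The last entry serves distances up to `R`; the first two serve larger distances, where only the
  -- linear part provides decay.
  set κ : ℝ := min (min (1 / 8) (β / 16)) (m * q ^ R / (4 * (2 + β * R))) with hκ
  have hκ1 : κ ≤ 1 / 8 := (min_le_left _ _).trans (min_le_left _ _)
  have hκ2 : κ ≤ β / 16 := (min_le_left _ _).trans (min_le_right _ _)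
  have hκ3 : κ * (2 + β * R) ≤ m * q ^ R / 4 := by
    have h := min_le_right (min (1 / 8) (β / 16)) (m * q ^ R / (4 * (2 + β * R)))
    rw [← hκ, le_div_iff₀ (by positivity)] at h
    linarith
  have hκ0 : 0 < κ := lt_min (lt_min (by norm_num) (by positivity)) (by positivity)
  refine ⟨φ, κ, hκ0, by simp [hφ, hψ], by simp [hφ, hψ]; positivity, hφm, fun d => ?_⟩
  have hψstep : ∀ d, ψ (d + 1) = ψ d + q ^ d := fun d => by
    simp only [hψ, Finset.sum_range_succ]
  have a1 : ψ ((d + 2) / 2) ≤ ψ (d + 1) := hψm (by omega)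
  have a2 : ψ (2 * d + 3) - ψ (d + 1) ≤ 2 * (q ^ d * q) := by
    have := htail (d + 1) (d + 2)
    rw [pow_succ] at this
    rwa [show d + 1 + (d + 2) = 2 * d + 3 by ring] at this
  have a2' : 0 ≤ ψ (2 * d + 3) - ψ (d + 1) := sub_nonneg.2 (hψm (by omega))
  have a3 := hψstep d
  have a4 := hψstep (d + 1)
  rw [pow_succ] at a4
  have hqd : 0 < q ^ d := by positivity
  have b1 : (((d + 2) / 2 : ℕ) : ℝ) ≤ (d + 2) / 2 := by
    have := @Nat.cast_div_le ℝ _ _ _ (d + 2) 2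
    push_cast at this
    exact this
  have hψpart : 3 * (ψ ((d + 2) / 2) - ψ (d + 1)) + 3 * lam * (ψ (2 * d + 3) - ψ (d + 1)) +
      m * (ψ d - ψ (d + 1)) + 6 * s * (ψ (d + 2) - ψ (d + 1)) ≤ -(m / 2 * q ^ d) := by
    have e1 : 3 * lam * (ψ (2 * d + 3) - ψ (d + 1)) ≤ 2 * (q ^ d * q) := by nlinarith
    have e2 : ψ (d + 2) - ψ (d + 1) = q ^ d * q := by linarith
    rw [e2, show ψ d - ψ (d + 1) = -q ^ d by linarith]
    have e3 : 2 * (q ^ d * q) + 6 * s * (q ^ d * q) = m / 2 * q ^ d := by rw [← hqm]; ring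
    linarith
  have hd0 : (0 : ℝ) ≤ d := Nat.cast_nonneg d
  have hlin : 3 * ((((d + 2) / 2 : ℕ) : ℝ) - (d + 1)) + 3 * lam * ((2 * d + 3) - (d + 1)) +
      m * (d - (d + 1)) + 6 * s * ((d + 2) - (d + 1)) ≤ E - (d + 1) / 2 := by
    have : 3 * lam * ((2 * (d : ℝ) + 3) - (d + 1)) ≤ d + 2 := by nlinarith
    rw [hE]
    linarith
  have htot : 3 * (φ ((d + 2) / 2) - φ (d + 1)) + 3 * lam * (φ (2 * d + 3) - φ (d + 1)) +
      m * (φ d - φ (d + 1)) + 6 * s * (φ (d + 2) - φ (d + 1)) ≤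
      -(m / 2 * q ^ d) + β * (E - (d + 1) / 2) := by
    have := mul_le_mul_of_nonneg_left hlin hβ0.le
    simp only [hφ]
    push_cast
    linarith
  refine htot.trans ?_
  have hφ2 : φ (d + 1) ≤ 2 + β * (d + 1) := by
    have := hψ2 (d + 1)
    simp only [hφ]
    push_cast
    linarith
  have hmq : 0 ≤ m / 2 * q ^ d := by positivity
  by_cases hdR : d + 1 ≤ R
  · have h1 : q ^ R ≤ q ^ d := pow_le_pow_of_le_one hq0.le (by linarith) (by omega)
    have h2 : m / 2 * q ^ R ≤ m / 2 * q ^ d := by gcongr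
    have h3 : (d : ℝ) + 1 ≤ R := by exact_mod_cast hdR
    have h4 : κ * φ (d + 1) ≤ κ * (2 + β * R) := by
      gcongr
      refine hφ2.trans ?_
      gcongr
    have h5 : β * (E - (d + 1) / 2) ≤ β * E := by
      gcongr
      linarith
    linarith
  · have h3 : (R : ℝ) ≤ d + 1 := by exact_mod_cast (by omega : R ≤ d + 1)
    have h4 : κ * φ (d + 1) ≤ κ * (2 + β * (d + 1)) := by gcongr
    have h5 : β * (E - (d + 1) / 2) ≤ β * (-(d + 1) / 4) := by
      gcongr
      linarith
    have h6 : κ * (β * (d + 1)) ≤ 1 / 8 * (β * (d + 1)) := by gcongr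
    have h7 : 0 ≤ β * d := by positivity
    linarith

/-! ### Decay of the oscillation of harmonic functions -/

namespace Word

variable {lam C₁ C₂ : ℝ}

theorem gen_eq_of_ne_root {F : Word → ℝ} {x : Word} (h : x ≠ root) :
    gen lam C₁ C₂ F x = 3 * (F x.father - F x) + lam * ∑ i, (F (x.child i) - F x) +
      ∑ z ∈ hor x, weight C₁ C₂ x z * (F z - F x) := by
  rw [gen, if_neg h]

/-- Coupling: functions that are harmonic at high levels have a decaying horizontal oscillation. -/
theorem Admissible.exists_horizontal_decay (A : Admissible lam C₁ C₂) {g : Word → ℝ} {B : ℝ} {M : ℕ}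
    (hB : ∀ x, |g x| ≤ B) (hg : ∀ x, M < x.len → gen lam C₁ C₂ g x = 0) :
    ∃ a γ : ℝ, 0 ≤ a ∧ 0 < γ ∧ γ < 1 ∧
      ∀ x y, M ≤ x.len → HorizontalAdj x y → |g x - g y| ≤ a * γ ^ x.len := by
  have hl := A.lam_pos
  have hl' := A.lam_lt
  have hC₁ := A.C₁_pos
  have hC₂ := A.C₂_pos
  have hmin : 0 < min C₁ C₂ := lt_min hC₁ hC₂
  obtain ⟨φ, κ, hκ, h0, h1, hmono, hφ⟩ := exists_lyapunov hl hl' hmin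
    (s := C₁ + C₂) ((min_le_left _ _).trans (by linarith))
  -- This is the solution of 3(1-γ) = γκ: the loss from weighting the father's level by γ^n is
  -- exactly paid by the Lyapunov drift.
  set γ : ℝ := 3 / (3 + κ) with hγ
  have hγ0 : 0 < γ := by positivity
  have hγ1 : γ < 1 := by rw [hγ, div_lt_one (by positivity)]; linarith
  have hγκ : 3 * (1 - γ) = γ * κ := by rw [hγ]; field_simp; ring
  have hB0 : 0 ≤ B := (abs_nonneg _).trans (hB root)
  -- At level `M` the claim for distinct words then follows from the bound by `B` alone.
  set a : ℝ := 2 * B / (φ 1 * γ ^ M) with ha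
  have ha0 : 0 ≤ a := by positivity
  have haB : a * (γ ^ M * φ 1) = 2 * B := by rw [ha]; field_simp
  have hφ0 : ∀ d, 0 ≤ φ d := fun d => h0 ▸ hmono (Nat.zero_le d)
  have key : ∀ x y : Word, x.len = y.len → M ≤ x.len →
      g x - g y ≤ a * (γ ^ x.len * φ (horGraph.dist x y)) := by
    by_contra! hcon
    obtain ⟨x₀, y₀, hlen₀, hM₀, hlt⟩ := hcon
    set δ := g x₀ - g y₀ - a * (γ ^ x₀.len * φ (horGraph.dist x₀ y₀)) with hδ
    have hδ0 : 0 < δ := by linarith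
    set ε : ℝ := δ / (2 * (x₀.len + 1)) with hε
    have hε0 : 0 < ε := by positivity
    -- A maximum principle for pairs at the same level. The small penalty in the level makes `W`
    -- attain a positive maximum if the claim fails somewhere.
    set W : Word → Word → ℝ := fun x y =>
      g x - g y - a * (γ ^ x.len * φ (horGraph.dist x y)) - ε * x.len with hW
    have hW₀ : 0 < W x₀ y₀ := by
      have : ε * ((x₀.len : ℝ) + 1) = δ / 2 := by rw [hε]; field_simp
      simp only [hW]
      rw [← hδ]
      linarith
    obtain ⟨n₁, hn₁⟩ := exists_nat_gt (2 * B / ε)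
    rw [div_lt_iff₀' hε0] at hn₁
    classical
    let S : Finset (Word × Word) := (upTo (max n₁ x₀.len) ×ˢ upTo (max n₁ x₀.len)).filter
      fun p => p.1.len = p.2.len ∧ M ≤ p.1.len
    have hmem₀ : (x₀, y₀) ∈ S := Finset.mem_filter.2 ⟨Finset.mem_product.2
      ⟨mem_upTo.2 (le_max_right _ _), mem_upTo.2 (hlen₀ ▸ le_max_right _ _)⟩, hlen₀, hM₀⟩
    obtain ⟨⟨x, y⟩, hxy, hmax'⟩ := S.exists_max_image (fun p => W p.1 p.2)
      ⟨(x₀, y₀), hmem₀⟩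
    have hWxy : 0 < W x y := hW₀.trans_le (hmax' (x₀, y₀) hmem₀)
    have hmax : ∀ x' y' : Word, x'.len = y'.len → M ≤ x'.len → W x' y' ≤ W x y := by
      intro x' y' h' hM'
      by_cases hn : x'.len ≤ max n₁ x₀.len
      · exact hmax' (x', y') (by simp only [S, Finset.mem_filter, Finset.mem_product, mem_upTo]; omega)
      · refine le_trans ?_ hWxy.le
        have e1 : (n₁ : ℝ) ≤ x'.len := by
          exact_mod_cast (le_max_left _ _).trans (not_le.1 hn).le
        have e2 : 0 ≤ a * (γ ^ x'.len * φ (horGraph.dist x' y')) :=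
          mul_nonneg ha0 (mul_nonneg (by positivity) (hφ0 _))
        have := abs_le.1 (hB x')
        have := abs_le.1 (hB y')
        have := mul_le_mul_of_nonneg_left e1 hε0.le
        simp only [hW]
        linarith
    simp only [S, Finset.mem_filter, Finset.mem_product] at hxy
    obtain ⟨-, hlen, hM⟩ := hxy
    have hne : x ≠ y := by
      rintro rfl
      have : 0 ≤ ε * x.len := by positivity
      have : W x x ≤ 0 := by
        simp only [hW, SimpleGraph.dist_self, h0]
        linarith
      linarith
    have hd1 := one_le_dist hlen hne
    have hM1 : M < x.len := by
      refine lt_of_le_of_ne hM fun hMx => ?_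
      have e1 : φ 1 ≤ φ (horGraph.dist x y) := hmono hd1
      have e2 : a * (γ ^ M * φ 1) ≤ a * (γ ^ x.len * φ (horGraph.dist x y)) := by
        rw [← hMx]; gcongr
      have e3 : 0 ≤ ε * x.len := by positivity
      have := abs_le.1 (hB x)
      have := abs_le.1 (hB y)
      simp only [hW] at hWxy
      linarith
    have hxr : x ≠ root := by rintro rfl; simp at hM1
    have hyr : y ≠ root := by rintro rfl; rw [hlen] at hM1; simp at hM1
    have hlx := len_father hxr
    have hly := len_father hyr
    obtain ⟨m, hm⟩ : ∃ m, x.len = m + 1 := ⟨_, hlx.symm⟩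
    obtain ⟨d, hd⟩ : ∃ d, horGraph.dist x y = d + 1 := ⟨_, (Nat.sub_add_cancel hd1).symm⟩
    have hΦ := hφ d
    set D := φ (d + 1) with hD
    -- distances after a step
    have d1 : φ (horGraph.dist x.father y.father) ≤ φ ((d + 2) / 2) :=
      hmono (by have := dist_father_le hlen; omega)
    have d1' : φ ((d + 2) / 2) ≤ D := hmono (by omega)
    have d2 : ∀ i, φ (horGraph.dist (x.child i) (y.child i)) ≤ φ (2 * d + 3) := fun i =>
      hmono (by have := dist_child_le hlen i i; omega)
    have d3 : ∀ z ∈ hor x, φ (horGraph.dist z y) ≤ φ (d + 2) := fun z hz =>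
      hmono (by have := dist_hor_le hlen (mem_hor.1 hz); omega)
    have d4 : ∀ z ∈ hor y, φ (horGraph.dist x z) ≤ φ (d + 2) := fun z hz =>
      hmono (by
        have := dist_hor_le hlen.symm (mem_hor.1 hz)
        rw [SimpleGraph.dist_comm (u := z), SimpleGraph.dist_comm (u := y)] at this; omega)
    have hstep : 0 ≤ φ (d + 2) - D := sub_nonneg.2 (hmono (by omega))
    -- comparison at the maximum
    have c1 : g x.father - g x - (g y.father - g y) ≤
        a * (γ ^ m * (φ ((d + 2) / 2) - γ * D)) - ε := by
      have := hmax x.father y.father (by omega) (by omega)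
      simp only [hW, hd, hm, show x.father.len = m by omega] at this
      have := mul_le_mul_of_nonneg_left d1 (by positivity : 0 ≤ a * γ ^ m)
      push_cast at *
      rw [pow_succ] at *
      linarith
    have c2 : ∀ i, (g (x.child i) - g x) - (g (y.child i) - g y) ≤
        a * (γ ^ m * (γ ^ 2 * φ (2 * d + 3) - γ * D)) + ε := by
      intro i
      have := hmax (x.child i) (y.child i) (by simp [hlen]) (by simp; omega)
      simp only [hW, hd, hm, len_child] at this
      have := mul_le_mul_of_nonneg_left (d2 i) (by positivity : 0 ≤ a * (γ ^ m * γ ^ 2))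
      push_cast at *
      simp only [pow_succ, pow_zero, one_mul] at *
      linarith
    have c3 : ∀ z ∈ hor x, g z - g x ≤ a * (γ ^ m * (γ * (φ (horGraph.dist z y) - D))) := by
      intro z hz
      have hz' := mem_hor.1 hz
      have := hmax z y (hz'.1.symm.trans hlen) (by rw [← hz'.1]; exact hM)
      simp only [hW, hd, ← hz'.1, hm] at this
      rw [pow_succ] at this
      linarith
    have c4 : ∀ z ∈ hor y, -(g z - g y) ≤ a * (γ ^ m * (γ * (φ (d + 2) - D))) := by
      intro z hz
      have hz' := mem_hor.1 hz
      have := hmax x z (hlen.trans hz'.1) hM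
      simp only [hW, hd, hm] at this
      have := mul_le_mul_of_nonneg_left (d4 z hz) (by positivity : 0 ≤ a * (γ ^ m * γ))
      rw [pow_succ] at *
      linarith
    -- summation
    have hag : 0 ≤ a * (γ ^ m * γ) := by positivity
    have s2 : lam * ∑ i, (g (x.child i) - g x) - lam * ∑ i, (g (y.child i) - g y) ≤
        3 * lam * (a * (γ ^ m * (γ ^ 2 * φ (2 * d + 3) - γ * D)) + ε) := by
      simp only [Fin.sum_univ_three]
      have := mul_le_mul_of_nonneg_left (add_le_add (add_le_add (c2 0) (c2 1)) (c2 2)) hl.le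
      linarith
    have s4 : -∑ z ∈ hor y, weight C₁ C₂ y z * (g z - g y) ≤
        3 * ((C₁ + C₂) * (a * (γ ^ m * (γ * (φ (d + 2) - D))))) := by
      have hnn : 0 ≤ a * (γ ^ m * (γ * (φ (d + 2) - D))) := by
        have := mul_nonneg hag hstep
        linarith
      rw [← Finset.sum_neg_distrib]
      refine (Finset.sum_le_card_nsmul _ _
        ((C₁ + C₂) * (a * (γ ^ m * (γ * (φ (d + 2) - D))))) fun z hz => ?_).trans ?_
      · rw [← mul_neg]
        exact (mul_le_mul_of_nonneg_left (c4 z hz) (A.weight_pos _ _).le).trans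
          (mul_le_mul_of_nonneg_right (A.weight_le _ _) hnn)
      · rw [nsmul_eq_mul]
        gcongr
        exact_mod_cast card_hor_le y
    have s3 : ∑ z ∈ hor x, weight C₁ C₂ x z * (g z - g x) ≤
        a * (γ ^ m * γ) * (min C₁ C₂ * (φ d - D) + 3 * ((C₁ + C₂) * (φ (d + 2) - D))) := by
      -- One neighbour lies on a shortest path towards `y`. Its weight is at least min(C₁, C₂),
      -- which supplies the term that decreases small distances; every other neighbour increases the
      -- distance by at most 1.
      obtain ⟨z₀, hz₀, hz₀'⟩ := exists_dist_hor_lt hlen hne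
      have hz₀m := mem_hor.2 hz₀
      rw [← Finset.add_sum_erase _ _ hz₀m, mul_add]
      refine add_le_add ?_ ?_
      · have e1 := c3 z₀ hz₀m
        have e2 : φ (horGraph.dist z₀ y) ≤ φ d := hmono (by omega)
        have e3 : φ d - D ≤ 0 := sub_nonpos.2 (hmono (Nat.le_succ d))
        have e4 : g z₀ - g x ≤ a * (γ ^ m * γ) * (φ d - D) := by
          have := mul_le_mul_of_nonneg_left e2 hag
          linarith
        calc weight C₁ C₂ x z₀ * (g z₀ - g x)
            ≤ weight C₁ C₂ x z₀ * (a * (γ ^ m * γ) * (φ d - D)) :=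
              mul_le_mul_of_nonneg_left e4 (A.weight_pos _ _).le
          _ ≤ min C₁ C₂ * (a * (γ ^ m * γ) * (φ d - D)) :=
              mul_le_mul_of_nonpos_right (min_le_weight _ _)
                (mul_nonpos_of_nonneg_of_nonpos hag e3)
          _ = _ := by ring
      · have hnn : 0 ≤ a * (γ ^ m * γ) * (φ (d + 2) - D) := mul_nonneg hag hstep
        refine (Finset.sum_le_card_nsmul _ _
          ((C₁ + C₂) * (a * (γ ^ m * γ) * (φ (d + 2) - D))) fun z hz => ?_).trans ?_
        · have hz := Finset.mem_of_mem_erase hz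
          have e1 : g z - g x ≤ a * (γ ^ m * γ) * (φ (d + 2) - D) := by
            have := c3 z hz
            have := mul_le_mul_of_nonneg_left (d3 z hz) hag
            linarith
          exact (mul_le_mul_of_nonneg_left e1 (A.weight_pos _ _).le).trans
            (mul_le_mul_of_nonneg_right (A.weight_le _ _) hnn)
        · rw [nsmul_eq_mul]
          have hc : (((hor x).erase z₀).card : ℝ) ≤ 3 := by
            exact_mod_cast (Finset.card_erase_le).trans (card_hor_le x)
          have := mul_le_mul_of_nonneg_right hc (mul_nonneg (by positivity : 0 ≤ C₁ + C₂) hnn)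
          linarith
    have hgx := hg x hM1
    have hgy := hg y (hlen ▸ hM1)
    rw [gen_eq_of_ne_root hxr] at hgx
    rw [gen_eq_of_ne_root hyr] at hgy
    have hfin : 0 ≤ a * γ ^ m * (3 * (φ ((d + 2) / 2) - γ * D) +
        3 * lam * (γ ^ 2 * φ (2 * d + 3) - γ * D) +
        γ * (min C₁ C₂ * (φ d - D) + 6 * (C₁ + C₂) * (φ (d + 2) - D))) - 3 * (1 - lam) * ε := by
      linarith
    have hneg : 3 * (φ ((d + 2) / 2) - γ * D) + 3 * lam * (γ ^ 2 * φ (2 * d + 3) - γ * D) +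
        γ * (min C₁ C₂ * (φ d - D) + 6 * (C₁ + C₂) * (φ (d + 2) - D)) ≤ 0 := by
      have e1 := mul_le_mul_of_nonneg_left hΦ hγ0.le
      have e2 : 3 * (1 - γ) * φ ((d + 2) / 2) ≤ 3 * (1 - γ) * D :=
        mul_le_mul_of_nonneg_left d1' (by linarith)
      have e3 : 0 ≤ 3 * lam * (γ * (1 - γ) * φ (2 * d + 3)) :=
        mul_nonneg (by linarith) (mul_nonneg (mul_nonneg hγ0.le (by linarith)) (hφ0 _))
      rw [hγκ] at e2
      have e4 : 3 * φ ((d + 2) / 2) = 3 * γ * φ ((d + 2) / 2) + γ * κ * φ ((d + 2) / 2) := by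
        rw [← hγκ]; ring
      linarith
    have e1 := mul_nonpos_of_nonneg_of_nonpos (by positivity : 0 ≤ a * γ ^ m) hneg
    have e2 : 0 < 3 * (1 - lam) * ε := mul_pos (by linarith) hε0
    linarith
  refine ⟨a * φ 1, γ, mul_nonneg ha0 h1.le, hγ0, hγ1, fun x y hM h => ?_⟩
  have hd : horGraph.dist x y = 1 := SimpleGraph.dist_eq_one_iff_adj.2 h
  have hd' : horGraph.dist y x = 1 := SimpleGraph.dist_eq_one_iff_adj.2 h.symm
  have k1 := key x y h.1 hM
  have k2 := key y x h.1.symm (h.1 ▸ hM)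
  rw [hd] at k1
  rw [hd', ← h.1] at k2
  rw [abs_le]
  constructor <;> linarith

/-- Functions that are harmonic at high levels have decaying increments along edges. -/
theorem Admissible.exists_decay (A : Admissible lam C₁ C₂) {g : Word → ℝ} {B : ℝ} {M : ℕ}
    (hB : ∀ x, |g x| ≤ B) (hg : ∀ x, M < x.len → gen lam C₁ C₂ g x = 0) :
    ∃ a γ : ℝ, 0 ≤ a ∧ 0 < γ ∧ γ < 1 ∧
      ∀ x y, M ≤ x.len → HorizontalAdj x y ∨ IsFather y x → |g x - g y| ≤ a * γ ^ x.len := by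
  obtain ⟨a, γ, ha, hγ0, hγ1, h⟩ := A.exists_horizontal_decay hB hg
  have hl := A.lam_pos
  have hl' := A.lam_lt
  have hC₁ := A.C₁_pos
  have hC₂ := A.C₂_pos
  have hB0 : 0 ≤ B := (abs_nonneg _).trans (hB root)
  have h1l : 0 < 1 - lam := by linarith
  set D : ℝ := (C₁ + C₂) * a / (1 - lam) with hD
  have hD0 : 0 ≤ D := by positivity
  have hDe : lam * D + (C₁ + C₂) * a = D := by rw [hD]; field_simp; ring
  -- Harmonicity bounds the increment to the father by λ times the increments to the children plus
  -- horizontal increments. Iterating shrinks the trivial bound 2B by λ^k, and `D` is the fixed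
  -- point of the inhomogeneous part.
  have hver : ∀ k : ℕ, ∀ x : Word, M < x.len → |g x.father - g x| ≤ D * γ ^ x.len + lam ^ k * (2 * B) := by
    intro k
    induction k with
    | zero =>
      intro x _
      have := abs_le.1 (hB x)
      have := abs_le.1 (hB x.father)
      have : 0 ≤ D * γ ^ x.len := by positivity
      rw [abs_le, pow_zero]
      constructor <;> linarith
    | succ k ih =>
      intro x hx
      have hxr : x ≠ root := by rintro rfl; simp at hx
      have h0 := hg x hx
      rw [gen_eq_of_ne_root hxr] at h0
      have e1 : |∑ i, (g (x.child i) - g x)| ≤ 3 * (D * γ ^ x.len + lam ^ k * (2 * B)) := by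
        refine (Finset.abs_sum_le_sum_abs _ _).trans ?_
        refine (Finset.sum_le_card_nsmul _ _ (D * γ ^ x.len + lam ^ k * (2 * B))
          fun i _ => ?_).trans (by simp [mul_add])
        have := ih (x.child i) (by simp; omega)
        rw [father_child, len_child, abs_sub_comm] at this
        refine this.trans ?_
        gcongr D * ?_ + _
        exact pow_le_pow_of_le_one hγ0.le hγ1.le (Nat.le_succ _)
      have e2 : |∑ z ∈ hor x, weight C₁ C₂ x z * (g z - g x)| ≤
          3 * ((C₁ + C₂) * (a * γ ^ x.len)) := by
        refine (Finset.abs_sum_le_sum_abs _ _).trans ?_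
        refine (Finset.sum_le_card_nsmul _ _ ((C₁ + C₂) * (a * γ ^ x.len)) fun z hz => ?_).trans ?_
        · rw [abs_mul, abs_of_pos (A.weight_pos _ _), abs_sub_comm]
          gcongr
          · exact A.weight_le _ _
          · exact h x z hx.le (mem_hor.1 hz)
        · rw [nsmul_eq_mul]
          gcongr
          exact_mod_cast card_hor_le x
      have e1' := abs_le.1 e1
      have e2' := abs_le.1 e2
      have e3 : D * γ ^ x.len = lam * (D * γ ^ x.len) + (C₁ + C₂) * (a * γ ^ x.len) := by
        conv_lhs => rw [← hDe]
        ring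
      rw [abs_le, e3, pow_succ]
      have p1 := mul_le_mul_of_nonneg_left e1'.1 hl.le
      have p2 := mul_le_mul_of_nonneg_left e1'.2 hl.le
      constructor <;> linarith
  have hver' : ∀ x : Word, M < x.len → |g x.father - g x| ≤ D * γ ^ x.len := by
    intro x hx
    have hlim : Tendsto (fun k : ℕ => D * γ ^ x.len + lam ^ k * (2 * B)) atTop
        (𝓝 (D * γ ^ x.len + 0 * (2 * B))) :=
      ((tendsto_pow_atTop_nhds_zero_of_lt_one hl.le (by linarith)).mul_const _).const_add _
    have := ge_of_tendsto' hlim fun k => hver k x hx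
    simpa using this
  refine ⟨max a D, γ, le_max_of_le_left ha, hγ0, hγ1, fun x y hx hxy => ?_⟩
  rcases hxy with hxy | hxy
  · refine (h x y hx hxy).trans ?_
    gcongr
    exact le_max_left _ _
  · obtain ⟨v, i, rfl⟩ := exists_eq_child hxy.1
    obtain rfl := hxy.2.trans (father_child _ _)
    have := hver' (x.child i) (by simp; omega)
    rw [father_child, len_child] at this
    refine this.trans ?_
    gcongr ?_ * ?_
    · exact le_max_right _ _
    · exact pow_le_pow_of_le_one hγ0.le hγ1.le (Nat.le_succ _)

end Word

end

noncomputable section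

/-! ### Criteria for finite energy -/

namespace Word

theorem sum_level_succ (E : Word → ℝ) (n : ℕ) :
    ∑ x ∈ level (n + 1), E x = ∑ x ∈ level n, ∑ i, E (x.child i) := by
  rw [← Finset.sum_product']
  symm
  refine Finset.sum_nbij (fun p => p.1.child p.2) ?_ ?_ ?_ fun _ _ => rfl
  · intro p hp
    simpa using hp
  · intro p _ q _ h
    exact Prod.ext (child_inj.1 h).1 (child_inj.1 h).2
  · intro x hx
    rw [Finset.mem_coe, mem_level] at hx
    obtain ⟨v, i, rfl⟩ := exists_eq_child (w := x) (by rintro rfl; simp at hx)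
    exact ⟨(v, i), by simpa using hx, rfl⟩

theorem sum_upTo (E : Word → ℝ) (n : ℕ) :
    ∑ x ∈ upTo n, E x = ∑ k ∈ Finset.range (n + 1), ∑ x ∈ level k, E x := by
  rw [← Finset.sum_fiberwise_of_maps_to (s := upTo n) (t := Finset.range (n + 1)) (g := len)
    (fun x hx => by rw [mem_upTo] at hx; rw [Finset.mem_range]; omega)]
  refine Finset.sum_congr rfl fun k hk => Finset.sum_congr ?_ fun _ _ => rfl
  ext x
  rw [Finset.mem_range] at hk
  simp only [Finset.mem_filter, mem_upTo, mem_level]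
  omega

/-- A nonnegative function on words whose sums over children decay geometrically is summable. -/
theorem summable_of_sum_child_le {E : Word → ℝ} (hE : ∀ x, 0 ≤ E x) {N : ℕ} {ρ : ℝ}
    (hρ' : ρ < 1) (h : ∀ x, N ≤ x.len → ∑ i, E (x.child i) ≤ ρ * E x) : Summable E := by
  have hS0 : ∀ n, 0 ≤ ∑ x ∈ level n, E x := fun n => Finset.sum_nonneg fun x _ => hE x
  have hS : Summable fun n => ∑ x ∈ level n, E x := by
    refine summable_of_ratio_norm_eventually_le hρ' ?_
    filter_upwards [eventually_ge_atTop N] with n hn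
    rw [Real.norm_of_nonneg (hS0 _), Real.norm_of_nonneg (hS0 _), sum_level_succ, Finset.mul_sum]
    exact Finset.sum_le_sum fun x hx => h x (by rw [mem_level] at hx; omega)
  refine summable_of_sum_le hE (c := ∑' n, ∑ x ∈ level n, E x) fun s => ?_
  have hs : s ⊆ upTo (s.sup len) := fun x hx => mem_upTo.2 (Finset.le_sup (f := len) hx)
  refine (Finset.sum_le_sum_of_subset_of_nonneg hs fun x _ _ => hE x).trans ?_
  rw [sum_upTo]
  exact hS.sum_le_tsum _ fun n _ => hS0 n

section

variable {lam C₁ C₂ : ℝ}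

/-- Each word has at most seven neighbours, so a summable bound on vertices also sums over edges. -/
theorem Admissible.finiteEnergy_of_le (A : Admissible lam C₁ C₂) {u E : Word → ℝ}
    (hE : ∀ x, 0 ≤ E x) (hs : Summable E)
    (h : ∀ x, ∀ y ∈ nbhd x, conductance lam C₁ C₂ x y * (u x - u y) ^ 2 ≤ E x + E y) :
    FiniteEnergy (conductance lam C₁ C₂) u := by
  classical
  have h1 : Summable fun p : Word × Word => if p.2 ∈ nbhd p.1 then E p.1 else 0 := by
    rw [summable_prod_of_nonneg (fun p => by dsimp only; split_ifs; exacts [hE _, le_rfl])]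
    refine ⟨fun x => summable_of_ne_finset_zero (s := nbhd x) fun y hy => by simp [hy], ?_⟩
    refine Summable.of_nonneg_of_le (fun x => tsum_nonneg fun y => ?_) (fun x => ?_)
      (hs.mul_left 7)
    · dsimp only; split_ifs; exacts [hE _, le_rfl]
    · dsimp only
      rw [tsum_eq_sum (s := nbhd x) fun y hy => by simp [hy],
        Finset.sum_congr rfl fun y hy => if_pos hy, Finset.sum_const, nsmul_eq_mul]
      gcongr
      · exact hE x
      · exact_mod_cast card_nbhd_le x
  have h2 : Summable fun p : Word × Word => if p.2 ∈ nbhd p.1 then E p.2 else 0 := by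
    have := h1.prod_symm
    refine this.congr fun p => ?_
    simp only [Prod.fst_swap, Prod.snd_swap, mem_nbhd_comm (x := p.1)]
  refine Summable.of_nonneg_of_le (fun p => mul_nonneg (A.conductance_nonneg _ _) (sq_nonneg _))
    (fun p => ?_) (h1.add h2)
  by_cases hp : p.2 ∈ nbhd p.1
  · simp only [hp, if_true]
    exact h _ _ hp
  · simp [hp, conductance_eq_zero hp]

theorem Admissible.conductance_mul_sq_le (A : Admissible lam C₁ C₂) {x y : Word} {t a b : ℝ}
    (ha : 0 ≤ a) (hb : 0 ≤ b) (h : t ≤ a + b) :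
    conductance lam C₁ C₂ x y * t ≤
      (1 + C₁ + C₂) / (3 * lam) ^ x.len * a + (1 + C₁ + C₂) / (3 * lam) ^ y.len * b := by
  have h1 := A.conductance_le x y
  have h2 := A.conductance_le y x
  rw [conductance_comm] at h2
  have h3 := A.conductance_nonneg x y
  calc conductance lam C₁ C₂ x y * t ≤ conductance lam C₁ C₂ x y * (a + b) := by gcongr
    _ = conductance lam C₁ C₂ x y * a + conductance lam C₁ C₂ x y * b := by ring
    _ ≤ _ := by gcongr

/-- Finitely supported functions have finite energy. -/
theorem Admissible.finiteEnergy_of_finite (A : Admissible lam C₁ C₂) {u : Word → ℝ}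
    (hu : (Function.support u).Finite) : FiniteEnergy (conductance lam C₁ C₂) u := by
  have hC₁ := A.C₁_pos
  have hC₂ := A.C₂_pos
  have h3 := A.three_pos
  refine A.finiteEnergy_of_le
    (E := fun x => (1 + C₁ + C₂) / (3 * lam) ^ x.len * (2 * u x ^ 2)) (fun x => by positivity)
    (summable_of_hasFiniteSupport (hu.subset fun x hx => ?_)) fun x y _ =>
      A.conductance_mul_sq_le (by positivity) (by positivity) ?_
  · contrapose! hx
    simp only [Function.mem_support, not_not] at hx ⊢
    rw [hx]; simp
  · nlinarith [sq_nonneg (u x + u y)]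

end

/-! ### Piecewise harmonic functions -/

/-- The corner values of the harmonic function with corner values `a` on the subcell `i`. -/
def subcell (i : Fin 3) (a : Fin 3 → ℝ) (j : Fin 3) : ℝ :=
  if j = i then a i else (a i + a j + ∑ k, a k) / 5

theorem subcell_self (i : Fin 3) (a : Fin 3 → ℝ) : subcell i a i = a i := if_pos rfl

/-- The 2/5, 2/5, 1/5 rule for the value at an edge midpoint is symmetric in the two ends, so the
harmonic values of adjacent subcells fit together. -/
theorem subcell_comm (i j : Fin 3) (a : Fin 3 → ℝ) : subcell i a j = subcell j a i := by
  by_cases h : j = i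
  · rw [h]
  · rw [subcell, subcell, if_neg h, if_neg (Ne.symm h), add_comm (a i)]

/-- The new values are convex combinations of the old ones: the maximum principle for harmonic
extension. -/
theorem abs_subcell_sub_le {a : Fin 3 → ℝ} {t ε : ℝ} (h : ∀ j, |a j - t| ≤ ε) (i j : Fin 3) :
    |subcell i a j - t| ≤ ε := by
  rw [subcell]
  split_ifs
  · exact h i
  · rw [Fin.sum_univ_three]
    have h1 := fun j => (abs_le.1 (h j)).1
    have h2 := fun j => (abs_le.1 (h j)).2
    rw [abs_le]
    constructor
    · linarith [h1 i, h1 j, h1 0, h1 1, h1 2]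
    · linarith [h2 i, h2 j, h2 0, h2 1, h2 2]

/-- The energy of three corner values. -/
def cornerEnergy (a : Fin 3 → ℝ) : ℝ := (a 0 - a 1) ^ 2 + (a 1 - a 2) ^ 2 + (a 2 - a 0) ^ 2

theorem cornerEnergy_nonneg (a : Fin 3 → ℝ) : 0 ≤ cornerEnergy a := by
  unfold cornerEnergy; positivity

/-- The renormalization of the energy on the Sierpinski gasket. -/
theorem sum_cornerEnergy_subcell (a : Fin 3 → ℝ) :
    ∑ i, cornerEnergy (subcell i a) = 3 / 5 * cornerEnergy a := by
  simp only [Fin.sum_univ_three, cornerEnergy, subcell]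
  simp
  ring

/-- The mean of the corner values. -/
def mean (a : Fin 3 → ℝ) : ℝ := (∑ j, a j) / 3

theorem abs_mean_sub_le {a : Fin 3 → ℝ} {t ε : ℝ} (h : ∀ j, |a j - t| ≤ ε) :
    |mean a - t| ≤ ε := by
  rw [mean, Fin.sum_univ_three]
  have h1 := fun j => (abs_le.1 (h j)).1
  have h2 := fun j => (abs_le.1 (h j)).2
  rw [abs_le]
  constructor
  · linarith [h1 0, h1 1, h1 2]
  · linarith [h2 0, h2 1, h2 2]

theorem sq_mean_sub_le (a : Fin 3 → ℝ) (j : Fin 3) : (mean a - a j) ^ 2 ≤ cornerEnergy a := by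
  rw [mean, Fin.sum_univ_three, cornerEnergy]
  fin_cases j <;> simp <;>
    nlinarith [sq_nonneg (a 0 - a 1), sq_nonneg (a 1 - a 2), sq_nonneg (a 2 - a 0),
      sq_nonneg (a 0 + a 1 - 2 * a 2), sq_nonneg (a 1 + a 2 - 2 * a 0),
      sq_nonneg (a 2 + a 0 - 2 * a 1)]

/-- The corner values of the functions which are harmonic on the cells of level `N`, with given
corner values on the cells of level at most `N`. -/
def cornerVal (N : ℕ) (b : Word → Fin 3 → ℝ) (w : Word) : Fin 3 → ℝ :=
  List.foldl (fun a i => subcell i a) (b (List.take N w)) (List.drop N w)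

theorem cornerVal_of_le {N : ℕ} {b : Word → Fin 3 → ℝ} {w : Word} (h : w.len ≤ N) :
    cornerVal N b w = b w := by
  unfold cornerVal
  rw [List.take_of_length_le (l := w) h, List.drop_of_length_le (l := w) h]
  rfl

theorem cornerVal_child {N : ℕ} {b : Word → Fin 3 → ℝ} {w : Word} (h : N ≤ w.len) (i : Fin 3) :
    cornerVal N b (w.child i) = subcell i (cornerVal N b w) := by
  have h1 : List.take N (w.child i) = List.take N w :=
    List.take_append_of_le_length (l₁ := w) (l₂ := [i]) h
  have h2 : List.drop N (w.child i) = List.drop N w ++ [i] :=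
    List.drop_append_of_le_length (l₁ := w) (l₂ := [i]) h
  unfold cornerVal
  rw [h1, h2, List.foldl_append]
  rfl

/-- Piecewise harmonic functions are continuous. -/
theorem Meet.cornerVal_eq {N : ℕ} {a : Plane → ℝ} {x y : Word} {i j : Fin 3} (h : Meet x j y i)
    (hN : N ≤ x.len) :
    cornerVal N (fun w k => a (w.map (cornerPt k))) x j =
      cornerVal N (fun w k => a (w.map (cornerPt k))) y i := by
  induction h with
  | base v i j h =>
    by_cases hv : N ≤ v.len
    · rw [cornerVal_child hv, cornerVal_child hv, subcell_comm]
    · rw [cornerVal_of_le (by simp; omega), cornerVal_of_le (by simp; omega),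
        (Meet.base v i j h).map_eq]
  | step x y j i h ih =>
    by_cases hv : N ≤ x.len
    · rw [cornerVal_child hv, cornerVal_child (h.len_eq ▸ hv), subcell_self, subcell_self, ih hv]
    · rw [cornerVal_of_le (by simp; omega), cornerVal_of_le (by rw [← h.step.len_eq]; simp; omega),
        h.step.map_eq]

section

variable {lam C₁ C₂ : ℝ}

/-- Piecewise harmonic functions have finite energy. -/
theorem Admissible.finiteEnergy_piecewise (A : Admissible lam C₁ C₂) (N : ℕ) (a : Plane → ℝ)
    (g : Word → ℝ) : FiniteEnergy (conductance lam C₁ C₂) (fun x =>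
      if x.len < N then g x else mean (cornerVal N (fun w k => a (w.map (cornerPt k))) x)) := by
  have hC₁ := A.C₁_pos
  have hC₂ := A.C₂_pos
  have h3 := A.three_pos
  have hl := A.lam_gt
  set b := cornerVal N (fun w k => a (w.map (cornerPt k))) with hb
  set u : Word → ℝ := fun x => if x.len < N then g x else mean (b x) with hu
  set K := 1 + C₁ + C₂ with hK
  have hK0 : 0 < K := by positivity
  have hQ := fun x => cornerEnergy_nonneg (b x)
  set E₁ : Word → ℝ := fun x => K / (3 * lam) ^ x.len * (2 * cornerEnergy (b x)) with hE₁
  set E₂ : Word → ℝ := fun x => K / (3 * lam) ^ x.len * (if x.len ≤ N then 2 * u x ^ 2 else 0)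
    with hE₂
  have hE₁0 : ∀ x, 0 ≤ E₁ x := fun x => by have := hQ x; positivity
  have hE₂0 : ∀ x, 0 ≤ E₂ x := fun x => by
    simp only [hE₂]; split_ifs <;> positivity
  have hs₁ : Summable E₁ := by
    -- The ratio combines the factor 3/5 of the corner energy with the factor 1/(3λ) of the
    -- conductance. It is below 1 exactly because λ > 1/5.
    refine summable_of_sum_child_le hE₁0 (N := N) (ρ := 1 / (5 * lam)) ?_ fun x hx => ?_
    · rw [div_lt_one (by linarith)]; linarith
    · simp only [hE₁, len_child, hb, cornerVal_child hx]
      rw [← Finset.mul_sum, ← Finset.mul_sum, sum_cornerEnergy_subcell, pow_succ]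
      apply le_of_eq
      have : lam ≠ 0 := by linarith
      field_simp
  have hs₂ : Summable E₂ := by
    refine summable_of_hasFiniteSupport ((upTo N).finite_toSet.subset fun x hx => ?_)
    rw [Finset.mem_coe, mem_upTo]
    contrapose! hx
    simp only [hE₂, Function.mem_support, not_not]
    rw [if_neg (by omega), mul_zero]
  refine A.finiteEnergy_of_le (E := fun x => E₁ x + E₂ x)
    (fun x => add_nonneg (hE₁0 x) (hE₂0 x)) (hs₁.add hs₂) fun x y hxy => ?_
  by_cases hlow : x.len ≤ N ∧ y.len ≤ N
  · have : conductance lam C₁ C₂ x y * (u x - u y) ^ 2 ≤ E₂ x + E₂ y := by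
      simp only [hE₂, hlow.1, hlow.2, if_true]
      exact A.conductance_mul_sq_le (by positivity) (by positivity)
        (by nlinarith [sq_nonneg (u x + u y)])
    linarith [hE₁0 x, hE₁0 y]
  -- Past level `N`, neighbouring cells share a corner value: a child keeps its father's corner of
  -- the same letter, and horizontal neighbours meet at a corner. Both means are then compared with
  -- that value.
  · have hshare : N ≤ x.len ∧ N ≤ y.len ∧ ∃ j i, b x j = b y i := by
      rcases mem_nbhd.1 hxy with h | h | h
      · obtain ⟨v, i, rfl⟩ := exists_eq_child h.1
        obtain rfl := h.2.trans (father_child _ _)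
        simp only [len_child] at hlow ⊢
        refine ⟨by omega, by omega, i, i, ?_⟩
        rw [hb, cornerVal_child (by omega), subcell_self]
      · obtain ⟨v, i, rfl⟩ := exists_eq_child h.1
        obtain rfl := h.2.trans (father_child _ _)
        simp only [len_child] at hlow ⊢
        refine ⟨by omega, by omega, i, i, ?_⟩
        rw [hb, cornerVal_child (by omega), subcell_self]
      · have hlen := h.1
        obtain ⟨j, i, hm⟩ := horizontalAdj_iff.1 h
        have hN : N ≤ x.len := by omega
        exact ⟨hN, by omega, j, i, hm.cornerVal_eq hN⟩
    obtain ⟨hx, hy, j, i, hij⟩ := hshare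
    have : conductance lam C₁ C₂ x y * (u x - u y) ^ 2 ≤ E₁ x + E₁ y := by
      refine A.conductance_mul_sq_le (by have := hQ x; positivity) (by have := hQ y; positivity) ?_
      simp only [hu]
      rw [if_neg (by omega), if_neg (by omega)]
      have h1 := sq_mean_sub_le (b x) j
      have h2 := sq_mean_sub_le (b y) i
      rw [← hij] at h2
      nlinarith [sq_nonneg ((mean (b x) - b x j) + (mean (b y) - b x j))]
    linarith [hE₂0 x, hE₂0 y]

/-- Functions that are harmonic at high levels are uniform limits of functions of finite energy. -/
theorem Admissible.exists_finiteEnergy_near (A : Admissible lam C₁ C₂) {g : Word → ℝ} {B : ℝ}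
    {M : ℕ} (hB : ∀ x, |g x| ≤ B) (hg : ∀ x, M < x.len → gen lam C₁ C₂ g x = 0) {ε : ℝ}
    (hε : 0 < ε) :
    ∃ u, FiniteEnergy (conductance lam C₁ C₂) u ∧ ∀ x, |u x - g x| ≤ ε := by
  classical
  obtain ⟨D, γ, hD, hγ0, hγ1, h⟩ := A.exists_decay hB hg
  have h1γ : 0 < 1 - γ := by linarith
  obtain ⟨N, hN, hNε⟩ : ∃ N : ℕ, M ≤ N ∧ D * γ ^ N * (1 + 1 / (1 - γ)) ≤ ε := by
    have h := ((tendsto_pow_atTop_nhds_zero_of_lt_one hγ0.le hγ1).const_mul D).mul_const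
      (1 + 1 / (1 - γ))
    rw [mul_zero, zero_mul] at h
    obtain ⟨N, h1, h2⟩ := ((h.eventually (eventually_le_nhds hε)).and
      (eventually_ge_atTop M)).exists
    exact ⟨N, h2, h1⟩
  -- Corner values must depend on the point and not on the cell. A chosen cell of level `N`
  -- containing the point provides the value; any other such cell is adjacent to it, so the error is
  -- one horizontal increment.
  let a : Plane → ℝ := fun p =>
    if hp : ∃ w : Word, w.len = N ∧ p ∈ w.cell then g hp.choose else 0
  have ha : ∀ w : Word, w.len = N → ∀ j, |a (w.map (cornerPt j)) - g w| ≤ D * γ ^ N := by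
    intro w hw j
    have hp : ∃ v : Word, v.len = N ∧ w.map (cornerPt j) ∈ v.cell :=
      ⟨w, hw, map_cornerPt_mem_cell w j⟩
    have ea : a (w.map (cornerPt j)) = g hp.choose := dif_pos hp
    obtain ⟨hv, hv'⟩ := hp.choose_spec
    rw [ea]
    by_cases hvw : hp.choose = w
    · rw [hvw, sub_self, abs_zero]
      positivity
    · have := h hp.choose w (by omega)
        (Or.inl ⟨hv.trans hw.symm, hvw, _, hv', map_cornerPt_mem_cell w j⟩)
      rwa [hv] at this
  set b := cornerVal N (fun w k => a (w.map (cornerPt k))) with hb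
  -- The witness `v` is the ancestor at level `N`: vertical increments of `g` telescope to a
  -- geometric sum, while harmonic extension keeps the corner values within the initial error.
  have key : ∀ w : Word, N ≤ w.len → ∃ v : Word, |g w - g v| * (1 - γ) ≤ D * (γ ^ N - γ ^ w.len) ∧
      ∀ j, |b w j - g v| ≤ D * γ ^ N := by
    have hbase : ∀ w : Word, w.len = N → ∃ v : Word,
        |g w - g v| * (1 - γ) ≤ D * (γ ^ N - γ ^ w.len) ∧ ∀ j, |b w j - g v| ≤ D * γ ^ N := by
      intro w hw
      refine ⟨w, by simp [hw], fun j => ?_⟩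
      rw [hb, cornerVal_of_le hw.le]
      exact ha w hw j
    intro w
    induction w using child_induction with
    | h₀ => exact fun h0 => hbase root (by simp at h0 ⊢; omega)
    | h w i ih =>
      intro hw
      by_cases hw' : N ≤ w.len
      · obtain ⟨v, hv, hv'⟩ := ih hw'
        refine ⟨v, ?_, fun j => ?_⟩
        · have h1 := h w (w.child i) (by omega)
            (Or.inr ⟨child_ne_root _ _, (father_child _ _).symm⟩)
          rw [abs_sub_comm] at h1
          have h2 := abs_sub_le (g (w.child i)) (g w) (g v)
          rw [len_child, pow_succ]
          have h3 : |g (w.child i) - g v| * (1 - γ) ≤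
              (|g (w.child i) - g w| + |g w - g v|) * (1 - γ) := by gcongr
          have h4 := mul_le_mul_of_nonneg_right h1 h1γ.le
          linarith
        · rw [hb, cornerVal_child hw']
          exact abs_subcell_sub_le hv' i j
      · exact hbase _ (by simp at hw ⊢; omega)
  refine ⟨_, A.finiteEnergy_piecewise N a g, fun x => ?_⟩
  by_cases hx : x.len < N
  · simp only [hx, if_true, sub_self, abs_zero]
    exact hε.le
  · simp only [hx, if_false]
    obtain ⟨v, hv, hv'⟩ := key x (by omega)
    have h1 := abs_mean_sub_le hv'
    have h2 : |g x - g v| ≤ D * γ ^ N * (1 / (1 - γ)) := by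
      rw [mul_one_div, le_div_iff₀ h1γ]
      refine hv.trans ?_
      gcongr
      have := pow_pos hγ0 x.len
      linarith
    have h3 := abs_sub_le (mean (b x)) (g v) (g x)
    rw [abs_sub_comm (g v)] at h3
    rw [← hb]
    linarith

end

end Word

end

noncomputable section

/-! ### The bilinear energy form -/

section Energy

variable {V : Type} {c : V → V → ℝ} {u v w : V → ℝ}

theorem FiniteEnergy.summable_mul (hc : ∀ x y, 0 ≤ c x y) (hu : FiniteEnergy c u)
    (hv : FiniteEnergy c v) :
    Summable fun p : V × V => c p.1 p.2 * ((u p.1 - u p.2) * (v p.1 - v p.2)) := by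
  refine Summable.of_norm_bounded (hu.add hv) fun p => ?_
  rw [Real.norm_eq_abs, abs_mul, abs_of_nonneg (hc _ _), ← mul_add]
  refine mul_le_mul_of_nonneg_left ?_ (hc _ _)
  rw [abs_le]
  constructor <;> nlinarith [sq_nonneg ((u p.1 - u p.2) + (v p.1 - v p.2)),
    sq_nonneg ((u p.1 - u p.2) - (v p.1 - v p.2))]

theorem FiniteEnergy.smul (a : ℝ) (hu : FiniteEnergy c u) : FiniteEnergy c fun x => a * u x :=
  (hu.mul_left (a ^ 2)).congr fun p => by ring

/-- A function with increments dominated by those of two functions of finite energy has finite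
energy. -/
theorem FiniteEnergy.of_le_add (hc : ∀ x y, 0 ≤ c x y) (hu : FiniteEnergy c u)
    (hv : FiniteEnergy c v)
    (h : ∀ x y, |w x - w y| ≤ |u x - u y| + |v x - v y|) : FiniteEnergy c w := by
  refine Summable.of_nonneg_of_le (fun p => mul_nonneg (hc _ _) (sq_nonneg _)) (fun p => ?_)
    ((hu.mul_left 2).add (hv.mul_left 2))
  have h1 := h p.1 p.2
  have h2 : (w p.1 - w p.2) ^ 2 ≤ 2 * (u p.1 - u p.2) ^ 2 + 2 * (v p.1 - v p.2) ^ 2 := by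
    rw [← sq_abs, ← sq_abs (u p.1 - u p.2), ← sq_abs (v p.1 - v p.2)]
    nlinarith [abs_nonneg (w p.1 - w p.2), sq_nonneg (|u p.1 - u p.2| - |v p.1 - v p.2|)]
  have := mul_le_mul_of_nonneg_left h2 (hc p.1 p.2)
  linarith

theorem finiteEnergy_const (a : ℝ) : FiniteEnergy c fun _ => a := by
  simp [FiniteEnergy, summable_zero]

theorem FiniteEnergy.of_le (hc : ∀ x y, 0 ≤ c x y) (hu : FiniteEnergy c u)
    (h : ∀ x y, |w x - w y| ≤ |u x - u y|) : FiniteEnergy c w :=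
  hu.of_le_add hc (finiteEnergy_const 0) fun x y => by simpa using h x y

theorem FiniteEnergy.add (hc : ∀ x y, 0 ≤ c x y) (hu : FiniteEnergy c u) (hv : FiniteEnergy c v) :
    FiniteEnergy c fun x => u x + v x :=
  hu.of_le_add hc hv fun x y => by
    rw [show u x + v x - (u y + v y) = (u x - u y) + (v x - v y) by ring]
    exact abs_add_le _ _

theorem FiniteEnergy.sub (hc : ∀ x y, 0 ≤ c x y) (hu : FiniteEnergy c u) (hv : FiniteEnergy c v) :
    FiniteEnergy c fun x => u x - v x :=
  hu.of_le_add hc hv fun x y => by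
    rw [show u x - v x - (u y - v y) = (u x - u y) - (v x - v y) by ring]
    exact abs_sub _ _

theorem FiniteEnergy.mul (hc : ∀ x y, 0 ≤ c x y) (hu : FiniteEnergy c u) (hv : FiniteEnergy c v)
    {a b : ℝ} (ha : ∀ x, |u x| ≤ a) (hb : ∀ x, |v x| ≤ b) : FiniteEnergy c fun x => u x * v x :=
  (hu.smul b).of_le_add hc (hv.smul a) fun x y => by
    rw [show u x * v x - u y * v y = v x * (u x - u y) + u y * (v x - v y) by ring,
      ← mul_sub, ← mul_sub, abs_mul b, abs_mul a]
    refine (abs_add_le _ _).trans ?_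
    rw [abs_mul, abs_mul]
    exact add_le_add
      (mul_le_mul_of_nonneg_right ((hb x).trans (le_abs_self b)) (abs_nonneg _))
      (mul_le_mul_of_nonneg_right ((ha y).trans (le_abs_self a)) (abs_nonneg _))

theorem energy_comm (u v : V → ℝ) : energy c u v = energy c v u := by
  simp only [energy, mul_comm (u _ - u _)]

theorem energy_add_left (hc : ∀ x y, 0 ≤ c x y) (hu : FiniteEnergy c u) (hv : FiniteEnergy c v)
    (hw : FiniteEnergy c w) :
    energy c (fun x => u x + v x) w = energy c u w + energy c v w := by
  rw [energy, energy, energy, ← mul_add,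
    ← (hu.summable_mul hc hw).tsum_add (hv.summable_mul hc hw)]
  congr 1
  exact tsum_congr fun p => by ring

theorem energy_smul_left (a : ℝ) (u v : V → ℝ) :
    energy c (fun x => a * u x) v = a * energy c u v := by
  rw [energy, energy, mul_left_comm]
  congr 1
  rw [← tsum_mul_left]
  exact tsum_congr fun p => by ring

theorem energy_le (hc : ∀ x y, 0 ≤ c x y) (hu : FiniteEnergy c u)
    (h : ∀ x y, |w x - w y| ≤ |u x - u y|) : energy c w w ≤ energy c u u := by
  have : 2 * energy c w w ≤ 2 * energy c u u := by
    rw [energy_self, energy_self]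
    exact (hu.of_le hc h).tsum_le_tsum (fun p =>
      mul_le_mul_of_nonneg_left (sq_le_sq.2 (h _ _)) (hc _ _)) hu
  linarith

/-- Lower semicontinuity of the energy with respect to pointwise convergence. -/
theorem finiteEnergy_of_tendsto (hc : ∀ x y, 0 ≤ c x y) {u : ℕ → V → ℝ} {v : V → ℝ}
    (hu : ∀ n, FiniteEnergy c (u n)) (hv : ∀ x, Tendsto (fun n => u n x) atTop (𝓝 (v x))) {b : ℝ}
    (hb : ∀ᶠ n in atTop, energy c (u n) (u n) ≤ b) : FiniteEnergy c v ∧ energy c v v ≤ b := by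
  have h0 : ∀ (f : V → ℝ) (p : V × V), 0 ≤ c p.1 p.2 * (f p.1 - f p.2) ^ 2 := fun f p =>
    mul_nonneg (hc _ _) (sq_nonneg _)
  have key : ∀ s : Finset (V × V), ∑ p ∈ s, c p.1 p.2 * (v p.1 - v p.2) ^ 2 ≤ 2 * b := by
    intro s
    have hlim : Tendsto (fun n => ∑ p ∈ s, c p.1 p.2 * (u n p.1 - u n p.2) ^ 2) atTop
        (𝓝 (∑ p ∈ s, c p.1 p.2 * (v p.1 - v p.2) ^ 2)) :=
      tendsto_finsetSum _ fun p _ => (((hv p.1).sub (hv p.2)).pow 2).const_mul _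
    refine le_of_tendsto hlim (hb.mono fun n hn => ?_)
    have h1 : ∑ p ∈ s, c p.1 p.2 * (u n p.1 - u n p.2) ^ 2 ≤ 2 * energy c (u n) (u n) := by
      rw [energy_self]
      exact (hu n).sum_le_tsum s fun p _ => h0 (u n) p
    linarith
  have hfin : FiniteEnergy c v := summable_of_sum_le (h0 v) key
  refine ⟨hfin, ?_⟩
  have := hfin.tsum_le_of_sum_le key
  rw [← energy_self] at this
  linarith

end Energy

theorem real_singleton_mul_le_integral {E : Type*} [MeasurableSpace E] [MeasurableSingletonClass E]
    {μ : Measure E} {f : E → ℝ} (hf : Integrable f μ) (h0 : ∀ x, 0 ≤ f x) (a : E) :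
    μ.real {a} * f a ≤ ∫ x, f x ∂μ := by
  have := setIntegral_le_integral (s := {a}) hf (Eventually.of_forall h0)
  rwa [integral_singleton, smul_eq_mul] at this

theorem L2_norm_sq_eq {E : Type*} [MeasurableSpace E] {μ : Measure E} (u : Lp ℝ 2 μ) :
    ‖u‖ ^ 2 = ∫ x, u x ^ 2 ∂μ := by
  rw [← real_inner_self_eq_norm_sq, L2.inner_def]
  refine integral_congr_ae (Eventually.of_forall fun x => ?_)
  simp [sq]

/-- At an atom the L² norm controls the value. This bounds the value at the root and turns L²
convergence into pointwise convergence on X. -/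
theorem real_singleton_mul_sq_le {E : Type*} [MeasurableSpace E] [MeasurableSingletonClass E]
    {μ : Measure E} (u : Lp ℝ 2 μ) (a : E) : μ.real {a} * u a ^ 2 ≤ ‖u‖ ^ 2 := by
  rw [L2_norm_sq_eq]
  exact real_singleton_mul_le_integral (Lp.memLp u).integrable_sq (fun x => sq_nonneg _) a

/-! ### The measures -/

section Martin

variable {V : Type} [Countable V] (P : V → V → ℝ) (o : V)

instance : SecondCountableTopology (MartinCompactification P o) :=
  inferInstanceAs (SecondCountableTopology (closure (range (martinMap P o))))

instance : TopologicalSpace.MetrizableSpace (MartinCompactification P o) :=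
  TopologicalSpace.metrizableSpace_of_t3_secondCountable _

end Martin

namespace Word

variable {lam θ C₁ C₂ : ℝ}

theorem vertexMeasure_singleton (x : Word) :
    vertexMeasure lam θ {x} = ENNReal.ofReal ((θ / (3 * lam)) ^ x.len) := by
  classical
  rw [vertexMeasure, Measure.sum_apply _ (measurableSet_singleton x), tsum_eq_single x]
  · simp
  · intro y hy
    simp [hy]

/-- Level n has mass 3^n (θ/(3λ))^n = (θ/λ)^n, a geometric series. -/
theorem isFiniteMeasure_vertexMeasure (hl : 0 < lam) (hθ : 0 < θ) (hθl : θ < lam) :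
    IsFiniteMeasure (vertexMeasure lam θ) := by
  refine ⟨?_⟩
  rw [vertexMeasure, Measure.sum_apply _ MeasurableSet.univ]
  simp only [Measure.smul_apply, measure_univ, smul_eq_mul, mul_one]
  refine Summable.tsum_ofReal_lt_top ?_
  refine summable_of_sum_child_le (N := 0) (ρ := θ / lam) (fun x => pow_nonneg (div_pos hθ (mul_pos three_pos hl)).le _)
    ((div_lt_one hl).2 hθl) fun x _ => le_of_eq ?_
  simp only [len_child, Finset.sum_const, Finset.card_univ, Fintype.card_fin, nsmul_eq_mul,
    pow_succ]
  push_cast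
  field_simp

theorem vertexMeasure_singleton_pos (hl : 0 < lam) (hθ : 0 < θ) (x : Word) :
    0 < vertexMeasure lam θ {x} := by
  rw [vertexMeasure_singleton]
  exact ENNReal.ofReal_pos.2 (by positivity)

theorem ae_vertexMeasure_iff (hl : 0 < lam) (hθ : 0 < θ) {p : Word → Prop} :
    (∀ᵐ x ∂vertexMeasure lam θ, p x) ↔ ∀ x, p x := by
  refine ⟨fun h x => ?_, Eventually.of_forall⟩
  by_contra hx
  have h1 : vertexMeasure lam θ {x} ≤ vertexMeasure lam θ {y | ¬ p y} :=
    measure_mono (by simpa using hx)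
  rw [ae_iff] at h
  rw [h] at h1
  exact (vertexMeasure_singleton_pos hl hθ x).not_ge h1

theorem measurable_inclX : Measurable (inclX lam C₁ C₂) := measurable_from_top

theorem measureXBar_singleton (x : Word) :
    measureXBar lam θ C₁ C₂ {inclX lam C₁ C₂ x} = vertexMeasure lam θ {x} := by
  rw [measureXBar, Measure.map_apply measurable_inclX (measurableSet_singleton _)]
  congr 1
  ext y
  simp [(martinIncl_injective _ _).eq_iff]

theorem isFiniteMeasure_measureXBar (hl : 0 < lam) (hθ : 0 < θ) (hθl : θ < lam) :
    IsFiniteMeasure (measureXBar lam θ C₁ C₂) := by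
  have := isFiniteMeasure_vertexMeasure hl hθ hθl
  unfold measureXBar
  infer_instance

theorem measurableSet_range_inclX : MeasurableSet (range (inclX lam C₁ C₂)) :=
  (isOpenEmbedding_martinIncl _ _).isOpen_range.measurableSet

theorem ae_mem_range_inclX :
    ∀ᵐ ξ ∂measureXBar lam θ C₁ C₂, ξ ∈ range (inclX lam C₁ C₂) :=
  (ae_map_iff measurable_inclX.aemeasurable measurableSet_range_inclX).2
    (Eventually.of_forall fun x => mem_range_self x)

/-- Points of X are atoms and the boundary is null, so an L² class on X̄ is the same as its values
on X. -/
theorem ae_measureXBar_iff (hl : 0 < lam) (hθ : 0 < θ) {p : XBar lam C₁ C₂ → Prop} :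
    (∀ᵐ ξ ∂measureXBar lam θ C₁ C₂, p ξ) ↔ ∀ x, p (inclX lam C₁ C₂ x) := by
  constructor
  · intro h x
    by_contra hx
    have h1 : measureXBar lam θ C₁ C₂ {inclX lam C₁ C₂ x} ≤ measureXBar lam θ C₁ C₂ {y | ¬ p y} :=
      measure_mono (by simpa using hx)
    rw [ae_iff] at h
    rw [h, measureXBar_singleton] at h1
    exact (vertexMeasure_singleton_pos hl hθ x).not_ge h1
  · intro h
    filter_upwards [ae_mem_range_inclX (lam := lam) (θ := θ) (C₁ := C₁) (C₂ := C₂)] with ξ hξ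
    obtain ⟨x, rfl⟩ := hξ
    exact h x

theorem real_root : (vertexMeasure lam θ).real {root} = 1 := by
  rw [Measure.real, vertexMeasure_singleton]
  simp

/-! ### The supremum bound and the regularity of the form -/

variable (lam C₁ C₂) in
/-- The constant in the bound of the supremum norm by the energy norm. -/
def supConst : ℝ := 1 + edgeConst lam C₁ C₂ / (1 - Real.sqrt (3 * lam))

theorem Admissible.supConst_pos (A : Admissible lam C₁ C₂) : 0 < supConst lam C₁ C₂ := by
  have := A.edgeConst_pos
  have : 0 < 1 - Real.sqrt (3 * lam) := by linarith [A.sqrt_lt_one]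
  unfold supConst
  positivity

theorem Admissible.abs_le_supConst (A : Admissible lam C₁ C₂) {u : Word → ℝ}
    (hu : FiniteEnergy (conductance lam C₁ C₂) u) {t : ℝ} (h0 : u root ^ 2 ≤ t)
    (hE : energy (conductance lam C₁ C₂) u u ≤ t) (x : Word) :
    |u x| ≤ supConst lam C₁ C₂ * Real.sqrt t := by
  have h1 := A.abs_sub_root_le hu x
  have h2 := abs_sub_abs_le_abs_sub (u x) (u root)
  have h3 : |u root| ≤ Real.sqrt t := Real.abs_le_sqrt h0
  have h4 : 0 < 1 - Real.sqrt (3 * lam) := by linarith [A.sqrt_lt_one]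
  have h5 := A.edgeConst_pos
  have h6 : edgeConst lam C₁ C₂ * Real.sqrt (energy (conductance lam C₁ C₂) u u) /
      (1 - Real.sqrt (3 * lam)) ≤ edgeConst lam C₁ C₂ * Real.sqrt t / (1 - Real.sqrt (3 * lam)) := by
    gcongr
  rw [supConst, add_mul, one_mul, div_mul_eq_mul_div]
  linarith

theorem Admissible.exists_abs_le (A : Admissible lam C₁ C₂) {u : Word → ℝ}
    (hu : FiniteEnergy (conductance lam C₁ C₂) u) : ∃ b, ∀ x, |u x| ≤ b :=
  ⟨_, A.abs_le_supConst hu (le_max_left _ _) (le_max_right _ _)⟩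

/-! ### The algebra of continuous functions of finite energy. -/

variable (lam C₁ C₂) in
/-- The trace of a continuous function on the vertices. -/
def trace (f : C(XBar lam C₁ C₂, ℝ)) (x : Word) : ℝ := f (inclX lam C₁ C₂ x)

theorem abs_trace_le (f : C(XBar lam C₁ C₂, ℝ)) (x : Word) : |trace lam C₁ C₂ f x| ≤ ‖f‖ :=
  f.norm_coe_le_norm _

/-- The algebra of continuous functions of finite energy. -/
def Admissible.core (A : Admissible lam C₁ C₂) : Subalgebra ℝ C(XBar lam C₁ C₂, ℝ) where
  carrier := {f | FiniteEnergy (conductance lam C₁ C₂) (trace lam C₁ C₂ f)}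
  mul_mem' := by
    intro f g hf hg
    have e : trace lam C₁ C₂ (f * g) = fun x => trace lam C₁ C₂ f x * trace lam C₁ C₂ g x :=
      funext fun x => ContinuousMap.mul_apply f g _
    rw [mem_ofPred_eq, e]
    exact FiniteEnergy.mul A.conductance_nonneg hf hg (abs_trace_le f) (abs_trace_le g)
  add_mem' := by
    intro f g hf hg
    have e : trace lam C₁ C₂ (f + g) = fun x => trace lam C₁ C₂ f x + trace lam C₁ C₂ g x :=
      funext fun x => ContinuousMap.add_apply f g _
    rw [mem_ofPred_eq, e]
    exact FiniteEnergy.add A.conductance_nonneg hf hg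
  algebraMap_mem' := fun r => finiteEnergy_const r

theorem Admissible.mem_core (A : Admissible lam C₁ C₂) {f : C(XBar lam C₁ C₂, ℝ)} :
    f ∈ A.core ↔ FiniteEnergy (conductance lam C₁ C₂) (trace lam C₁ C₂ f) := Iff.rfl

/-- A point of X̄ is determined by its coordinates. The Martin coordinates are functions of the
extended `relGreen x`, which are uniform limits of elements of `core`; the indicator coordinates
come from finitely supported functions, which lie in `core`. -/
theorem Admissible.core_separatesPoints (A : Admissible lam C₁ C₂) : A.core.SeparatesPoints := by
  intro ξ η hne
  by_contra hcon
  have hagree : ∀ f ∈ A.core, f ξ = f η := by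
    intro f hf
    by_contra h
    exact hcon ⟨f, ⟨f, hf, rfl⟩, h⟩
  apply hne
  refine Subtype.ext (Prod.ext (funext fun x => ?_) (funext fun x => ?_))
  · obtain ⟨g, hg, k, hk⟩ := A.exists_relGreen_extension x
    rw [hk, hk]
    congr 2
    obtain ⟨B, hB⟩ := A.exists_relGreen_le x
    refine eq_of_forall_dist_le fun ε hε => ?_
    obtain ⟨u, hu, hug⟩ := A.exists_finiteEnergy_near (g := relGreen lam C₁ C₂ x) (B := B)
      (M := x.len) (fun y => by rw [abs_of_nonneg (A.relGreen_nonneg x y)]; exact hB y)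
      (fun y hy => by rw [A.gen_relGreen, if_neg (by rintro rfl; exact lt_irrefl _ hy)])
      (half_pos hε)
    obtain ⟨f, hf⟩ := A.exists_extension hu
    have hfc : f ∈ A.core := by
      rw [A.mem_core]
      convert hu using 1
      exact funext hf
    have hclose : ∀ ζ, |f ζ - g ζ| ≤ ε / 2 := fun ζ =>
      abs_le_of_abs_martinIncl_le (f := fun ζ => f ζ - g ζ) (by fun_prop)
        (fun y => by
          have h1 := hf y
          have h2 := hg y
          have h3 := hug y
          rw [← h1, ← h2] at h3
          exact h3) ζ
    have h1 := abs_le.1 (hclose ξ)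
    have h2 := abs_le.1 (hclose η)
    rw [hagree f hfc] at h1
    rw [Real.dist_eq, abs_le]
    constructor <;> linarith
  · have hfe : FiniteEnergy (conductance lam C₁ C₂) (Set.indicator {x} fun _ => (1 : ℝ)) :=
      A.finiteEnergy_of_finite ((finite_singleton x).subset Set.support_indicator_subset)
    obtain ⟨f, hf⟩ := A.exists_extension hfe
    have hfc : f ∈ A.core := by
      rw [A.mem_core]
      convert hfe using 1
      exact funext hf
    have hval : ∀ ζ : XBar lam C₁ C₂, f ζ = if ζ.1.2 x = true then 1 else 0 := by
      intro ζ
      have hcont : Continuous fun ζ : XBar lam C₁ C₂ => ζ.1.2 x :=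
        (continuous_apply x).comp (continuous_snd.comp (continuous_martinMap_val _ _))
      have hcont' : Continuous fun b : Bool => if b = true then (1 : ℝ) else 0 :=
        continuous_of_discreteTopology
      refine (denseRange_martinIncl (walkX lam C₁ C₂) root).induction_on
        (p := fun ζ => f ζ = if ζ.1.2 x = true then 1 else 0) ζ
        (isClosed_eq f.continuous (hcont'.comp hcont)) fun y => ?_
      refine (hf y).trans ?_
      by_cases hxy : x = y
      · simp [martinIncl, martinMap, hxy]
      · simp [martinIncl, martinMap, hxy, Ne.symm hxy]
    have h := hagree f hfc
    rw [hval, hval] at h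
    cases h1 : ξ.1.2 x <;> cases h2 : η.1.2 x <;> simp [h1, h2] at h ⊢

theorem Admissible.core_dense (A : Admissible lam C₁ C₂) :
    Dense (A.core : Set C(XBar lam C₁ C₂, ℝ)) := by
  have h := ContinuousMap.subalgebra_topologicalClosure_eq_top_of_separatesPoints _
    A.core_separatesPoints
  rw [dense_iff_closure_eq, ← Subalgebra.topologicalClosure_coe, h]
  rfl

/-- The elements of the domain on the compactification are determined by the finiteness of their
energy. -/
theorem Admissible.mem_dom_formXBar (A : Admissible lam C₁ C₂) (hθ : 0 < θ)
    {u : Lp ℝ 2 (measureXBar lam θ C₁ C₂)} :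
    u ∈ (formXBar lam θ C₁ C₂).dom ↔
      FiniteEnergy (conductance lam C₁ C₂) fun x => u (inclX lam C₁ C₂ x) := by
  constructor
  · rintro ⟨f, huf, hf⟩
    have h := (ae_measureXBar_iff A.lam_pos hθ).1 huf
    simpa only [h] using hf
  · intro hu
    obtain ⟨f, hf⟩ := A.exists_extension hu
    refine ⟨f, (ae_measureXBar_iff A.lam_pos hθ).2 fun x => (hf x).symm, ?_⟩
    simpa only [hf] using hu

theorem formXBar_form (u v : Lp ℝ 2 (measureXBar lam θ C₁ C₂)) :
    (formXBar lam θ C₁ C₂).form u v =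
      energy (conductance lam C₁ C₂) (fun x => u (inclX lam C₁ C₂ x))
        (fun x => v (inclX lam C₁ C₂ x)) := rfl

theorem formXBar_normSq₁ (u : Lp ℝ 2 (measureXBar lam θ C₁ C₂)) :
    (formXBar lam θ C₁ C₂).normSq₁ u =
      energy (conductance lam C₁ C₂) (fun x => u (inclX lam C₁ C₂ x))
        (fun x => u (inclX lam C₁ C₂ x)) + ‖u‖ ^ 2 := rfl

theorem Admissible.abs_le_normSq₁ (A : Admissible lam C₁ C₂) (hθ : 0 < θ)
    {u : Lp ℝ 2 (measureXBar lam θ C₁ C₂)} (hu : u ∈ (formXBar lam θ C₁ C₂).dom) (x : Word) :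
    |u (inclX lam C₁ C₂ x)| ≤
      supConst lam C₁ C₂ * Real.sqrt ((formXBar lam θ C₁ C₂).normSq₁ u) := by
  have hE := energy_self_nonneg A.conductance_nonneg fun x => u (inclX lam C₁ C₂ x)
  refine A.abs_le_supConst ((A.mem_dom_formXBar hθ).1 hu) ?_ ?_ x
  · have h := real_singleton_mul_sq_le u (inclX lam C₁ C₂ root)
    rw [Measure.real, measureXBar_singleton, ← Measure.real, real_root, one_mul] at h
    rw [formXBar_normSq₁]
    linarith
  · rw [formXBar_normSq₁]
    linarith [sq_nonneg ‖u‖]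

theorem Admissible.coe_add (A : Admissible lam C₁ C₂) (hθ : 0 < θ)
    (u v : Lp ℝ 2 (measureXBar lam θ C₁ C₂)) (x : Word) :
    (u + v : Lp ℝ 2 _) (inclX lam C₁ C₂ x) = u (inclX lam C₁ C₂ x) + v (inclX lam C₁ C₂ x) :=
  (ae_measureXBar_iff A.lam_pos hθ).1 (Lp.coeFn_add u v) x

theorem Admissible.coe_sub (A : Admissible lam C₁ C₂) (hθ : 0 < θ)
    (u v : Lp ℝ 2 (measureXBar lam θ C₁ C₂)) (x : Word) :
    (u - v : Lp ℝ 2 _) (inclX lam C₁ C₂ x) = u (inclX lam C₁ C₂ x) - v (inclX lam C₁ C₂ x) :=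
  (ae_measureXBar_iff A.lam_pos hθ).1 (Lp.coeFn_sub u v) x

theorem Admissible.coe_smul (A : Admissible lam C₁ C₂) (hθ : 0 < θ) (a : ℝ)
    (u : Lp ℝ 2 (measureXBar lam θ C₁ C₂)) (x : Word) :
    (a • u : Lp ℝ 2 _) (inclX lam C₁ C₂ x) = a * u (inclX lam C₁ C₂ x) :=
  (ae_measureXBar_iff A.lam_pos hθ).1 (Lp.coeFn_smul a u) x

theorem Admissible.coe_zero (A : Admissible lam C₁ C₂) (hθ : 0 < θ) (x : Word) :
    (0 : Lp ℝ 2 (measureXBar lam θ C₁ C₂)) (inclX lam C₁ C₂ x) = 0 :=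
  (ae_measureXBar_iff A.lam_pos hθ).1 (Lp.coeFn_zero ℝ 2 (measureXBar lam θ C₁ C₂)) x

/-- Completeness of the form. -/
theorem Admissible.closed_formXBar (A : Admissible lam C₁ C₂) (hθ : 0 < θ)
    (u : ℕ → Lp ℝ 2 (measureXBar lam θ C₁ C₂)) (hu : ∀ n, u n ∈ (formXBar lam θ C₁ C₂).dom)
    (hc : ∀ ε > 0, ∃ N, ∀ m ≥ N, ∀ n ≥ N, (formXBar lam θ C₁ C₂).normSq₁ (u m - u n) < ε) :
    ∃ v ∈ (formXBar lam θ C₁ C₂).dom,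
      Tendsto (fun n => (formXBar lam θ C₁ C₂).normSq₁ (u n - v)) atTop (𝓝 0) := by
  have hnn := A.conductance_nonneg
  have hle1 : ∀ w : Lp ℝ 2 (measureXBar lam θ C₁ C₂),
      ‖w‖ ^ 2 ≤ (formXBar lam θ C₁ C₂).normSq₁ w := fun w => by
    rw [formXBar_normSq₁]
    linarith [energy_self_nonneg hnn fun x => w (inclX lam C₁ C₂ x)]
  have hle2 : ∀ w : Lp ℝ 2 (measureXBar lam θ C₁ C₂),
      energy (conductance lam C₁ C₂) (fun x => w (inclX lam C₁ C₂ x))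
        (fun x => w (inclX lam C₁ C₂ x)) ≤ (formXBar lam θ C₁ C₂).normSq₁ w := fun w => by
    rw [formXBar_normSq₁]
    linarith [sq_nonneg ‖w‖]
  have hcs : CauchySeq u := by
    rw [Metric.cauchySeq_iff]
    intro ε hε
    obtain ⟨N, hN⟩ := hc (ε ^ 2) (by positivity)
    refine ⟨N, fun m hm n hn => ?_⟩
    rw [dist_eq_norm]
    exact lt_of_pow_lt_pow_left₀ 2 hε.le ((hle1 _).trans_lt (hN m hm n hn))
  obtain ⟨v, hv⟩ := cauchySeq_tendsto_of_complete hcs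
  have hnorm : Tendsto (fun n => ‖u n - v‖ ^ 2) atTop (𝓝 0) := by
    simpa using (tendsto_iff_norm_sub_tendsto_zero.1 hv).pow 2
  have hpt : ∀ x, Tendsto (fun n => u n (inclX lam C₁ C₂ x)) atTop (𝓝 (v (inclX lam C₁ C₂ x))) := by
    intro x
    rw [tendsto_iff_norm_sub_tendsto_zero]
    set w := (measureXBar lam θ C₁ C₂).real {inclX lam C₁ C₂ x} with hw
    have hw0 : 0 < w := by
      rw [hw, Measure.real, measureXBar_singleton, vertexMeasure_singleton]
      have := A.lam_pos
      rw [ENNReal.toReal_ofReal (by positivity)]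
      positivity
    have hsq : Tendsto (fun n => ‖u n (inclX lam C₁ C₂ x) - v (inclX lam C₁ C₂ x)‖ ^ 2)
        atTop (𝓝 0) := by
      refine squeeze_zero (fun n => sq_nonneg _) (fun n => ?_)
        (by simpa using hnorm.const_mul w⁻¹)
      have h := real_singleton_mul_sq_le (u n - v) (inclX lam C₁ C₂ x)
      rw [A.coe_sub hθ, ← hw] at h
      rw [Real.norm_eq_abs, sq_abs, inv_mul_eq_div, le_div_iff₀' hw0]
      exact h
    have := hsq.sqrt
    simpa [Real.sqrt_sq_eq_abs] using this
  -- Lower semicontinuity of the energy with `n` fixed and `m → ∞` turns the Cauchy bound into a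
  -- bound for the distance to the limit.
  have hdiff : ∀ ε > 0, ∃ N, ∀ n ≥ N,
      FiniteEnergy (conductance lam C₁ C₂)
        (fun x => u n (inclX lam C₁ C₂ x) - v (inclX lam C₁ C₂ x)) ∧
      energy (conductance lam C₁ C₂) (fun x => u n (inclX lam C₁ C₂ x) - v (inclX lam C₁ C₂ x))
        (fun x => u n (inclX lam C₁ C₂ x) - v (inclX lam C₁ C₂ x)) ≤ ε := by
    intro ε hε
    obtain ⟨N, hN⟩ := hc ε hε
    refine ⟨N, fun n hn => ?_⟩
    refine finiteEnergy_of_tendsto hnn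
      (u := fun m x => u n (inclX lam C₁ C₂ x) - u m (inclX lam C₁ C₂ x))
      (fun m => ((A.mem_dom_formXBar hθ).1 (hu n)).sub hnn ((A.mem_dom_formXBar hθ).1 (hu m)))
      (fun x => (hpt x).const_sub _) ?_
    filter_upwards [eventually_ge_atTop N] with m hm
    have h1 := hle2 (u n - u m)
    simp only [A.coe_sub hθ] at h1
    exact h1.trans (hN n hn m hm).le
  refine ⟨v, ?_, ?_⟩
  · rw [A.mem_dom_formXBar hθ]
    obtain ⟨N, hN⟩ := hdiff 1 one_pos
    have := ((A.mem_dom_formXBar hθ).1 (hu N)).sub hnn (hN N le_rfl).1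
    simpa using this
  · have hE : Tendsto (fun n => energy (conductance lam C₁ C₂)
        (fun x => u n (inclX lam C₁ C₂ x) - v (inclX lam C₁ C₂ x))
        (fun x => u n (inclX lam C₁ C₂ x) - v (inclX lam C₁ C₂ x))) atTop (𝓝 0) := by
      rw [Metric.tendsto_atTop]
      intro ε hε
      obtain ⟨N, hN⟩ := hdiff (ε / 2) (half_pos hε)
      refine ⟨N, fun n hn => ?_⟩
      rw [Real.dist_0_eq_abs, abs_of_nonneg (energy_self_nonneg hnn _)]
      exact (hN n hn).2.trans_lt (half_lt_self hε)
    have := hE.add hnorm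
    simp only [formXBar_normSq₁, A.coe_sub hθ]
    simpa using this

theorem abs_clip_sub_clip_le (s t a b : ℝ) : |min (max s a) b - min (max t a) b| ≤ |s - t| := by
  have h1 := abs_min_sub_min_le_max (max s a) b (max t a) b
  rw [sub_self, abs_zero, max_eq_left (abs_nonneg (max s a - max t a))] at h1
  exact h1.trans (abs_max_sub_max_le_abs s t a)

/-- The form on the Martin compactification is a regular Dirichlet form. -/
theorem Admissible.isRegularDirichletForm (A : Admissible lam C₁ C₂) (hθ : 0 < θ) (hθl : θ < lam) :
    (formXBar lam θ C₁ C₂).IsRegularDirichletForm := by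
  have hnn := A.conductance_nonneg
  have hfin := isFiniteMeasure_measureXBar (C₁ := C₁) (C₂ := C₂) A.lam_pos hθ hθl
  have hmem := fun {u} => A.mem_dom_formXBar (u := u) hθ
  have hcoe : ∀ (f : C(XBar lam C₁ C₂, ℝ)) (x : Word),
      ContinuousMap.toLp 2 (measureXBar lam θ C₁ C₂) ℝ f (inclX lam C₁ C₂ x) =
        f (inclX lam C₁ C₂ x) := fun f =>
    (ae_measureXBar_iff A.lam_pos hθ).1 (ContinuousMap.coeFn_toLp _ f)
  have hcore : ∀ f ∈ A.core, ContinuousMap.toLp 2 (measureXBar lam θ C₁ C₂) ℝ f ∈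
      (formXBar lam θ C₁ C₂).dom := fun f hf =>
    ⟨f, ContinuousMap.coeFn_toLp _ f, hf⟩
  refine { zero_mem := ?_, add_mem := ?_, smul_mem := ?_, dense := ?_, symm := ?_, add_left := ?_,
           smul_left := ?_, nonneg := ?_, closed := A.closed_formXBar hθ, markov := ?_,
           locallyCompact := inferInstance, separable := inferInstance,
           metrizable := inferInstance, finiteOnCompacts := inferInstance, fullSupport := ?_,
           core_dense := ?_, core_dense_unif := ?_ }
  · rw [hmem]
    simp only [A.coe_zero hθ]
    exact finiteEnergy_const 0
  · intro u hu v hv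
    rw [hmem] at *
    simp only [A.coe_add hθ]
    exact hu.add hnn hv
  · intro a u hu
    rw [hmem] at *
    simp only [A.coe_smul hθ]
    exact hu.smul a
  · have hd : DenseRange (ContinuousMap.toLp (E := ℝ) 2 (measureXBar lam θ C₁ C₂) ℝ) :=
      ContinuousMap.toLp_denseRange ℝ _ ℝ (by norm_num)
    have := hd.dense_image (ContinuousLinearMap.continuous _) A.core_dense
    refine this.mono ?_
    rintro _ ⟨f, hf, rfl⟩
    exact hcore f hf
  · intro u _ v _
    rw [formXBar_form, formXBar_form, energy_comm]
  · intro u hu v hv w hw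
    simp only [formXBar_form, A.coe_add hθ]
    exact energy_add_left hnn (hmem.1 hu) (hmem.1 hv) (hmem.1 hw)
  · intro a u _ v _
    simp only [formXBar_form, A.coe_smul hθ]
    exact energy_smul_left a _ _
  · intro u _
    rw [formXBar_form]
    exact energy_self_nonneg hnn _
  · rintro u ⟨f, huf, hf⟩
    let g : C(XBar lam C₁ C₂, ℝ) := ⟨fun ξ => min (max (f ξ) 0) 1, by fun_prop⟩
    have huf' := (ae_measureXBar_iff A.lam_pos hθ).1 huf
    have hfg : ∀ x y, |trace lam C₁ C₂ g x - trace lam C₁ C₂ g y| ≤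
        |trace lam C₁ C₂ f x - trace lam C₁ C₂ f y| := fun x y => abs_clip_sub_clip_le _ _ _ _
    refine ⟨ContinuousMap.toLp 2 _ ℝ g, hcore g (hf.of_le hnn hfg), ?_, ?_⟩
    · filter_upwards [ContinuousMap.coeFn_toLp (p := 2) (𝕜 := ℝ) (measureXBar lam θ C₁ C₂) g, huf]
        with ξ h1 h2
      rw [h1, h2]
      rfl
    · simp only [formXBar_form, hcoe, huf']
      exact energy_le hnn hf hfg
  · refine ⟨fun U hU hne h0 => ?_⟩
    obtain ⟨x, hx⟩ := (denseRange_martinIncl (walkX lam C₁ C₂) root).exists_mem_open hU hne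
    have h1 : measureXBar lam θ C₁ C₂ {inclX lam C₁ C₂ x} ≤ measureXBar lam θ C₁ C₂ U :=
      measure_mono (singleton_subset_iff.2 hx)
    rw [h0, measureXBar_singleton] at h1
    exact (vertexMeasure_singleton_pos A.lam_pos hθ x).not_ge h1
  · intro u hu ε hε
    obtain ⟨f, huf, hf⟩ := hu
    -- Every element of the domain is already continuous on a compact space, so `u` approximates
    -- itself.
    refine ⟨u, ⟨f, huf, hf⟩, ⟨f, HasCompactSupport.of_compactSpace _, huf⟩, ?_⟩
    rw [sub_self, formXBar_normSq₁]
    simp only [A.coe_zero hθ, norm_zero]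
    simpa [energy] using hε
  · intro f _ ε hε
    obtain ⟨g, hg, hfg⟩ := A.core_dense.exists_dist_lt f hε
    refine ⟨g, HasCompactSupport.of_compactSpace _,
      ⟨_, hcore g hg, ContinuousMap.coeFn_toLp _ g⟩, fun ξ => ?_⟩
    rw [← Real.dist_eq]
    exact (ContinuousMap.dist_apply_le_dist ξ).trans_lt hfg

end Word

end

noncomputable section

/-! ### Capacity and the part form -/

namespace Word

variable {lam θ C₁ C₂ : ℝ}

/-- Nonempty sets have capacity bounded below. -/
theorem Admissible.le_cap (A : Admissible lam C₁ C₂) (hθ : 0 < θ) {S : Set (XBar lam C₁ C₂)}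
    (hS : S.Nonempty) :
    ENNReal.ofReal ((1 / supConst lam C₁ C₂) ^ 2) ≤ (formXBar lam θ C₁ C₂).cap S := by
  refine le_iInf₂ fun U hU => le_iInf₂ fun u hu => ?_
  obtain ⟨hUo, hSU⟩ := hU
  obtain ⟨hu, hu1⟩ := hu
  obtain ⟨x, hx⟩ := (denseRange_martinIncl (walkX lam C₁ C₂) root).exists_mem_open hUo
    (hS.mono hSU)
  have h1 : 1 ≤ u (inclX lam C₁ C₂ x) := (ae_measureXBar_iff A.lam_pos hθ).1 hu1 x hx
  have h2 := A.abs_le_normSq₁ hθ hu x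
  have h3 := A.supConst_pos
  refine ENNReal.ofReal_le_ofReal ?_
  refine (Real.le_sqrt' (by positivity)).1 ?_
  rw [div_le_iff₀' h3]
  exact (h1.trans (le_abs_self _)).trans h2

theorem Admissible.le_cap_pos (A : Admissible lam C₁ C₂) :
    0 < ENNReal.ofReal ((1 / supConst lam C₁ C₂) ^ 2) := by
  have := A.supConst_pos
  exact ENNReal.ofReal_pos.2 (by positivity)

theorem Admissible.cap_empty (A : Admissible lam C₁ C₂) (hθ : 0 < θ) :
    (formXBar lam θ C₁ C₂).cap ∅ = 0 := by
  refine le_antisymm ?_ zero_le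
  refine (iInf₂_le ∅ ⟨isOpen_empty, empty_subset _⟩).trans ?_
  refine (iInf₂_le (0 : Lp ℝ 2 (measureXBar lam θ C₁ C₂)) ⟨?_, by simp⟩).trans ?_
  · rw [formXBar_normSq₁]
    simp only [A.coe_zero hθ]
    simp [energy]
  · rw [A.mem_dom_formXBar hθ]
    simp only [A.coe_zero hθ]
    exact finiteEnergy_const 0

/-- Vanishing quasi-everywhere means that the continuous version vanishes everywhere. -/
theorem Admissible.vanishesQEOn_iff (A : Admissible lam C₁ C₂) (hθ : 0 < θ)
    {u : Lp ℝ 2 (measureXBar lam θ C₁ C₂)} {f : C(XBar lam C₁ C₂, ℝ)}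
    (huf : ∀ x, u (inclX lam C₁ C₂ x) = f (inclX lam C₁ C₂ x)) (S : Set (XBar lam C₁ C₂)) :
    (formXBar lam θ C₁ C₂).VanishesQEOn u S ↔ ∀ ξ ∈ S, f ξ = 0 := by
  constructor
  · rintro ⟨f', hqc, hu, hcap⟩
    -- With tolerance equal to the lower bound for capacities of nonempty sets, the exceptional set
    -- must be empty.
    obtain ⟨G, -, hG, hcont⟩ := hqc _ A.le_cap_pos
    have hGe : G = ∅ := by
      by_contra h
      exact absurd (A.le_cap hθ (nonempty_iff_ne_empty.2 h)) (not_le.2 hG)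
    rw [hGe, compl_empty, continuousOn_univ] at hcont
    have hff : f' = f := by
      refine (denseRange_martinIncl (walkX lam C₁ C₂) root).equalizer hcont f.continuous ?_
      funext x
      have := (ae_measureXBar_iff A.lam_pos hθ).1 hu x
      exact this.symm.trans (huf x)
    intro ξ hξ
    by_contra h
    have := A.le_cap (θ := θ) hθ (S := {x ∈ S | f' x ≠ 0}) ⟨ξ, hξ, by rwa [hff]⟩
    rw [hcap] at this
    exact absurd this (not_le.2 A.le_cap_pos)
  · intro h
    refine ⟨f, fun ε hε => ⟨∅, isOpen_empty, by rwa [A.cap_empty hθ], ?_⟩,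
      (ae_measureXBar_iff A.lam_pos hθ).2 huf, ?_⟩
    · exact f.continuous.continuousOn
    · have : {x ∈ S | f x ≠ 0} = ∅ := by
        ext ξ
        simp only [mem_ofPred_eq, mem_empty_iff_false, iff_false, not_and, not_not]
        exact h ξ
      rw [this, A.cap_empty hθ]

/-- Limits of finitely supported functions vanish on the boundary. -/
theorem Admissible.eq_zero_of_mem_dom_formX (A : Admissible lam C₁ C₂) (hθ : 0 < θ) (hθl : θ < lam)
    {v : Lp ℝ 2 (vertexMeasure lam θ)} (hv : v ∈ (formX lam θ C₁ C₂).dom)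
    {f : C(XBar lam C₁ C₂, ℝ)} (hf : ∀ x, f (inclX lam C₁ C₂ x) = v x)
    {ξ : XBar lam C₁ C₂} (hξ : ξ ∉ range (inclX lam C₁ C₂)) : f ξ = 0 := by
  have hfin := isFiniteMeasure_vertexMeasure A.lam_pos hθ hθl
  have hnn := A.conductance_nonneg
  obtain ⟨hvE, φ, hφ, hlim⟩ := hv
  have hbound : ∀ n x, |φ n x - v x| ≤ supConst lam C₁ C₂ *
      Real.sqrt (energy (conductance lam C₁ C₂) (φ n - v) (φ n - v) +
        ∫ x, (φ n x - v x) ^ 2 ∂vertexMeasure lam θ) := by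
    intro n x
    -- Finite energy and integrability are checked because a divergent sum or integral has default
    -- value 0, and its convergence to 0 would carry no information.
    have hE : FiniteEnergy (conductance lam C₁ C₂) (φ n - v) :=
      (A.finiteEnergy_of_finite (hφ n)).sub hnn hvE
    obtain ⟨b, hb⟩ := A.exists_abs_le hE
    have hint : Integrable (fun x => (φ n x - v x) ^ 2) (vertexMeasure lam θ) := by
      refine Integrable.of_bound measurable_from_top.aestronglyMeasurable (b ^ 2)
        (Eventually.of_forall fun x => ?_)
      rw [Real.norm_eq_abs, abs_pow]
      exact pow_le_pow_left₀ (abs_nonneg _) (hb x) 2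
    have h1 := real_singleton_mul_le_integral hint (fun x => sq_nonneg _) root
    rw [real_root, one_mul] at h1
    have h2 := energy_self_nonneg hnn (φ n - v)
    have h3 : 0 ≤ ∫ x, (φ n x - v x) ^ 2 ∂vertexMeasure lam θ :=
      integral_nonneg fun x => sq_nonneg _
    exact A.abs_le_supConst hE (by rw [Pi.sub_apply]; linarith) (by linarith) x
  have hlim' := (hlim.sqrt).const_mul (supConst lam C₁ C₂)
  rw [Real.sqrt_zero, mul_zero] at hlim'
  have key : ∀ n, |f ξ| ≤ supConst lam C₁ C₂ *
      Real.sqrt (energy (conductance lam C₁ C₂) (φ n - v) (φ n - v) +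
        ∫ x, (φ n x - v x) ^ 2 ∂vertexMeasure lam θ) := by
    intro n
    set b := supConst lam C₁ C₂ *
      Real.sqrt (energy (conductance lam C₁ C₂) (φ n - v) (φ n - v) +
        ∫ x, (φ n x - v x) ^ 2 ∂vertexMeasure lam θ) with hb
    -- Removing the finite support of `φ n` keeps `ξ` in the closure of the remaining words, where
    -- `f = v` is bounded by the uniform distance from `φ n` to `v`.
    have hF : ((inclX lam C₁ C₂) '' Function.support (φ n)).Finite := (hφ n).image _
    have hmem : ξ ∈ ((inclX lam C₁ C₂) '' Function.support (φ n))ᶜ := fun ⟨x, _, hx⟩ =>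
      hξ ⟨x, hx⟩
    have hcl := (denseRange_martinIncl (walkX lam C₁ C₂) root).open_subset_closure_inter
      hF.isClosed.isOpen_compl hmem
    refine closure_minimal (t := {ζ | |f ζ| ≤ b}) ?_ (isClosed_le (by fun_prop) continuous_const)
      hcl
    rintro _ ⟨hx', x, rfl⟩
    have hx0 : φ n x = 0 := by
      by_contra h
      exact hx' ⟨x, h, rfl⟩
    have h1 := hbound n x
    rw [hx0, zero_sub, abs_neg, ← hf x] at h1
    exact h1
  have := ge_of_tendsto' hlim' key
  exact abs_nonpos_iff.1 this

/-- The set where `|f| ≥ ε` is compact and avoids the boundary, so it is a compact subset of the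
discrete space X. -/
theorem finite_of_vanishing {f : C(XBar lam C₁ C₂, ℝ)}
    (hf : ∀ ξ ∉ range (inclX lam C₁ C₂), f ξ = 0) {ε : ℝ} (hε : 0 < ε) :
    {x | ε ≤ |f (inclX lam C₁ C₂ x)|}.Finite := by
  have hcl : IsClosed {ξ : XBar lam C₁ C₂ | ε ≤ |f ξ|} := isClosed_le continuous_const (by fun_prop)
  have hsub : {ξ : XBar lam C₁ C₂ | ε ≤ |f ξ|} ⊆ range (inclX lam C₁ C₂) := by
    intro ξ hξ
    by_contra h
    have : ε ≤ |f ξ| := hξ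
    rw [hf ξ h, abs_zero] at this
    exact not_le.2 hε this
  have := ((isOpenEmbedding_martinIncl (walkX lam C₁ C₂) root).isInducing.isCompact_preimage_iff
    hsub).2 hcl.isCompact
  exact isCompact_iff_finite.1 this

/-- Functions of finite energy which vanish on the boundary are limits of finitely supported
functions. -/
theorem Admissible.mem_dom_formX (A : Admissible lam C₁ C₂) (hθ : 0 < θ) (hθl : θ < lam)
    {v : Lp ℝ 2 (vertexMeasure lam θ)} (hv : FiniteEnergy (conductance lam C₁ C₂) v)
    {f : C(XBar lam C₁ C₂, ℝ)} (hfv : ∀ x, v x = f (inclX lam C₁ C₂ x))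
    (hf : ∀ ξ ∉ range (inclX lam C₁ C₂), f ξ = 0) : v ∈ (formX lam θ C₁ C₂).dom := by
  have hfin := isFiniteMeasure_vertexMeasure A.lam_pos hθ hθl
  have hnn := A.conductance_nonneg
  set ε : ℕ → ℝ := fun n => 1 / ((n : ℝ) + 1) with hε
  have hε0 : ∀ n, 0 < ε n := fun n => by positivity
  have hεlim : Tendsto ε atTop (𝓝 0) := tendsto_one_div_add_atTop_nhds_zero_nat
  -- The approximants are `v - ψ n`: they vanish where `|v| < ε n`, hence have finite support.
  -- Clipping contracts increments, so the energy of `ψ n` tends to 0 by dominated convergence with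
  -- the energy of `v` as majorant.
  set ψ : ℕ → Word → ℝ := fun n x => min (max (v x) (-ε n)) (ε n) with hψ
  have hψle : ∀ n x, |ψ n x| ≤ ε n := fun n x => by
    have := hε0 n
    rw [abs_le]
    exact ⟨le_min (le_max_right _ _) (by linarith), min_le_right _ _⟩
  have hψlim : ∀ x, Tendsto (fun n => ψ n x) atTop (𝓝 0) := fun x =>
    squeeze_zero_norm (fun n => hψle n x) hεlim
  have hsub : ∀ n, (fun x => v x - ψ n x) - v = fun x => -ψ n x := fun n => by
    funext x
    simp
  refine ⟨hv, fun n x => v x - ψ n x, fun n => ?_, ?_⟩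
  · refine (finite_of_vanishing hf (hε0 n)).subset fun x hx => ?_
    by_contra h
    have h' : |v x| < ε n := by
      rw [hfv]
      exact not_le.1 h
    have := abs_lt.1 h'
    apply hx
    simp only [hψ]
    rw [max_eq_left this.1.le, min_eq_left this.2.le, sub_self]
  · rw [← add_zero (0 : ℝ)]
    refine Tendsto.add ?_ ?_
    · simp only [hsub, energy]
      have h := tendsto_tsum_of_dominated_convergence (𝓕 := atTop) hv
        (f := fun n (p : Word × Word) =>
          conductance lam C₁ C₂ p.1 p.2 * ((-ψ n p.1 - -ψ n p.2) * (-ψ n p.1 - -ψ n p.2)))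
        (g := fun _ => 0) (fun p => ?_) (Eventually.of_forall fun n p => ?_)
      · have h' := h.const_mul (1 / 2)
        rwa [tsum_zero, mul_zero] at h'
      · have h1 := ((hψlim p.1).neg.sub (hψlim p.2).neg)
        simpa using (h1.mul h1).const_mul (conductance lam C₁ C₂ p.1 p.2)
      · have h1 : |ψ n p.1 - ψ n p.2| ≤ |v p.1 - v p.2| := abs_clip_sub_clip_le _ _ _ _
        rw [Real.norm_eq_abs, abs_mul, abs_of_nonneg (hnn _ _)]
        refine mul_le_mul_of_nonneg_left ?_ (hnn _ _)
        rw [← sq_abs (v p.1 - v p.2), ← sq, abs_pow, neg_sub_neg, abs_sub_comm]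
        exact pow_le_pow_left₀ (abs_nonneg _) h1 2
    · have hlim : Tendsto (fun n => ε n ^ 2 * (vertexMeasure lam θ).real univ) atTop (𝓝 0) := by
        simpa using (hεlim.pow 2).mul_const ((vertexMeasure lam θ).real univ)
      refine squeeze_zero_norm (fun n => ?_) hlim
      refine norm_integral_le_of_norm_le_const (Eventually.of_forall fun x => ?_)
      rw [sub_sub_cancel_left, neg_sq, Real.norm_eq_abs, abs_pow]
      exact pow_le_pow_left₀ (abs_nonneg _) (hψle n x) 2

/-- The form on the vertices is the part form. -/
theorem Admissible.isPartForm (A : Admissible lam C₁ C₂) (hθ : 0 < θ) (hθl : θ < lam) :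
    (formXBar lam θ C₁ C₂).IsPartForm (inclX lam C₁ C₂) (formX lam θ C₁ C₂) where
  isOpenEmbedding := isOpenEmbedding_martinIncl _ _
  map_eq := by
    rw [← measureXBar, Measure.restrict_eq_self_of_ae_mem ae_mem_range_inclX]
  mem_dom_iff := by
    have hfin := isFiniteMeasure_measureXBar (C₁ := C₁) (C₂ := C₂) A.lam_pos hθ hθl
    intro v
    constructor
    · intro hv
      obtain ⟨f, hf⟩ := A.exists_extension hv.1
      have hu : ∀ x, ContinuousMap.toLp 2 (measureXBar lam θ C₁ C₂) ℝ f (inclX lam C₁ C₂ x) =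
          f (inclX lam C₁ C₂ x) :=
        (ae_measureXBar_iff A.lam_pos hθ).1 (ContinuousMap.coeFn_toLp _ f)
      refine ⟨ContinuousMap.toLp 2 (measureXBar lam θ C₁ C₂) ℝ f, ?_, ?_, ?_⟩
      · rw [A.mem_dom_formXBar hθ]
        simp only [hu, hf]
        exact hv.1
      · rw [A.vanishesQEOn_iff hθ hu]
        exact fun ξ hξ => A.eq_zero_of_mem_dom_formX hθ hθl hv hf hξ
      · exact Eventually.of_forall fun x => ((hu x).trans (hf x)).symm
    · rintro ⟨u, ⟨f, huf, hfE⟩, hvan, huv⟩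
      have huf' := (ae_measureXBar_iff A.lam_pos hθ).1 huf
      have huv' := (ae_vertexMeasure_iff A.lam_pos hθ).1 huv
      have hvf : ∀ x, v x = f (inclX lam C₁ C₂ x) := fun x => (huv' x).trans (huf' x)
      rw [A.vanishesQEOn_iff hθ huf'] at hvan
      refine A.mem_dom_formX hθ hθl ?_ hvf hvan
      rwa [show (v : Word → ℝ) = _ from funext hvf]
  form_eq := by
    intro v₁ v₂ u₁ _ u₂ _ _ _ h₁ h₂
    have h₁' := (ae_vertexMeasure_iff A.lam_pos hθ).1 h₁
    have h₂' := (ae_vertexMeasure_iff A.lam_pos hθ).1 h₂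
    rw [formXBar_form, formX]
    simp only [← h₁', ← h₂']

end Word

end

/-- For `lam ∈ (1/5, 1/3)`, `θ ∈ (0, lam)` and `C₁, C₂ > 0`, the form `(ℰ_X̄, ℱ_X̄)` is a regular
Dirichlet form on `L²(X̄; m)`, and `(ℰ_X, ℱ_X)` on `L²(X; m)` is its part form on the open set
`X ⊆ X̄`. -/
theorem mainTheorem12 (lam θ C₁ C₂ : ℝ) (hlam : lam ∈ Set.Ioo (1 / 5 : ℝ) (1 / 3))
    (hθ : θ ∈ Set.Ioo 0 lam) (hC₁ : 0 < C₁) (hC₂ : 0 < C₂) :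
    (formXBar lam θ C₁ C₂).IsRegularDirichletForm ∧
      (formXBar lam θ C₁ C₂).IsPartForm (inclX lam C₁ C₂) (formX lam θ C₁ C₂) := by
  have A : Word.Admissible lam C₁ C₂ := ⟨hlam.1, hlam.2, hC₁, hC₂⟩
  exact ⟨A.isRegularDirichletForm hθ.1 hθ.2, A.isPartForm hθ.1 hθ.2⟩
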